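/- Let $d>0$, $\Omega=\mathbb R\times(0,d)$, and for $n\ge 1$ put $\mu_n=(2n-1)^2\pi^2/(4d^2)$, $\chi_n^-(y)=\sqrt{2/d}\,\sin\big((2n-1)\tfrac{\pi y}{2d}\big)$, $\chi_n^+(y)=\sqrt{2/d}\,\cos\big((2n-1)\tfrac{\pi y}{2d}\big)$. Let $H=-\Delta$ in $L^2(\Omega)$ with domain the set of $u\in H^1(\Omega)$ with $\Delta u\in L^2(\Omega)$ and, in the sense of traces, $u(-x,0)=u(x,d)=\partial_yu(x,0)=\partial_yu(-x,d)=0$ for $x>0$. Let $\Delta_{DN}$ (resp. $\Delta_{ND}$) be the Laplacian in $L^2(\Omega)$ whose domain is the set of $u\in H^1(\Omega)$ with $\Delta u\in L^2(\Omega)$ satisfying the Dirichlet (resp. Neumann) condition on $y=0$ and the Neumann (resp. Dirichlet) condition on $y=d$. Fix $n_0\ge1$, let $M=\{k>0:\ \mu_n=k^2+\mu_{n_0}\text{ for some }n\ge1\}$, let $\alpha<\beta$ with $[\alpha,\beta]\subset(0,\infty)\setminus M$, and let $a\in C_0^\infty(\mathbb R)$ have support in $[\alpha,\beta]$. For $k\in[\alpha,\beta]$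 let $n_1$ be the largest $n$ with $\mu_n<\mu_{n_0}+k^2$ (it does not depend on $k$), $k_n=\sqrt{\mu_{n_0}-\mu_n+k^2}$ for $n\le n_1$, $\kappa_n=\sqrt{\mu_n-\mu_{n_0}-k^2}$ for $n>n_1$, and let $$f(k,x,y)=\begin{cases}e^{ikx}\chi^-_{n_0}(y)+\sum_{l=1}^{n_1}r_l(k)e^{-ik_lx}\chi_l^-(y)+\sum_{n>n_1}r_n(k)e^{\kappa_nx}\chi_n^-(y),&x<0,\\ \sum_{l=1}^{n_1}t_l(k)e^{ik_lx}\chi_l^+(y)+\sum_{n>n_1}t_n(k)e^{-\kappa_nx}\chi_n^+(y),&x>0,\end{cases}$$ where the complex coefficients satisfy $\sum_n n|r_n(k)|^2<\infty$, $\sum_n n|t_n(k)|^2<\infty$ and the matching conditions $$f(k,0^-,\cdot)=f(k,0^+,\cdot)\ \text{in }\mathcal H^{1/2},\qquad f_x(k,0^-,\cdot)=f_x(k,0^+,\cdot)\ \text{in }\mathcal H^{-1/2}.$$ Here $\mathcal H^{1/2}$ is the space of $g\in L^2(0,d)$ with $\sum_n n|(\chi_n^-,g)|^2<\infty$ and $\sum_n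 n|(\chi_n^+,g)|^2<\infty$, $\mathcal H^{-1/2}$ is its dual, and the one-sided traces $f(k,0^\pm,\cdot)$, $f_x(k,0^\pm,\cdot)$ are obtained by putting $x=0$ in the above series and in their termwise derivatives in $x$. Define $$\psi(t,x,y)=\int a(k)e^{-i(\mu_{n_0}+k^2)t}f(k,x,y)\,dk,\qquad \psi^-(t,x,y)=\int a(k)e^{-i(\mu_{n_0}+k^2)t}e^{ikx}\chi^-_{n_0}(y)\,dk,$$ $$\psi_{DN}(t,x,y)=\int a(k)e^{-i(\mu_{n_0}+k^2)t}\sum_{l=1}^{n_1}r_l(k)e^{-ik_lx}\chi_l^-(y)\,dk,\qquad \psi_{ND}(t,x,y)=\int a(k)e^{-i(\mu_{n_0}+k^2)t}\sum_{l=1}^{n_1}t_l(k)e^{ik_lx}\chi_l^+(y)\,dk.$$ Then these integrals converge absolutely for all $t\in\mathbb R$ and all $(x,y)\in\Omega$ with $x\ne0$. For every $t\in\mathbb R$, $\psi(t,\cdot,\cdot)\in\mathcal D(H)$, $\psi^-(t,\cdot,\cdot)\in\mathcal D(\Delta_{DN})$, $\psi_{DN}(t,\cdot,\cdot)\in\mathcal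 D(\Delta_{DN})$, $\psi_{ND}(t,\cdot,\cdot)\in\mathcal D(\Delta_{ND})$, and, with $\partial_t$ taken in the norm of $L^2(\Omega)$, $$i\partial_t\psi=H\psi,\qquad (i\partial_t+\Delta_{DN})\psi^-=0,\qquad (i\partial_t+\Delta_{DN})\psi_{DN}=0,\qquad (i\partial_t+\Delta_{ND})\psi_{ND}=0 .$$ -/

import Mathlib

open MeasureTheory Filter Topology Set
open scoped ContDiff ENNReal

noncomputable section

namespace Waveguide

/-! ### The waveguide and its Laplace operators -/

/-- The waveguide `Ω = ℝ × (0, d)`. -/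
def strip (d : ℝ) : Set (ℝ × ℝ) := univ ×ˢ Ioo 0 d

/-- The Hilbert space `L²(Ω)`. -/
abbrev L2Strip (d : ℝ) := Lp ℂ 2 (volume.restrict (strip d))

/-- Test functions on `Ω`: smooth, with compact support contained in `Ω`. -/
structure IsTest (d : ℝ) (φ : ℝ × ℝ → ℝ) : Prop where
  smooth : ContDiff ℝ ∞ φ
  compact : HasCompactSupport φ
  subset : tsupport φ ⊆ strip d

/-- `∂φ/∂x`. -/
def dx (φ : ℝ × ℝ → ℝ) : ℝ × ℝ → ℝ := fun z => fderiv ℝ φ z (1, 0)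

/-- `∂φ/∂y`. -/
def dy (φ : ℝ × ℝ → ℝ) : ℝ × ℝ → ℝ := fun z => fderiv ℝ φ z (0, 1)

/-- `g = ∂u/∂x` in the sense of distributions in `Ω`. -/
def HasWeakDx {d : ℝ} (u g : L2Strip d) : Prop :=
  ∀ φ, IsTest d φ → ∫ z in strip d, dx φ z • u z = -∫ z in strip d, φ z • g z

/-- `g = ∂u/∂y` in the sense of distributions in `Ω`. -/
def HasWeakDy {d : ℝ} (u g : L2Strip d) : Prop :=
  ∀ φ, IsTest d φ → ∫ z in strip d, dy φ z • u z = -∫ z in strip d, φ z • g z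

/-- `w = Δu` in the sense of distributions in `Ω`. -/
def HasWeakLaplacian {d : ℝ} (u w : L2Strip d) : Prop :=
  ∀ φ, IsTest d φ →
    ∫ z in strip d, (dx (dx φ) z + dy (dy φ) z) • u z = ∫ z in strip d, φ z • w z

/-- `u` has vanishing trace on the part `Γ` of one of the two boundary lines: a representative of
`u` satisfies `u(·, y) → 0` in `L²_loc(Γ)` as `y` tends to the boundary line. The filter `l` is
`𝓝[>] 0` for the lower line `y = 0` and `𝓝[<] d` for the upper line `y = d`. -/
def HasZeroTrace {d : ℝ} (u : L2Strip d) (Γ : Set ℝ) (l : Filter ℝ) : Prop :=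
  ∃ v : ℝ × ℝ → ℂ, Measurable v ∧ u =ᵐ[volume.restrict (strip d)] v ∧
    ∀ K : Set ℝ, IsCompact K → K ⊆ Γ →
      Tendsto (fun y => ∫⁻ x in K, ‖v (x, y)‖ₑ ^ 2) l (𝓝 0)

/-- The parts of the lower (`y = 0`) and upper (`y = d`) boundary lines on which the Dirichlet and
the Neumann boundary conditions are imposed, given by their `x`-coordinates. -/
structure BoundaryConditions where
  dirichletLower : Set ℝ
  neumannLower : Set ℝ
  dirichletUpper : Set ℝ
  neumannUpper : Set ℝ

/-- Dirichlet at `y = 0, x < 0` and `y = d, x > 0`; Neumann at `y = 0, x > 0` and `y = d, x < 0`. -/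
def combinedBC : BoundaryConditions := ⟨Iio 0, Ioi 0, Ioi 0, Iio 0⟩

/-- Dirichlet on the whole line `y = 0`, Neumann on the whole line `y = d`. -/
def dirichletNeumannBC : BoundaryConditions := ⟨univ, ∅, ∅, univ⟩

/-- Neumann on the whole line `y = 0`, Dirichlet on the whole line `y = d`. -/
def neumannDirichletBC : BoundaryConditions := ⟨∅, univ, univ, ∅⟩

/-- `u ∈ H¹(Ω)` with `Δu ∈ L²(Ω)`, where `u` vanishes on the Dirichlet part of the boundary and
`∂u/∂y` vanishes on the Neumann part. -/
def MemLaplaceDomain {d : ℝ} (B : BoundaryConditions) (u : L2Strip d) : Prop :=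
  ∃ ux uy w : L2Strip d, HasWeakDx u ux ∧ HasWeakDy u uy ∧ HasWeakLaplacian u w ∧
    HasZeroTrace u B.dirichletLower (𝓝[>] 0) ∧ HasZeroTrace u B.dirichletUpper (𝓝[<] d) ∧
    HasZeroTrace uy B.neumannLower (𝓝[>] 0) ∧ HasZeroTrace uy B.neumannUpper (𝓝[<] d)

/-! #### The Laplace operator is a well-defined linear operator in `L²(Ω)` -/

lemma contDiff_dx {φ : ℝ × ℝ → ℝ} (h : ContDiff ℝ ∞ φ) : ContDiff ℝ ∞ (dx φ) := by
  unfold dx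
  exact (h.fderiv_right (m := ∞) (by simp)).clm_apply contDiff_const

lemma contDiff_dy {φ : ℝ × ℝ → ℝ} (h : ContDiff ℝ ∞ φ) : ContDiff ℝ ∞ (dy φ) := by
  unfold dy
  exact (h.fderiv_right (m := ∞) (by simp)).clm_apply contDiff_const

lemma hasCompactSupport_dx {φ : ℝ × ℝ → ℝ} (h : HasCompactSupport φ) :
    HasCompactSupport (dx φ) := h.fderiv_apply ℝ _

lemma hasCompactSupport_dy {φ : ℝ × ℝ → ℝ} (h : HasCompactSupport φ) :
    HasCompactSupport (dy φ) := h.fderiv_apply ℝ _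

lemma integrable_smul {d : ℝ} {φ : ℝ × ℝ → ℝ} (h : Continuous φ) (hc : HasCompactSupport φ)
    (u : L2Strip d) : Integrable (fun z => φ z • u z) (volume.restrict (strip d)) := by
  rw [← memLp_one_iff_integrable]
  exact (Lp.memLp u).smul (h.memLp_of_hasCompactSupport hc (p := 2))

lemma pairing_comb {d : ℝ} {φ : ℝ × ℝ → ℝ} (h : Continuous φ) (hc : HasCompactSupport φ)
    (c : ℂ) (u v : L2Strip d) : ∫ z in strip d, φ z • (c • u + v) z =
      c * (∫ z in strip d, φ z • u z) + ∫ z in strip d, φ z • v z := by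
  rw [← integral_const_mul, ← integral_add ((integrable_smul h hc u).const_mul c)
    (integrable_smul h hc v)]
  refine integral_congr_ae ?_
  filter_upwards [Lp.coeFn_add (c • u) v, Lp.coeFn_smul c u] with z h1 h2
  rw [h1, Pi.add_apply, h2, Pi.smul_apply]
  simp only [Complex.real_smul, smul_eq_mul]
  ring

lemma HasWeakDx.comb {d : ℝ} {u v g k : L2Strip d} (c : ℂ) (hu : HasWeakDx u g)
    (hv : HasWeakDx v k) : HasWeakDx (c • u + v) (c • g + k) := by
  intro φ hφ
  rw [pairing_comb (contDiff_dx hφ.smooth).continuous (hasCompactSupport_dx hφ.compact),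
    pairing_comb hφ.smooth.continuous hφ.compact, hu φ hφ, hv φ hφ]
  ring

lemma HasWeakDy.comb {d : ℝ} {u v g k : L2Strip d} (c : ℂ) (hu : HasWeakDy u g)
    (hv : HasWeakDy v k) : HasWeakDy (c • u + v) (c • g + k) := by
  intro φ hφ
  rw [pairing_comb (contDiff_dy hφ.smooth).continuous (hasCompactSupport_dy hφ.compact),
    pairing_comb hφ.smooth.continuous hφ.compact, hu φ hφ, hv φ hφ]
  ring

lemma HasWeakLaplacian.comb {d : ℝ} {u v g k : L2Strip d} (c : ℂ) (hu : HasWeakLaplacian u g)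
    (hv : HasWeakLaplacian v k) : HasWeakLaplacian (c • u + v) (c • g + k) := by
  intro φ hφ
  rw [pairing_comb (φ := fun z => dx (dx φ) z + dy (dy φ) z)
      ((contDiff_dx (contDiff_dx hφ.smooth)).add (contDiff_dy (contDiff_dy hφ.smooth))).continuous
      ((hasCompactSupport_dx (hasCompactSupport_dx hφ.compact)).add
        (hasCompactSupport_dy (hasCompactSupport_dy hφ.compact))),
    pairing_comb hφ.smooth.continuous hφ.compact, hu φ hφ, hv φ hφ]

lemma HasZeroTrace.comb {d : ℝ} {u v : L2Strip d} {Γ : Set ℝ} {l : Filter ℝ} (c : ℂ)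
    (hu : HasZeroTrace u Γ l) (hv : HasZeroTrace v Γ l) : HasZeroTrace (c • u + v) Γ l := by
  obtain ⟨u', mu, eu, tu⟩ := hu
  obtain ⟨v', mv, ev, tv⟩ := hv
  refine ⟨fun z => c * u' z + v' z, (mu.const_mul c).add mv, ?_, fun K hK hKΓ => ?_⟩
  · filter_upwards [Lp.coeFn_add (c • u) v, Lp.coeFn_smul c u, eu, ev] with z h1 h2 h3 h4
    rw [h1, Pi.add_apply, h2, Pi.smul_apply, h3, h4, smul_eq_mul]
  · have key : ∀ y, ∫⁻ x in K, ‖c * u' (x, y) + v' (x, y)‖ₑ ^ 2 ≤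
        2 * ‖c‖ₑ ^ 2 * (∫⁻ x in K, ‖u' (x, y)‖ₑ ^ 2) + 2 * ∫⁻ x in K, ‖v' (x, y)‖ₑ ^ 2 := by
      intro y
      have m1 : Measurable fun x => ‖u' (x, y)‖ₑ ^ 2 := by fun_prop
      have m2 : Measurable fun x => ‖v' (x, y)‖ₑ ^ 2 := by fun_prop
      rw [← lintegral_const_mul _ m1, ← lintegral_const_mul _ m2,
        ← lintegral_add_left (m1.const_mul _)]
      refine lintegral_mono fun x => ?_
      calc ‖c * u' (x, y) + v' (x, y)‖ₑ ^ 2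
          ≤ (‖c * u' (x, y)‖ₑ + ‖v' (x, y)‖ₑ) ^ 2 := by gcongr; exact enorm_add_le _ _
        _ ≤ 2 * (‖c * u' (x, y)‖ₑ ^ 2 + ‖v' (x, y)‖ₑ ^ 2) := by
            have := ENNReal.rpow_add_le_mul_rpow_add_rpow ‖c * u' (x, y)‖ₑ ‖v' (x, y)‖ₑ
              (p := 2) (by norm_num)
            rw [show (2 : ℝ) - 1 = 1 by norm_num, ENNReal.rpow_one] at this
            exact_mod_cast this
        _ = _ := by rw [enorm_mul, mul_pow]; ring
    have lim : Tendsto (fun y => 2 * ‖c‖ₑ ^ 2 * (∫⁻ x in K, ‖u' (x, y)‖ₑ ^ 2) +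
        2 * ∫⁻ x in K, ‖v' (x, y)‖ₑ ^ 2) l (𝓝 0) := by
      have a1 := ENNReal.Tendsto.const_mul (a := 2 * ‖c‖ₑ ^ 2) (tu K hK hKΓ)
        (Or.inr (ENNReal.mul_ne_top (by norm_num) (by simp)))
      have a2 := ENNReal.Tendsto.const_mul (a := 2) (tv K hK hKΓ) (Or.inr (by norm_num))
      simpa using a1.add a2
    exact tendsto_of_tendsto_of_tendsto_of_le_of_le tendsto_const_nhds lim
      (fun _ => bot_le) key

lemma pairing_zero {d : ℝ} (φ : ℝ × ℝ → ℝ) :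
    ∫ z in strip d, φ z • (0 : L2Strip d) z = 0 := by
  refine integral_eq_zero_of_ae ?_
  filter_upwards [Lp.coeFn_zero ℂ 2 (volume.restrict (strip d))] with z hz
  rw [hz, Pi.zero_apply, smul_zero]

lemma hasZeroTrace_zero {d : ℝ} (Γ : Set ℝ) (l : Filter ℝ) :
    HasZeroTrace (0 : L2Strip d) Γ l :=
  ⟨fun _ => 0, measurable_const, Lp.coeFn_zero ℂ 2 _, fun K _ _ => by simpa using tendsto_const_nhds⟩

lemma MemLaplaceDomain.comb {d : ℝ} {B : BoundaryConditions} {u v : L2Strip d} (c : ℂ)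
    (hu : MemLaplaceDomain B u) (hv : MemLaplaceDomain B v) : MemLaplaceDomain B (c • u + v) := by
  obtain ⟨ux, uy, w, h1, h2, h3, h4, h5, h6, h7⟩ := hu
  obtain ⟨vx, vy, k, g1, g2, g3, g4, g5, g6, g7⟩ := hv
  exact ⟨c • ux + vx, c • uy + vy, c • w + k, h1.comb c g1, h2.comb c g2, h3.comb c g3,
    h4.comb c g4, h5.comb c g5, h6.comb c g6, h7.comb c g7⟩

lemma memLaplaceDomain_zero {d : ℝ} (B : BoundaryConditions) :
    MemLaplaceDomain B (0 : L2Strip d) :=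
  ⟨0, 0, 0, fun φ _ => by simp only [pairing_zero, neg_zero],
    fun φ _ => by simp only [pairing_zero, neg_zero],
    fun φ _ => by
      rw [pairing_zero φ]; exact pairing_zero fun z => dx (dx φ) z + dy (dy φ) z,
    hasZeroTrace_zero _ _, hasZeroTrace_zero _ _, hasZeroTrace_zero _ _, hasZeroTrace_zero _ _⟩

lemma isOpen_strip (d : ℝ) : IsOpen (strip d) := isOpen_univ.prod isOpen_Ioo

lemma HasWeakLaplacian.unique {d : ℝ} {u w w' : L2Strip d} (h : HasWeakLaplacian u w)
    (h' : HasWeakLaplacian u w') : w = w' := by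
  rw [← sub_eq_zero]
  have hloc : LocallyIntegrableOn (w - w' : L2Strip d) (strip d) (volume.restrict (strip d)) :=
    ((Lp.memLp (w - w')).locallyIntegrable (by norm_num)).locallyIntegrableOn _
  have := (isOpen_strip d).ae_eq_zero_of_integral_contDiff_smul_eq_zero hloc
    (fun φ h1 h2 h3 => by
      have e := pairing_comb h1.continuous h2 (-1) w' w
      have e1 := h φ ⟨h1, h2, h3⟩
      have e2 := h' φ ⟨h1, h2, h3⟩
      rw [← e1, ← e2] at e
      rw [show w - w' = (-1 : ℂ) • w' + w by rw [neg_one_smul]; abel, e]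
      ring)
  refine Lp.ext ?_
  filter_upwards [this, ae_restrict_mem (isOpen_strip d).measurableSet,
    Lp.coeFn_zero ℂ 2 (volume.restrict (strip d))] with z h1 h2 h3
  rw [h1 h2, h3, Pi.zero_apply]

/-- The domain of the Laplace operator with boundary conditions `B`, as a subspace of `L²(Ω)`. -/
def laplaceDomain (d : ℝ) (B : BoundaryConditions) : Submodule ℂ (L2Strip d) where
  carrier := {u | MemLaplaceDomain B u}
  add_mem' := fun {u v} hu hv => by
    have := MemLaplaceDomain.comb 1 hu hv
    rwa [one_smul] at this
  zero_mem' := memLaplaceDomain_zero B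
  smul_mem' := fun c u hu => by
    have := MemLaplaceDomain.comb c hu (memLaplaceDomain_zero B)
    rwa [add_zero] at this

lemma exists_weakLaplacian {d : ℝ} {B : BoundaryConditions} (u : laplaceDomain d B) :
    ∃ w : L2Strip d, HasWeakLaplacian (u : L2Strip d) w := by
  obtain ⟨_, _, w, _, _, h, _⟩ := u.2
  exact ⟨w, h⟩

/-- The Laplace operator `Δ` in `L²(Ω)` with boundary conditions `B`: the unbounded operator with
domain `laplaceDomain d B` which maps `u` to its distributional Laplacian. -/
def laplaceOp (d : ℝ) (B : BoundaryConditions) : L2Strip d →ₗ.[ℂ] L2Strip d where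
  domain := laplaceDomain d B
  toFun :=
    { toFun := fun u => (exists_weakLaplacian u).choose
      map_add' := fun u v => by
        have h := (exists_weakLaplacian u).choose_spec.comb 1 (exists_weakLaplacian v).choose_spec
        rw [one_smul, one_smul] at h
        exact (exists_weakLaplacian (u + v)).choose_spec.unique h
      map_smul' := fun c u => by
        have h := (exists_weakLaplacian u).choose_spec.comb c
          (exists_weakLaplacian (0 : laplaceDomain d B)).choose_spec
        have h0 : HasWeakLaplacian ((0 : laplaceDomain d B) : L2Strip d) 0 := fun φ _ => by
          rw [pairing_zero φ]; exact pairing_zero fun z => dx (dx φ) z + dy (dy φ) z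
        rw [(exists_weakLaplacian (0 : laplaceDomain d B)).choose_spec.unique h0, add_zero,
          ZeroMemClass.coe_zero, add_zero] at h
        exact (exists_weakLaplacian (c • u)).choose_spec.unique h }

lemma laplaceOp_spec {d : ℝ} {B : BoundaryConditions} (u : (laplaceOp d B).domain) :
    HasWeakLaplacian (u : L2Strip d) (laplaceOp d B u) :=
  (exists_weakLaplacian u).choose_spec

/-- The Hamiltonian `H = -Δ` with the combined Dirichlet/Neumann boundary conditions. -/
def hamiltonian (d : ℝ) : L2Strip d →ₗ.[ℂ] L2Strip d := -laplaceOp d combinedBC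

/-- The Laplace operator `Δ_DN`. -/
def laplaceDN (d : ℝ) : L2Strip d →ₗ.[ℂ] L2Strip d := laplaceOp d dirichletNeumannBC

/-- The Laplace operator `Δ_ND`. -/
def laplaceND (d : ℝ) : L2Strip d →ₗ.[ℂ] L2Strip d := laplaceOp d neumannDirichletBC

/-- `ψ(t, ·, ·)` is in the domain of `A` for each `t`, and `i ∂ψ/∂t = A ψ`, where the derivative
with respect to `t` is taken in the norm of `L²(Ω)`. -/
def SolvesSchrodinger {d : ℝ} (A : L2Strip d →ₗ.[ℂ] L2Strip d) (ψ : ℝ → ℝ → ℝ → ℂ) : Prop :=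
  ∃ Ψ : ℝ → L2Strip d,
    (∀ t, Ψ t =ᵐ[volume.restrict (strip d)] fun z => ψ t z.1 z.2) ∧
    ∀ t, ∃ h : Ψ t ∈ A.domain, ∃ Ψ' : L2Strip d,
      HasDerivAt Ψ Ψ' t ∧ Complex.I • Ψ' = A ⟨Ψ t, h⟩

/-! ### Transversal modes and generalized eigenfunctions -/

/-- The transversal eigenvalue `μ_n = (2n-1)² π² / (4d²)`, for `n ≥ 1`. -/
def mu (d : ℝ) (n : ℕ) : ℝ := (2 * (n : ℝ) - 1) ^ 2 * Real.pi ^ 2 / (4 * d ^ 2)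

/-- The transversal mode `χ⁻_n`, for `n ≥ 1`. -/
def chiMinus (d : ℝ) (n : ℕ) (y : ℝ) : ℂ :=
  (√(2 / d) * Real.sin ((2 * (n : ℝ) - 1) * (Real.pi * y / (2 * d))) : ℝ)

/-- The transversal mode `χ⁺_n`, for `n ≥ 1`. -/
def chiPlus (d : ℝ) (n : ℕ) (y : ℝ) : ℂ :=
  (√(2 / d) * Real.cos ((2 * (n : ℝ) - 1) * (Real.pi * y / (2 * d))) : ℝ)

/-- The Hilbert space `L²(0, d)`. -/
abbrev L2Interval (d : ℝ) := Lp ℂ 2 (volume.restrict (Ioo 0 d))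

lemma memLp_of_continuous {d : ℝ} {f : ℝ → ℂ} (hf : Continuous f) :
    MemLp f 2 (volume.restrict (Ioo 0 d)) := by
  obtain ⟨C, hC⟩ := isCompact_Icc.exists_bound_of_continuousOn (hf.continuousOn (s := Icc 0 d))
  refine MemLp.of_bound hf.aestronglyMeasurable C ?_
  filter_upwards [ae_restrict_mem measurableSet_Ioo] with y hy
  exact hC y (Ioo_subset_Icc_self hy)

/-- `χ⁻_n` as an element of `L²(0, d)`. -/
def chiMinusL2 (d : ℝ) (n : ℕ) : L2Interval d :=
  (memLp_of_continuous (f := chiMinus d n) (by unfold chiMinus; fun_prop)).toLp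

/-- `χ⁺_n` as an element of `L²(0, d)`. -/
def chiPlusL2 (d : ℝ) (n : ℕ) : L2Interval d :=
  (memLp_of_continuous (f := chiPlus d n) (by unfold chiPlus; fun_prop)).toLp

/-- The space `𝓗^{1/2} = 𝓗₋^{1/2} ∩ 𝓗₊^{1/2}`. -/
def HHalf (d : ℝ) : Set (L2Interval d) :=
  {g | Summable (fun n : ℕ => (n : ℝ) * ‖inner ℂ (chiMinusL2 d n) g‖ ^ 2) ∧
    Summable (fun n : ℕ => (n : ℝ) * ‖inner ℂ (chiPlusL2 d n) g‖ ^ 2)}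

/-- The thresholds: the `k > 0` with `μ_n = k² + μ_{n₀}` for some `n ≥ 1`. -/
def thresholds (d : ℝ) (n₀ : ℕ) : Set ℝ := {k | 0 < k ∧ ∃ n : ℕ, 1 ≤ n ∧ mu d n = k ^ 2 + mu d n₀}

/-- The index `n₁(k)` of the highest excited transversal mode. -/
def nExc (d : ℝ) (n₀ : ℕ) (k : ℝ) : ℕ :=
  ⌊1 / 2 + √(((n₀ : ℝ) - 1 / 2) ^ 2 + d ^ 2 / Real.pi ^ 2 * k ^ 2)⌋₊

/-- `k_n`, for `1 ≤ n ≤ n₁(k)`. -/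
def waveNumber (d : ℝ) (n₀ : ℕ) (k : ℝ) (n : ℕ) : ℝ := √(mu d n₀ - mu d n + k ^ 2)

/-- `κ_n`, for `n > n₁(k)`. -/
def decayRate (d : ℝ) (n₀ : ℕ) (k : ℝ) (n : ℕ) : ℝ := √(mu d n - mu d n₀ - k ^ 2)

/-- The reflected part `∑_{l=1}^{n₁} r_l e^{-i k_l x} χ⁻_l(y)`. -/
def reflectedWave (d : ℝ) (n₀ : ℕ) (k : ℝ) (r : ℕ → ℂ) (x y : ℝ) : ℂ :=
  ∑ l ∈ Finset.Icc 1 (nExc d n₀ k),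
    r l * Complex.exp (-Complex.I * waveNumber d n₀ k l * x) * chiMinus d l y

/-- The transmitted part `∑_{l=1}^{n₁} t_l e^{i k_l x} χ⁺_l(y)`. -/
def transmittedWave (d : ℝ) (n₀ : ℕ) (k : ℝ) (t : ℕ → ℂ) (x y : ℝ) : ℂ :=
  ∑ l ∈ Finset.Icc 1 (nExc d n₀ k),
    t l * Complex.exp (Complex.I * waveNumber d n₀ k l * x) * chiPlus d l y

/-- The incident wave `e^{ikx} χ⁻_{n₀}(y)`. -/
def incidentWave (d : ℝ) (n₀ : ℕ) (k x y : ℝ) : ℂ :=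
  Complex.exp (Complex.I * k * x) * chiMinus d n₀ y

/-- The function `f(k, x, y)` with coefficients `r`, `t` (`r 0` and `t 0` are not used). The null
set `x = 0` is irrelevant. -/
def eigenfunction (d : ℝ) (n₀ : ℕ) (k : ℝ) (r t : ℕ → ℂ) (x y : ℝ) : ℂ :=
  if x < 0 then
    incidentWave d n₀ k x y + reflectedWave d n₀ k r x y +
      ∑' m : ℕ, r (nExc d n₀ k + 1 + m) *
        Complex.exp (decayRate d n₀ k (nExc d n₀ k + 1 + m) * x) *
        chiMinus d (nExc d n₀ k + 1 + m) y
  else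
    transmittedWave d n₀ k t x y +
      ∑' m : ℕ, t (nExc d n₀ k + 1 + m) *
        Complex.exp (-decayRate d n₀ k (nExc d n₀ k + 1 + m) * x) *
        chiPlus d (nExc d n₀ k + 1 + m) y

/-- The coefficient at `χ⁻_n` of the one-sided trace `f(k, 0⁻, ·)`. -/
def leftTrace (n₀ : ℕ) (r : ℕ → ℂ) (n : ℕ) : ℂ := (if n = n₀ then 1 else 0) + r n

/-- The coefficient at `χ⁻_n` of the one-sided normal derivative `f_x(k, 0⁻, ·)`. -/
def leftDerivTrace (d : ℝ) (n₀ : ℕ) (k : ℝ) (r : ℕ → ℂ) (n : ℕ) : ℂ :=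
  (if n = n₀ then Complex.I * k else 0) +
    if n ≤ nExc d n₀ k then -Complex.I * waveNumber d n₀ k n * r n
    else decayRate d n₀ k n * r n

/-- The coefficient at `χ⁺_n` of the one-sided normal derivative `f_x(k, 0⁺, ·)`. -/
def rightDerivTrace (d : ℝ) (n₀ : ℕ) (k : ℝ) (t : ℕ → ℂ) (n : ℕ) : ℂ :=
  if n ≤ nExc d n₀ k then Complex.I * waveNumber d n₀ k n * t n
  else -decayRate d n₀ k n * t n

/-- `r` and `t` are the reflection and transmission coefficients of the generalized eigenfunction
`f(k, ·, ·)`: it is locally of class `H¹` on both sides of `x = 0`, and satisfies the matching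
conditions `f(k, 0⁻, ·) = f(k, 0⁺, ·)` in `𝓗^{1/2} ⊆ L²(0, d)` and
`f_x(k, 0⁻, ·) = f_x(k, 0⁺, ·)` in `𝓗^{-1/2}`, the dual space of `𝓗^{1/2}`. -/
structure IsScatteringSolution (d : ℝ) (n₀ : ℕ) (k : ℝ) (r t : ℕ → ℂ) : Prop where
  summable_left : Summable fun n : ℕ => (n : ℝ) * ‖r n‖ ^ 2
  summable_right : Summable fun n : ℕ => (n : ℝ) * ‖t n‖ ^ 2
  matching : ∃ φ : L2Interval d,
    HasSum (fun m : ℕ => leftTrace n₀ r (m + 1) • chiMinusL2 d (m + 1)) φ ∧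
    HasSum (fun m : ℕ => t (m + 1) • chiPlusL2 d (m + 1)) φ
  matching_deriv : ∀ g ∈ HHalf d,
    ∑' m : ℕ, star (leftDerivTrace d n₀ k r (m + 1)) * inner ℂ (chiMinusL2 d (m + 1)) g =
      ∑' m : ℕ, star (rightDerivTrace d n₀ k t (m + 1)) * inner ℂ (chiPlusL2 d (m + 1)) g

/-! ### Wave packets -/

/-- The integrand `a(k) e^{-i(μ_{n₀} + k²)t} F(k, x, y)` of a wave packet. -/
def packetIntegrand (d : ℝ) (n₀ : ℕ) (a : ℝ → ℂ) (F : ℝ → ℝ → ℝ → ℂ) (t x y k : ℝ) : ℂ :=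
  a k * Complex.exp (-Complex.I * (mu d n₀ + k ^ 2) * t) * F k x y

/-- The integral `∫ a(k) e^{-i(μ_{n₀} + k²)t} F(k, x, y) dk` converges absolutely for all `t` and
all `(x, y) ∈ Ω` with `x ≠ 0`. -/
def PacketConverges (d : ℝ) (n₀ : ℕ) (a : ℝ → ℂ) (F : ℝ → ℝ → ℝ → ℂ) : Prop :=
  ∀ t x y, x ≠ 0 → y ∈ Ioo 0 d → Integrable (packetIntegrand d n₀ a F t x y)

/-- The wave packet `∫ a(k) e^{-i(μ_{n₀} + k²)t} F(k, x, y) dk`. -/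
def packet (d : ℝ) (n₀ : ℕ) (a : ℝ → ℂ) (F : ℝ → ℝ → ℝ → ℂ) (t x y : ℝ) : ℂ :=
  ∫ k, packetIntegrand d n₀ a F t x y k

/-- The wave packet built from the functions `F(k, ·, ·)` is well defined, lies in the domain of
`A` at each time, and satisfies the Schrödinger equation with Hamiltonian `A`. -/
def PacketSolves (d : ℝ) (n₀ : ℕ) (a : ℝ → ℂ) (A : L2Strip d →ₗ.[ℂ] L2Strip d)
    (F : ℝ → ℝ → ℝ → ℂ) : Prop :=
  PacketConverges d n₀ a F ∧ SolvesSchrodinger A (packet d n₀ a F)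

end Waveguide

set_option linter.unusedSectionVars false

/-! The proof separates variables. Count the channels from `0`, so that the `m`-th mode has
transversal frequency λ_m with λ_m² = μ_{m+1}, and let σ_m be -i k_{m+1} in an open channel and
κ_{m+1} in a closed one. In both cases σ_m² = λ_m² - E(k) with E(k) = μ_{n₀} + k², hence e^{±σ_m x}
times the mode satisfies Δu = -E(k)u away from x = 0. Integrating over k against an amplitude b
gives a packet T b, linear in b ∈ C([α,β]), with ΔT b = -T(E b). The amplitude a e^{-itE} is an
exponential curve in the Banach algebra C([α,β]), so for bounded T the chain rule gives the
Schrödinger equation in the norm of L²(Ω) (`packetSolves_of_clm`). It remains to show that T is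
bounded into L²(Ω), that T b is in the domain, and that nothing is lost at x = 0.

No regularity in k of the coefficients is assumed; it comes from the matching conditions. Tested
against g, they read ∑ conj(σ_m) ⟨v_m, g_m⟩ = 2ik (χ⁻_{n₀}, g), where v_m and g_m are the pairs of
coefficients of the trace and of g in the two mode systems. The numbers conj(σ_m) lie on the
nonnegative real and imaginary half-axes and have modulus at least c(m+1), because [α,β] contains no
threshold; the form is therefore coercive in 𝓗^{1/2}. Testing with the trace itself bounds it in
𝓗^{1/2} uniformly in k (`exists_traceVec_bound`); testing the identities for k and k' with the
difference of the traces shows that the trace is Lipschitz in k (`exists_traceVec_lipschitz`).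

The L² bounds are made channel by channel. In an open channel the packet is a Fourier transform
after the substitution ξ = ∓k_m/(2π), and Plancherel applies (`exists_wave_bound`). In a closed
channel the waves decay like e^{-κ(m+1)|x|}, which gains a factor (m+1)^{-1/2} in L². With the
𝓗^{1/2} bound the norms of the gradients of the channels are square summable, and orthogonality of
the modes makes the gradients summable. Both estimates are collected in `ModeFamily`.

Green's formula on each half-strip leaves boundary terms on x = 0; summed over channels and sides
they are the matching conditions integrated against b, and they cancel (`packetSolves_of_matching`).
The conditions on y = 0 and y = d hold mode by mode, and pass to the sum since the closed channels
decay geometrically on compact sets away from x = 0. -/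

namespace Waveguide

/-! ### Transversal modes -/

/-- The transversal frequency `√μ_{m+1} = (2m+1)π/(2d)`. -/
def lam (d : ℝ) (m : ℕ) : ℝ := (2 * (m : ℝ) + 1) * Real.pi / (2 * d)

lemma mu_succ (d : ℝ) (m : ℕ) : mu d (m + 1) = lam d m ^ 2 := by
  unfold mu lam
  push_cast
  rw [div_pow]
  congr 1 <;> ring

lemma lam_pos {d : ℝ} (hd : 0 < d) (m : ℕ) : 0 < lam d m := by
  unfold lam
  positivity

/-- An orthonormal system of transversal modes `χ m`, with normalised derivatives `η m`. -/
structure Transverse (d : ℝ) (χ η : ℕ → ℝ → ℂ) : Prop where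
  deriv_left : ∀ m y, HasDerivAt (χ m) (lam d m * η m y) y
  deriv_right : ∀ m y, HasDerivAt (η m) (-(lam d m * χ m y)) y
  real_left : ∀ m y, star (χ m y) = χ m y
  real_right : ∀ m y, star (η m y) = η m y
  orth_left : ∀ m n, ∫ y in Ioo 0 d, χ m y * χ n y = if m = n then 1 else 0
  orth_right : ∀ m n, ∫ y in Ioo 0 d, η m y * η n y = if m = n then 1 else 0
  bound_left : ∀ m y, ‖χ m y‖ ≤ √(2 / d)
  bound_right : ∀ m y, ‖η m y‖ ≤ √(2 / d)

/-- Differentiation rotates the pair: (χ, η) becomes (η, -χ). Each fact below is therefore proved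
only for the left system, and the χ⁺ system comes for free from the χ⁻ system. -/
lemma Transverse.symm {d : ℝ} {χ η : ℕ → ℝ → ℂ} (h : Transverse d χ η) :
    Transverse d η (fun m y => -χ m y) where
  deriv_left m y := by simpa using h.deriv_right m y
  deriv_right m y := (h.deriv_left m y).neg
  real_left := h.real_right
  real_right m y := by rw [star_neg, h.real_left]
  orth_left := h.orth_right
  orth_right m n := by simpa using h.orth_left m n
  bound_left := h.bound_right
  bound_right m y := by simpa using h.bound_left m y

lemma Transverse.continuous_left {d : ℝ} {χ η : ℕ → ℝ → ℂ} (h : Transverse d χ η) (m : ℕ) :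
    Continuous (χ m) :=
  continuous_iff_continuousAt.2 fun y => (h.deriv_left m y).continuousAt

lemma Transverse.continuous_right {d : ℝ} {χ η : ℕ → ℝ → ℂ} (h : Transverse d χ η) (m : ℕ) :
    Continuous (η m) := h.symm.continuous_left m

/-- Quantifies the vanishing of a mode near a boundary line where it is zero. The loss of one factor
λ_m is repaid later by the decay of the profiles in x. -/
lemma Transverse.lipschitz {d : ℝ} (hd : 0 < d) {χ η : ℕ → ℝ → ℂ} (h : Transverse d χ η) (m : ℕ)
    (y y' : ℝ) : ‖χ m y - χ m y'‖ ≤ lam d m * √(2 / d) * |y - y'| := by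
  refine Convex.norm_image_sub_le_of_norm_hasDerivWithin_le (s := univ)
    (fun z _ => (h.deriv_left m z).hasDerivWithinAt) (fun z _ => ?_) convex_univ
    (mem_univ _) (mem_univ _)
  rw [norm_mul, Complex.norm_real, Real.norm_of_nonneg (lam_pos hd m).le]
  exact mul_le_mul_of_nonneg_left (h.bound_right m z) (lam_pos hd m).le

lemma integral_cos_int {d : ℝ} (hd : 0 < d) (j : ℤ) :
    ∫ y in (0 : ℝ)..d, Real.cos (j * (Real.pi * y / d)) = if j = 0 then d else 0 := by
  split_ifs with hj
  · simp [hj]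
  · have hj' : (j : ℝ) ≠ 0 := by exact_mod_cast hj
    have hc : (j : ℝ) * Real.pi / d ≠ 0 := by have := Real.pi_ne_zero; positivity
    have : ∀ y : ℝ, (j : ℝ) * (Real.pi * y / d) = (j * Real.pi / d) * y := fun y => by ring
    simp_rw [this]
    rw [intervalIntegral.integral_comp_mul_left (fun y => Real.cos y) hc, integral_cos,
      mul_zero, Real.sin_zero, sub_zero, div_mul_cancel₀ _ hd.ne', Real.sin_int_mul_pi, smul_zero]

/-- The product-to-sum form of the orthogonality relations, with s = -1 for sines and s = 1 for
cosines. The sum frequency m + n + 1 never vanishes, so only the difference frequency can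
contribute. -/
lemma chi_orth_aux {d : ℝ} (hd : 0 < d) (s : ℝ) (m n : ℕ) :
    ∫ y in Ioo 0 d, (1 / d) * (Real.cos (((m : ℤ) - n : ℤ) * (Real.pi * y / d)) +
      s * Real.cos (((m : ℤ) + n + 1 : ℤ) * (Real.pi * y / d))) = if m = n then 1 else 0 := by
  rw [← integral_Ioc_eq_integral_Ioo, ← intervalIntegral.integral_of_le hd.le,
    intervalIntegral.integral_const_mul, intervalIntegral.integral_add
      (by apply Continuous.intervalIntegrable; fun_prop)
      (by apply Continuous.intervalIntegrable; fun_prop),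
    intervalIntegral.integral_const_mul, integral_cos_int hd, integral_cos_int hd,
    if_neg (by omega : ¬ ((m : ℤ) + n + 1 = 0))]
  by_cases h : m = n
  · subst h; simp [hd.ne']
  · rw [if_neg (by omega), if_neg h]; simp

lemma transverse_minus {d : ℝ} (hd : 0 < d) :
    Transverse d (fun m => chiMinus d (m + 1)) (fun m => chiPlus d (m + 1)) := by
  have e : ∀ (m : ℕ) (y : ℝ),
      (2 * ((m + 1 : ℕ) : ℝ) - 1) * (Real.pi * y / (2 * d)) = lam d m * y := by
    intro m y; unfold lam; push_cast; ring
  have sq : √(2 / d) * √(2 / d) = 2 / d := Real.mul_self_sqrt (by positivity)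
  have pm : ∀ (m n : ℕ) (y : ℝ), (((m : ℤ) - n : ℤ) : ℝ) * (Real.pi * y / d) =
      lam d m * y - lam d n * y := by
    intro m n y; unfold lam; push_cast; field_simp; ring
  have pp : ∀ (m n : ℕ) (y : ℝ), (((m : ℤ) + n + 1 : ℤ) : ℝ) * (Real.pi * y / d) =
      lam d m * y + lam d n * y := by
    intro m n y; unfold lam; push_cast; field_simp; ring
  refine ⟨fun m y => ?_, fun m y => ?_, fun m y => ?_, fun m y => ?_, fun m n => ?_,
    fun m n => ?_, fun m y => ?_, fun m y => ?_⟩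
  · unfold chiMinus chiPlus
    simp only [e]
    have := ((((hasDerivAt_id y).const_mul (lam d m)).sin).const_mul √(2 / d)).ofReal_comp
    convert! this using 1
    push_cast; simp; ring
  · unfold chiMinus chiPlus
    simp only [e]
    have := ((((hasDerivAt_id y).const_mul (lam d m)).cos).const_mul √(2 / d)).ofReal_comp
    convert! this using 1
    push_cast; simp; ring
  · exact Complex.conj_ofReal _
  · exact Complex.conj_ofReal _
  · rw [← Complex.ofReal_one, ← Complex.ofReal_zero, ← apply_ite Complex.ofReal,
      ← chi_orth_aux hd (-1) m n, ← integral_complex_ofReal]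
    refine integral_congr_ae (ae_of_all _ fun y => ?_)
    unfold chiMinus
    simp only [e, pm, pp, Real.cos_sub, Real.cos_add]
    rw [← Complex.ofReal_mul]
    congr 1
    linear_combination (Real.sin (lam d m * y) * Real.sin (lam d n * y)) * sq
  · rw [← Complex.ofReal_one, ← Complex.ofReal_zero, ← apply_ite Complex.ofReal,
      ← chi_orth_aux hd 1 m n, ← integral_complex_ofReal]
    refine integral_congr_ae (ae_of_all _ fun y => ?_)
    unfold chiPlus
    simp only [e, pm, pp, Real.cos_sub, Real.cos_add]
    rw [← Complex.ofReal_mul]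
    congr 1
    linear_combination (Real.cos (lam d m * y) * Real.cos (lam d n * y)) * sq
  · simp only [chiMinus]
    rw [Complex.norm_real, Real.norm_eq_abs, abs_mul, abs_of_nonneg (Real.sqrt_nonneg _)]
    exact mul_le_of_le_one_right (Real.sqrt_nonneg _) (Real.abs_sin_le_one _)
  · simp only [chiPlus]
    rw [Complex.norm_real, Real.norm_eq_abs, abs_mul, abs_of_nonneg (Real.sqrt_nonneg _)]
    exact mul_le_of_le_one_right (Real.sqrt_nonneg _) (Real.abs_cos_le_one _)

lemma transverse_plus {d : ℝ} (hd : 0 < d) :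
    Transverse d (fun m => chiPlus d (m + 1)) (fun m y => -chiMinus d (m + 1) y) :=
  (transverse_minus hd).symm

lemma chiMinus_zero (d : ℝ) (n : ℕ) : chiMinus d n 0 = 0 := by simp [chiMinus]

lemma chiPlus_top {d : ℝ} (hd : 0 < d) (m : ℕ) : chiPlus d (m + 1) d = 0 := by
  have : (2 * ((m + 1 : ℕ) : ℝ) - 1) * (Real.pi * d / (2 * d)) = m * Real.pi + Real.pi / 2 := by
    push_cast; field_simp; ring
  rw [chiPlus, this, Real.cos_add_pi_div_two, Real.sin_nat_mul_pi]
  simp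

/-! ### Coefficients of test functions -/

/-- The coefficient of a function at a transversal mode. -/
def coeff (χ : ℝ → ℂ) (g : ℝ → ℝ) : ℂ := ∫ y, (g y : ℂ) * χ y

/-- Test functions on the interval `(0, d)`. -/
structure IsTestInterval (d : ℝ) (g : ℝ → ℝ) : Prop where
  smooth : ContDiff ℝ ∞ g
  compact : HasCompactSupport g
  subset : tsupport g ⊆ Ioo 0 d

lemma IsTestInterval.deriv {d : ℝ} {g : ℝ → ℝ} (h : IsTestInterval d g) :
    IsTestInterval d (deriv g) :=
  ⟨(contDiff_infty_iff_deriv.1 h.smooth).2, h.compact.deriv,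
    (tsupport_deriv_subset).trans h.subset⟩

lemma IsTestInterval.eq_zero {d : ℝ} {g : ℝ → ℝ} (h : IsTestInterval d g) {y : ℝ}
    (hy : y ∉ Ioo 0 d) : g y = 0 :=
  image_eq_zero_of_notMem_tsupport fun h' => hy (h.subset h')

lemma integral_deriv_mul_of_compact {g : ℝ → ℝ} {F F' : ℝ → ℂ} (hg : ContDiff ℝ ∞ g)
    (hc : HasCompactSupport g) (hF : ∀ x, HasDerivAt F (F' x) x) (hF' : Continuous F') :
    ∫ x, ((deriv g x : ℝ) : ℂ) * F x = -∫ x, (g x : ℂ) * F' x := by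
  have cF : Continuous F := continuous_iff_continuousAt.2 fun y => (hF y).continuousAt
  have cg : Continuous (deriv g) := (contDiff_infty_iff_deriv.1 hg).2.continuous
  have hc1 : HasCompactSupport fun x => ((deriv g x : ℝ) : ℂ) :=
    hc.deriv.comp_left (g := fun x : ℝ => (x : ℂ)) (by simp)
  have hc2 : HasCompactSupport fun x => (g x : ℂ) :=
    hc.comp_left (g := fun x : ℝ => (x : ℂ)) (by simp)
  have i1 : Integrable fun x => ((deriv g x : ℝ) : ℂ) * F x :=
    (by fun_prop : Continuous fun x => ((deriv g x : ℝ) : ℂ) * F x).integrable_of_hasCompactSupport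
      hc1.mul_right
  have cg0 := hg.continuous
  have i2 : Integrable fun x => (g x : ℂ) * F' x :=
    (by fun_prop : Continuous fun x => (g x : ℂ) * F' x).integrable_of_hasCompactSupport
      hc2.mul_right
  have i3 : Integrable fun x => (g x : ℂ) * F x :=
    (by fun_prop : Continuous fun x => (g x : ℂ) * F x).integrable_of_hasCompactSupport
      hc2.mul_right
  have hd : ∀ x, HasDerivAt (fun x => (g x : ℂ) * F x)
      (((deriv g x : ℝ) : ℂ) * F x + g x * F' x) x :=
    fun x => ((hg.differentiable (by simp) x).hasDerivAt.ofReal_comp).mul (hF x)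
  have := integral_eq_zero_of_hasDerivAt_of_integrable hd (i1.add i2) i3
  rw [integral_add i1 i2] at this
  exact eq_neg_of_add_eq_zero_left this

lemma Transverse.coeff_deriv {d : ℝ} {χ η : ℕ → ℝ → ℂ} (h : Transverse d χ η) {g : ℝ → ℝ}
    (hg : IsTestInterval d g) (m : ℕ) : coeff (χ m) (deriv g) = -(lam d m * coeff (η m) g) := by
  have c := h.continuous_right m
  unfold coeff
  rw [integral_deriv_mul_of_compact hg.smooth hg.compact (h.deriv_left m) (by fun_prop),
    ← integral_const_mul]
  congr 2 with y
  ring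

lemma Transverse.norm_coeff_le {d : ℝ} {χ η : ℕ → ℝ → ℂ} (h : Transverse d χ η) {g : ℝ → ℝ}
    (hg : IsTestInterval d g) (m : ℕ) : ‖coeff (χ m) g‖ ≤ √(2 / d) * ∫ y, ‖g y‖ := by
  unfold coeff
  rw [← integral_const_mul]
  refine norm_integral_le_of_norm_le
    ((hg.smooth.continuous.integrable_of_hasCompactSupport hg.compact).norm.const_mul _)
    (ae_of_all _ fun y => ?_)
  rw [norm_mul, Complex.norm_real, mul_comm]
  exact mul_le_mul_of_nonneg_right (h.bound_left m y) (norm_nonneg _)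

/-- Four integrations by parts, without boundary terms since the support is compact in (0, d), each
produce a factor λ_m up to sign. The fourth power leaves a summable bound even after multiplication
by (m+1)², the largest weight needed in exchanging sums and integrals. -/
lemma Transverse.exists_coeff_bound {d : ℝ} (hd : 0 < d) {χ η : ℕ → ℝ → ℂ}
    (h : Transverse d χ η) {g : ℝ → ℝ} (hg : IsTestInterval d g) :
    ∃ C, ∀ m : ℕ, ‖coeff (χ m) g‖ ≤ C / ((m : ℝ) + 1) ^ 4 := by
  set D := √(2 / d) * ∫ y, ‖deriv (deriv (deriv (deriv g))) y‖
  have D0 : 0 ≤ D := mul_nonneg (Real.sqrt_nonneg _) (integral_nonneg fun _ => norm_nonneg _)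
  refine ⟨D * (2 * d / Real.pi) ^ 4, fun m => ?_⟩
  have l := lam_pos hd m
  have e : coeff (χ m) (deriv (deriv (deriv (deriv g)))) = lam d m ^ 4 * coeff (χ m) g := by
    have neg : ∀ f : ℝ → ℝ, coeff (fun y => -χ m y) f = -coeff (χ m) f := fun f => by
      simp [coeff, integral_neg]
    -- The derivatives alternate between the system and its rotation; two of them reproduce χ with
    -- the factor -λ², hence four give λ⁴.
    rw [h.coeff_deriv hg.deriv.deriv.deriv, h.symm.coeff_deriv hg.deriv.deriv, neg,
      h.coeff_deriv hg.deriv, h.symm.coeff_deriv hg, neg]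
    ring
  have b := h.norm_coeff_le hg.deriv.deriv.deriv.deriv m
  rw [e, norm_mul, norm_pow, Complex.norm_real, Real.norm_of_nonneg l.le] at b
  have le : Real.pi / (2 * d) * ((m : ℝ) + 1) ≤ lam d m := by
    rw [lam, div_mul_eq_mul_div, mul_comm]
    gcongr
    linarith [Nat.cast_nonneg (α := ℝ) m]
  have : (Real.pi / (2 * d) * ((m : ℝ) + 1)) ^ 4 * ‖coeff (χ m) g‖ ≤ D :=
    (mul_le_mul_of_nonneg_right (pow_le_pow_left₀ (by positivity) le 4) (norm_nonneg _)).trans b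
  rw [le_div_iff₀ (by positivity)]
  calc ‖coeff (χ m) g‖ * ((m : ℝ) + 1) ^ 4
      = (Real.pi / (2 * d) * ((m : ℝ) + 1)) ^ 4 * ‖coeff (χ m) g‖ * (2 * d / Real.pi) ^ 4 := by
        field_simp
    _ ≤ _ := by gcongr

end Waveguide

namespace Waveguide

/-! ### Coercivity of the matching form -/

section Form
variable {V : Type*} [NormedAddCommGroup V]

/-- On the nonnegative real and imaginary half-axes, where conj(σ_m) lies, real part plus imaginary
part equals the modulus. Adding both parts of the form thus loses no coercivity although its values
are complex, and each part of `z` is at most ‖z‖. -/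
lemma form_lower_bound {σ : ℕ → ℂ} {c : ℝ} (hσ : ∀ m : ℕ, c * ((m : ℝ) + 1) ≤ ‖σ m‖)
    (sgn : ∀ m, (0 ≤ (σ m).re ∧ (σ m).im = 0) ∨ ((σ m).re = 0 ∧ (σ m).im ≤ 0))
    {D : ℕ → V} (hD : Summable fun m : ℕ => ((m : ℝ) + 1) * ‖D m‖ ^ 2) {z : ℂ}
    (h : HasSum (fun m => star (σ m) * (((‖D m‖ ^ 2 : ℝ)) : ℂ)) z) :
    c * ∑' m : ℕ, ((m : ℝ) + 1) * ‖D m‖ ^ 2 ≤ 2 * ‖z‖ := by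
  have hn : ∀ m, ‖σ m‖ = (σ m).re - (σ m).im := by
    intro m
    rcases sgn m with ⟨h1, h2⟩ | ⟨h1, h2⟩
    · rw [← Complex.abs_re_eq_norm.2 h2, h2, abs_of_nonneg h1, sub_zero]
    · rw [← Complex.abs_im_eq_norm.2 h1, h1, abs_of_nonpos h2, zero_sub]
  have h1 := (Complex.hasSum_re h).add (Complex.hasSum_im h)
  have e : ∀ m, (star (σ m) * (((‖D m‖ ^ 2 : ℝ)) : ℂ)).re +
      (star (σ m) * (((‖D m‖ ^ 2 : ℝ)) : ℂ)).im = ‖σ m‖ * ‖D m‖ ^ 2 := by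
    intro m
    rw [Complex.re_mul_ofReal, Complex.im_mul_ofReal, hn]
    simp only [Complex.star_def, Complex.conj_re, Complex.conj_im]
    ring
  simp_rw [e] at h1
  rw [← tsum_mul_left]
  have := hasSum_le (fun m => ?_) (hD.mul_left c).hasSum h1
  · refine this.trans ?_
    have a1 := Complex.re_le_norm z
    have a2 := (le_abs_self _).trans (Complex.abs_im_le_norm z)
    linarith
  · rw [← mul_assoc]
    exact mul_le_mul_of_nonneg_right (hσ m) (by positivity)

/-- Here `u` is a second expansion of the value `z` of the form, linear in `D`. Young's inequality
with weights A²/c and c/4 turns half of the coercive lower bound into control of `D`, because c S ≤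
2‖z‖ ≤ 2(A²/c)W + (c/2)S. -/
lemma form_estimate {σ : ℕ → ℂ} {c : ℝ} (c0 : 0 < c)
    (hσ : ∀ m : ℕ, c * ((m : ℝ) + 1) ≤ ‖σ m‖)
    (sgn : ∀ m, (0 ≤ (σ m).re ∧ (σ m).im = 0) ∨ ((σ m).re = 0 ∧ (σ m).im ≤ 0))
    {D : ℕ → V} (hD : Summable fun m : ℕ => ((m : ℝ) + 1) * ‖D m‖ ^ 2) {z : ℂ}
    (h : HasSum (fun m => star (σ m) * (((‖D m‖ ^ 2 : ℝ)) : ℂ)) z)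
    {u : ℕ → ℂ} (hu : HasSum u z) {A : ℝ} {w : ℕ → ℝ}
    (huw : ∀ m, ‖u m‖ ≤ A * w m * ‖D m‖) {W : ℝ} (hw : Summable fun m => w m ^ 2)
    (hW : ∑' m, w m ^ 2 ≤ W) :
    ∑' m : ℕ, ((m : ℝ) + 1) * ‖D m‖ ^ 2 ≤ 4 * A ^ 2 / c ^ 2 * W := by
  have low := form_lower_bound hσ sgn hD h
  have up : ‖z‖ ≤ A ^ 2 / c * W + c / 4 * ∑' m : ℕ, ((m : ℝ) + 1) * ‖D m‖ ^ 2 := by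
    have hs := (hw.hasSum.mul_left (A ^ 2 / c)).add (hD.hasSum.mul_left (c / 4))
    have key : ∀ m, ‖u m‖ ≤ A ^ 2 / c * w m ^ 2 + c / 4 * (((m : ℝ) + 1) * ‖D m‖ ^ 2) := by
      intro m
      refine (huw m).trans ?_
      have h1 : A * w m * ‖D m‖ ≤ A ^ 2 / c * w m ^ 2 + c / 4 * ‖D m‖ ^ 2 := by
        have : A ^ 2 / c * w m ^ 2 + c / 4 * ‖D m‖ ^ 2 - A * w m * ‖D m‖ =
          (A * w m - c / 2 * ‖D m‖) ^ 2 / c := by field_simp; ring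
        have : 0 ≤ (A * w m - c / 2 * ‖D m‖) ^ 2 / c := by positivity
        linarith
      have h2 : ‖D m‖ ^ 2 ≤ ((m : ℝ) + 1) * ‖D m‖ ^ 2 :=
        le_mul_of_one_le_left (by positivity) (by linarith [Nat.cast_nonneg (α := ℝ) m])
      have := mul_le_mul_of_nonneg_left h2 (by positivity : 0 ≤ c / 4)
      linarith
    have := tsum_of_norm_bounded hs key
    rw [hu.tsum_eq] at this
    have h3 : A ^ 2 / c * ∑' m, w m ^ 2 ≤ A ^ 2 / c * W := by gcongr
    linarith
  set S := ∑' m : ℕ, ((m : ℝ) + 1) * ‖D m‖ ^ 2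
  have : S * c ^ 2 ≤ 4 * A ^ 2 * W := by
    have h5 : c * S ≤ 4 * (A ^ 2 / c * W) := by linarith
    have h4 : A ^ 2 / c * W * c = A ^ 2 * W := by field_simp
    nlinarith
  rw [div_mul_eq_mul_div, le_div_iff₀ (by positivity)]
  exact this

end Form

/-! ### Orthonormality in `L²(0, d)` -/

lemma inner_toLp_interval {d : ℝ} {f g : ℝ → ℂ} (hf : MemLp f 2 (volume.restrict (Ioo 0 d)))
    (hg : MemLp g 2 (volume.restrict (Ioo 0 d))) :
    inner ℂ (hf.toLp : L2Interval d) hg.toLp = ∫ y in Ioo 0 d, star (f y) * g y := by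
  rw [L2.inner_def]
  refine integral_congr_ae ?_
  filter_upwards [hf.coeFn_toLp, hg.coeFn_toLp] with y h1 h2
  rw [h1, h2, RCLike.inner_apply, mul_comm]
  rfl

lemma inner_chiMinusL2 {d : ℝ} (hd : 0 < d) (m n : ℕ) :
    inner ℂ (chiMinusL2 d (m + 1)) (chiMinusL2 d (n + 1)) = if m = n then (1 : ℂ) else 0 := by
  rw [chiMinusL2, chiMinusL2, inner_toLp_interval]
  simp_rw [(transverse_minus hd).real_left]
  exact (transverse_minus hd).orth_left m n

lemma inner_chiPlusL2 {d : ℝ} (hd : 0 < d) (m n : ℕ) :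
    inner ℂ (chiPlusL2 d (m + 1)) (chiPlusL2 d (n + 1)) = if m = n then (1 : ℂ) else 0 := by
  rw [chiPlusL2, chiPlusL2, inner_toLp_interval]
  simp_rw [(transverse_plus hd).real_left]
  exact (transverse_plus hd).orth_left m n

lemma inner_of_hasSum {H : Type*} [NormedAddCommGroup H] [InnerProductSpace ℂ H] {e : ℕ → H}
    (he : ∀ m n, inner ℂ (e m) (e n) = if m = n then (1 : ℂ) else 0) {c : ℕ → ℂ} {φ : H}
    (h : HasSum (fun m => c m • e m) φ) (m : ℕ) : inner ℂ (e m) φ = c m := by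
  have h1 := h.mapL (innerSL ℂ (e m))
  refine h1.unique ?_
  have : ∀ n, innerSL ℂ (e m) (c n • e n) = if n = m then c m else 0 := by
    intro n
    rw [innerSL_apply_apply, inner_smul_right, he]
    by_cases hn : n = m
    · subst hn; simp
    · rw [if_neg hn, if_neg (Ne.symm hn), mul_zero]
  simp_rw [this]
  exact hasSum_ite_eq m (c m)

/-- A test function on the interval as an element of `L²(0, d)`. -/
def IsTestInterval.toL2 {d : ℝ} {g : ℝ → ℝ} (hg : IsTestInterval d g) : L2Interval d :=
  (memLp_of_continuous (f := fun y => (g y : ℂ))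
    (Complex.continuous_ofReal.comp hg.smooth.continuous)).toLp

lemma integral_interval_eq_coeff {d : ℝ} {g : ℝ → ℝ} (hg : IsTestInterval d g) (χ : ℝ → ℂ) :
    ∫ y in Ioo 0 d, (g y : ℂ) * χ y = coeff χ g := by
  refine setIntegral_eq_integral_of_forall_compl_eq_zero fun y hy => ?_
  rw [hg.eq_zero hy, Complex.ofReal_zero, zero_mul]

lemma inner_chiMinusL2_test {d : ℝ} (hd : 0 < d) {g : ℝ → ℝ} (hg : IsTestInterval d g) (m : ℕ) :
    inner ℂ (chiMinusL2 d (m + 1)) hg.toL2 = coeff (chiMinus d (m + 1)) g := by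
  rw [chiMinusL2, IsTestInterval.toL2, inner_toLp_interval, ← integral_interval_eq_coeff hg]
  simp_rw [(transverse_minus hd).real_left, mul_comm]

lemma inner_chiPlusL2_test {d : ℝ} (hd : 0 < d) {g : ℝ → ℝ} (hg : IsTestInterval d g) (m : ℕ) :
    inner ℂ (chiPlusL2 d (m + 1)) hg.toL2 = coeff (chiPlus d (m + 1)) g := by
  rw [chiPlusL2, IsTestInterval.toL2, inner_toLp_interval, ← integral_interval_eq_coeff hg]
  simp_rw [(transverse_plus hd).real_left, mul_comm]

lemma star_coeff {χ : ℝ → ℂ} (h : ∀ y, star (χ y) = χ y) (g : ℝ → ℝ) :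
    star (coeff χ g) = coeff χ g := by
  unfold coeff
  rw [Complex.star_def, ← integral_conj]
  congr 1 with y
  rw [map_mul, Complex.conj_ofReal, ← Complex.star_def, h]

lemma summable_mul_of_sq {w : ℕ → ℝ} (hw : ∀ m, 0 ≤ w m) {a b : ℕ → ℂ}
    (ha : Summable fun m => w m * ‖a m‖ ^ 2) (hb : Summable fun m => w m * ‖b m‖ ^ 2) :
    Summable fun m => w m * (‖a m‖ * ‖b m‖) := by
  refine Summable.of_nonneg_of_le (fun m => mul_nonneg (hw m) (by positivity)) (fun m => ?_)
    (ha.add hb)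
  rw [← mul_add]
  have := two_mul_le_add_sq ‖a m‖ ‖b m‖
  have : 0 ≤ ‖a m‖ * ‖b m‖ := by positivity
  exact mul_le_mul_of_nonneg_left (by linarith) (hw m)

lemma Transverse.summable_coeff {d : ℝ} (hd : 0 < d) {χ η : ℕ → ℝ → ℂ} (h : Transverse d χ η)
    {g : ℝ → ℝ} (hg : IsTestInterval d g) :
    Summable fun m : ℕ => ((m : ℝ) + 1) ^ 2 * ‖coeff (χ m) g‖ := by
  obtain ⟨C, hC⟩ := h.exists_coeff_bound hd hg
  have s2 : Summable fun m : ℕ => 1 / ((m : ℝ) + 1) ^ 2 := by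
    have := (summable_nat_add_iff 1).2 (Real.summable_one_div_nat_pow.2 (by norm_num : 1 < 2))
    simpa using this
  refine Summable.of_nonneg_of_le (fun m => by positivity) (fun m => ?_) (s2.mul_left C)
  calc ((m : ℝ) + 1) ^ 2 * ‖coeff (χ m) g‖ ≤ ((m : ℝ) + 1) ^ 2 * (C / ((m : ℝ) + 1) ^ 4) := by
        gcongr; exact hC m
    _ = _ := by field_simp

lemma Transverse.summable_coeff_sq {d : ℝ} (hd : 0 < d) {χ η : ℕ → ℝ → ℂ}
    (h : Transverse d χ η) {g : ℝ → ℝ} (hg : IsTestInterval d g) :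
    Summable fun m : ℕ => ((m : ℝ) + 1) * ‖coeff (χ m) g‖ ^ 2 := by
  refine Summable.of_nonneg_of_le (fun m => by positivity) (fun m => ?_)
    ((h.summable_coeff hd hg).mul_left (√(2 / d) * ∫ y, ‖g y‖))
  have h1 := h.norm_coeff_le hg m
  have h2 : (m : ℝ) + 1 ≤ ((m : ℝ) + 1) ^ 2 := by
    nlinarith [Nat.cast_nonneg (α := ℝ) m]
  calc ((m : ℝ) + 1) * ‖coeff (χ m) g‖ ^ 2
      = ‖coeff (χ m) g‖ * (((m : ℝ) + 1) * ‖coeff (χ m) g‖) := by ring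
    _ ≤ (√(2 / d) * ∫ y, ‖g y‖) * (((m : ℝ) + 1) ^ 2 * ‖coeff (χ m) g‖) := by gcongr

lemma mem_HHalf_iff {d : ℝ} {g : L2Interval d} : g ∈ HHalf d ↔
    (Summable fun m : ℕ => ((m : ℝ) + 1) * ‖inner ℂ (chiMinusL2 d (m + 1)) g‖ ^ 2) ∧
      Summable fun m : ℕ => ((m : ℝ) + 1) * ‖inner ℂ (chiPlusL2 d (m + 1)) g‖ ^ 2 := by
  rw [HHalf, mem_ofPred_eq, ← summable_nat_add_iff 1,
    ← summable_nat_add_iff (f := fun n : ℕ => (n : ℝ) * ‖inner ℂ (chiPlusL2 d n) g‖ ^ 2) 1]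
  push_cast
  rfl

lemma test_mem_HHalf {d : ℝ} (hd : 0 < d) {g : ℝ → ℝ} (hg : IsTestInterval d g) :
    hg.toL2 ∈ HHalf d := by
  rw [mem_HHalf_iff]
  simp_rw [inner_chiMinusL2_test hd hg, inner_chiPlusL2_test hd hg]
  exact ⟨(transverse_minus hd).summable_coeff_sq hd hg,
    (transverse_plus hd).summable_coeff_sq hd hg⟩

/-! ### Thresholds and exponents -/

/-- Unfolds the floor: (π²/d²)(n - 1/2)² = μ_n, so the number of excited modes counts the n with μ_n
≤ μ_{n₀} + k². The inequality is not strict here; off the thresholds equality cannot occur. -/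
lemma le_nExc_iff {d : ℝ} (hd : 0 < d) (n₀ : ℕ) (k : ℝ) (m : ℕ) :
    m < nExc d n₀ k ↔ mu d (m + 1) ≤ mu d n₀ + k ^ 2 := by
  have hpi := Real.pi_pos
  rw [← Nat.succ_le_iff, nExc, Nat.le_floor_iff (by positivity), ← sub_le_iff_le_add',
    Real.le_sqrt' (by push_cast; linarith [Nat.cast_nonneg (α := ℝ) m]), mu, mu]
  rw [← mul_le_mul_iff_right₀ (by positivity : 0 < Real.pi ^ 2 / d ^ 2)]
  have e1 : Real.pi ^ 2 / d ^ 2 * (((m.succ : ℕ) : ℝ) - 1 / 2) ^ 2 =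
    (2 * ((m + 1 : ℕ) : ℝ) - 1) ^ 2 * Real.pi ^ 2 / (4 * d ^ 2) := by
    push_cast; field_simp; ring
  have e2 : Real.pi ^ 2 / d ^ 2 * (((n₀ : ℝ) - 1 / 2) ^ 2 + d ^ 2 / Real.pi ^ 2 * k ^ 2) =
    (2 * (n₀ : ℝ) - 1) ^ 2 * Real.pi ^ 2 / (4 * d ^ 2) + k ^ 2 := by
    field_simp; ring
  rw [e1, e2]

/-- A channel open at k and closed at k' would have √(μ_{m+1} - μ_{n₀}) in [k', k], which is a
threshold inside [α, β]. -/
lemma le_nExc_of_le {d : ℝ} {n₀ : ℕ} (hd : 0 < d) {α β : ℝ}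
    (hM : Icc α β ⊆ Ioi 0 \ thresholds d n₀) {k k' : ℝ} (hk : k ∈ Icc α β) (hk' : k' ∈ Icc α β)
    {m : ℕ} (h : m < nExc d n₀ k) : m < nExc d n₀ k' := by
  rw [le_nExc_iff hd] at h ⊢
  by_contra! hc
  have k0 : 0 < k := (hM hk).1
  have k0' : 0 < k' := (hM hk').1
  set x := √(mu d (m + 1) - mu d n₀)
  have hx : x ^ 2 = mu d (m + 1) - mu d n₀ := Real.sq_sqrt (by nlinarith)
  have x1 : k' ≤ x := Real.le_sqrt_of_sq_le (by linarith)
  have x2 : x ≤ k := Real.sqrt_le_iff.2 ⟨k0.le, by linarith⟩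
  exact (hM ⟨hk'.1.trans x1, x2.trans hk.2⟩).2 ⟨k0'.trans_le x1, m + 1, by omega, by linarith⟩

lemma nExc_eq {d : ℝ} {n₀ : ℕ} (hd : 0 < d) {α β : ℝ}
    (hM : Icc α β ⊆ Ioi 0 \ thresholds d n₀) {k k' : ℝ} (hk : k ∈ Icc α β) (hk' : k' ∈ Icc α β) :
    nExc d n₀ k = nExc d n₀ k' :=
  eq_of_forall_lt_iff fun _ => ⟨le_nExc_of_le hd hM hk hk', le_nExc_of_le hd hM hk' hk⟩

/-- The exponent `-i k_{m+1}` or `κ_{m+1}` of the `m`-th mode when there are `N` excited modes. -/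
def sig (d : ℝ) (n₀ N m : ℕ) (k : ℝ) : ℂ :=
  if m < N then -Complex.I * waveNumber d n₀ k (m + 1) else decayRate d n₀ k (m + 1)

/-- Standing assumptions on the interval of wave numbers. -/
structure Admissible (d : ℝ) (n₀ N : ℕ) (α β : ℝ) : Prop where
  pos_d : 0 < d
  one_le : 1 ≤ n₀
  sub : Icc α β ⊆ Ioi 0 \ thresholds d n₀
  exc : ∀ k ∈ Icc α β, nExc d n₀ k = N

namespace Admissible
variable {d : ℝ} {n₀ N : ℕ} {α β : ℝ}

lemma pos (hA : Admissible d n₀ N α β) {k : ℝ} (hk : k ∈ Icc α β) : 0 < k := (hA.sub hk).1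

lemma ne (hA : Admissible d n₀ N α β) {k : ℝ} (hk : k ∈ Icc α β) (m : ℕ) :
    mu d (m + 1) ≠ mu d n₀ + k ^ 2 := fun h =>
  (hA.sub hk).2 ⟨hA.pos hk, m + 1, by omega, by linarith⟩

lemma lt (hA : Admissible d n₀ N α β) {k : ℝ} (hk : k ∈ Icc α β) {m : ℕ} (hm : m < N) :
    mu d (m + 1) < mu d n₀ + k ^ 2 := by
  rw [← hA.exc k hk, le_nExc_iff hA.pos_d] at hm
  exact lt_of_le_of_ne hm (hA.ne hk m)

lemma gt (hA : Admissible d n₀ N α β) {k : ℝ} (hk : k ∈ Icc α β) {m : ℕ} (hm : N ≤ m) :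
    mu d n₀ + k ^ 2 < mu d (m + 1) := by
  rw [← not_lt, ← hA.exc k hk, le_nExc_iff hA.pos_d] at hm
  exact not_le.1 hm

/-- The point of `sig`: open and closed channels obey the same dispersion relation, so the calculus
of profiles needs no case distinction. -/
lemma sig_sq (hA : Admissible d n₀ N α β) {k : ℝ} (hk : k ∈ Icc α β) (m : ℕ) :
    sig d n₀ N m k ^ 2 = ((lam d m ^ 2 - (mu d n₀ + k ^ 2) : ℝ) : ℂ) := by
  rw [← mu_succ, sig]
  split_ifs with h
  · rw [mul_pow, neg_sq, Complex.I_sq, waveNumber, ← Complex.ofReal_pow,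
      Real.sq_sqrt (by linarith [hA.lt hk h])]
    push_cast; ring
  · rw [decayRate, ← Complex.ofReal_pow, Real.sq_sqrt (by linarith [hA.gt hk (not_lt.1 h)])]
    push_cast; ring

lemma continuous_sig (m : ℕ) : Continuous (sig d n₀ N m) := by
  unfold sig waveNumber decayRate
  split_ifs <;> fun_prop

lemma sgn (m : ℕ) (k : ℝ) : (0 ≤ (sig d n₀ N m k).re ∧ (sig d n₀ N m k).im = 0) ∨
    ((sig d n₀ N m k).re = 0 ∧ (sig d n₀ N m k).im ≤ 0) := by
  rw [sig]
  split_ifs with h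
  · right; simp [waveNumber, Real.sqrt_nonneg]
  · left; simp [decayRate, Real.sqrt_nonneg]

/-- The incident channel, with index n₀ - 1 when counted from 0, is open because k² ≥ 0. The
alternative covers an empty interval, on which `N` is unconstrained. -/
lemma lt_exc (hA : Admissible d n₀ N α β) : n₀ - 1 < N ∨ Icc α β = ∅ := by
  rcases (Icc α β).eq_empty_or_nonempty with h | ⟨k, hk⟩
  · exact Or.inr h
  · left
    rw [← hA.exc k hk, le_nExc_iff hA.pos_d, Nat.sub_add_cancel hA.one_le]
    nlinarith

lemma sig_channel (hA : Admissible d n₀ N α β) {k : ℝ} (hk : k ∈ Icc α β) :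
    sig d n₀ N (n₀ - 1) k = -Complex.I * k := by
  rw [sig, if_pos, waveNumber, Nat.sub_add_cancel hA.one_le, sub_self, zero_add,
    Real.sqrt_sq (hA.pos hk).le]
  exact hA.lt_exc.resolve_right (nonempty_iff_ne_empty.1 ⟨k, hk⟩)

/-- A uniform lower bound for the exponents. -/
lemma exists_lower (hA : Admissible d n₀ N α β) (hαβ : α ≤ β) : ∃ c, 0 < c ∧ ∀ k ∈ Icc α β, ∀ m : ℕ,
    c * ((m : ℝ) + 1) ≤ ‖sig d n₀ N m k‖ := by
  have ha : α ∈ Icc α β := ⟨le_rfl, hαβ⟩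
  have hb : β ∈ Icc α β := ⟨hαβ, le_rfl⟩
  have fin : ∃ c, 0 < c ∧ ∀ k ∈ Icc α β, ∀ m < N, c * ((m : ℝ) + 1) ≤ ‖sig d n₀ N m k‖ := by
    rcases Nat.eq_zero_or_pos N with h0 | hN
    · exact ⟨1, one_pos, fun k _ m hm => by omega⟩
    · obtain ⟨N', rfl⟩ : ∃ N', N = N' + 1 := ⟨N - 1, by omega⟩
      -- The last open channel has the smallest wave number, and wave numbers increase with k, so
      -- its value at α bounds all finitely many open ones from below.
      set w := √(mu d n₀ - mu d (N' + 1) + α ^ 2)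
      have w0 : 0 < w := Real.sqrt_pos.2 (by linarith [hA.lt ha (Nat.lt_succ_self N')])
      refine ⟨w / (N' + 1), by positivity, fun k hk m hm => ?_⟩
      have : w ≤ ‖sig d n₀ (N' + 1) m k‖ := by
        rw [sig, if_pos hm, norm_mul, norm_neg, Complex.norm_I, one_mul, Complex.norm_real,
          waveNumber, Real.norm_of_nonneg (Real.sqrt_nonneg _)]
        refine Real.sqrt_le_sqrt ?_
        have h1 : mu d (m + 1) ≤ mu d (N' + 1) := by
          rw [mu_succ, mu_succ]
          refine pow_le_pow_left₀ (lam_pos hA.pos_d m).le ?_ 2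
          unfold lam
          have : (m : ℝ) ≤ N' := by exact_mod_cast Nat.lt_succ_iff.1 hm
          have := hA.pos_d
          have := Real.pi_pos
          gcongr
        have := hA.pos ha
        nlinarith [hk.1]
      refine le_trans ?_ this
      have hm' : (m : ℝ) + 1 ≤ N' + 1 := by exact_mod_cast hm
      calc w / (N' + 1) * ((m : ℝ) + 1) ≤ w / (N' + 1) * (N' + 1) := by gcongr
        _ = w := by field_simp
  have inf : ∃ c, 0 < c ∧ ∀ k ∈ Icc α β, ∀ m, N ≤ m → c * ((m : ℝ) + 1) ≤ ‖sig d n₀ N m k‖ := by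
    have hl := lam_pos hA.pos_d N
    -- θ < 1 says that the first closed channel is still closed at β. For m ≥ N it gives μ_{n₀} + k²
    -- ≤ θ λ_m², hence κ² ≥ (1 - θ) λ_m², which grows like (m+1)².
    set θ := (mu d n₀ + β ^ 2) / lam d N ^ 2
    have hθ : θ < 1 := by
      rw [div_lt_one (by positivity), ← mu_succ]
      exact hA.gt hb le_rfl
    have h0 : 0 < 1 - θ := by linarith
    have hq : 0 < Real.pi / (2 * d) := by have := hA.pos_d; have := Real.pi_pos; positivity
    refine ⟨√(1 - θ) * (Real.pi / (2 * d)), mul_pos (Real.sqrt_pos.2 h0) hq, fun k hk m hm => ?_⟩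
    rw [sig, if_neg (not_lt.2 hm), Complex.norm_real, decayRate,
      Real.norm_of_nonneg (Real.sqrt_nonneg _)]
    refine Real.le_sqrt_of_sq_le ?_
    rw [mul_pow, mul_pow, Real.sq_sqrt h0.le, mu_succ]
    have l1 : lam d N ≤ lam d m := by
      unfold lam
      have : (N : ℝ) ≤ m := by exact_mod_cast hm
      have := hA.pos_d
      have := Real.pi_pos
      gcongr
    have l2 : Real.pi / (2 * d) * ((m : ℝ) + 1) ≤ lam d m := by
      rw [lam, mul_div_assoc, mul_comm]
      gcongr
      linarith [Nat.cast_nonneg (α := ℝ) m]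
    have e : mu d n₀ + β ^ 2 = θ * lam d N ^ 2 := by
      simp only [θ]; field_simp
    have kb : k ^ 2 ≤ β ^ 2 := pow_le_pow_left₀ (hA.pos hk).le hk.2 2
    have θ0 : 0 ≤ θ := by
      have : 0 ≤ mu d n₀ := by unfold mu; positivity
      positivity
    have l3 : θ * lam d N ^ 2 ≤ θ * lam d m ^ 2 := by gcongr
    have l4 : (Real.pi / (2 * d) * ((m : ℝ) + 1)) ^ 2 ≤ lam d m ^ 2 := by gcongr
    have l5 := mul_le_mul_of_nonneg_left l4 h0.le
    nlinarith
  obtain ⟨c1, h1, h1'⟩ := fin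
  obtain ⟨c2, h2, h2'⟩ := inf
  refine ⟨min c1 c2, lt_min h1 h2, fun k hk m => ?_⟩
  rcases lt_or_ge m N with h | h
  · exact (mul_le_mul_of_nonneg_right (min_le_left _ _) (by positivity)).trans (h1' k hk m h)
  · exact (mul_le_mul_of_nonneg_right (min_le_right _ _) (by positivity)).trans (h2' k hk m h)

lemma exists_upper (hA : Admissible d n₀ N α β) : ∃ C, 0 ≤ C ∧ ∀ k ∈ Icc α β, ∀ m : ℕ,
    ‖sig d n₀ N m k‖ ≤ C * ((m : ℝ) + 1) := by
  have hl : ∀ m, lam d m ≤ Real.pi / d * ((m : ℝ) + 1) := by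
    intro m
    have := hA.pos_d
    have := Real.pi_pos
    rw [lam, div_mul_eq_mul_div, div_le_div_iff₀ (by positivity) (by positivity)]
    have : 0 ≤ Real.pi * d := by positivity
    nlinarith [Nat.cast_nonneg (α := ℝ) m]
  have mu0 : 0 ≤ mu d n₀ := by unfold mu; positivity
  set E := mu d n₀ + β ^ 2
  have hE : 0 ≤ E := by positivity
  have hpd : 0 ≤ Real.pi / d := by have := hA.pos_d; have := Real.pi_pos; positivity
  refine ⟨Real.pi / d + √E, by positivity, fun k hk m => ?_⟩
  have kb : k ^ 2 ≤ β ^ 2 := pow_le_pow_left₀ (hA.pos hk).le hk.2 2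
  have h1 : ‖sig d n₀ N m k‖ ^ 2 ≤ lam d m ^ 2 + E := by
    rw [← norm_pow, hA.sig_sq hk, Complex.norm_real, Real.norm_eq_abs, abs_le]
    constructor <;> nlinarith [sq_nonneg k, sq_nonneg (lam d m)]
  refine abs_le_of_sq_le_sq' ?_ (by positivity) |>.2
  refine h1.trans ?_
  have h2 := hl m
  have h3 := (lam_pos hA.pos_d m).le
  have h4 : (1 : ℝ) ≤ (m : ℝ) + 1 := by linarith [Nat.cast_nonneg (α := ℝ) m]
  have h5 : √E ≤ √E * ((m : ℝ) + 1) := le_mul_of_one_le_right (Real.sqrt_nonneg _) h4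
  have h6 : √E ^ 2 = E := Real.sq_sqrt hE
  have h7 : (lam d m + √E) ^ 2 ≤ ((Real.pi / d + √E) * ((m : ℝ) + 1)) ^ 2 := by
    refine pow_le_pow_left₀ (by positivity) (by linarith) 2
  nlinarith [mul_nonneg h3 (Real.sqrt_nonneg E)]

/-- The difference σ² - σ'² = k'² - k² does not depend on the channel. Both exponents lie on the
same ray, so |σ + σ'| = |σ| + |σ'| ≥ 2c; dividing gives the constant β/c, uniform in m. -/
lemma exists_lipschitz (hA : Admissible d n₀ N α β) (hαβ : α ≤ β) :
    ∃ C, 0 ≤ C ∧ ∀ k ∈ Icc α β, ∀ k' ∈ Icc α β, ∀ m : ℕ,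
    ‖sig d n₀ N m k - sig d n₀ N m k'‖ ≤ C * |k - k'| := by
  obtain ⟨c, c0, hc⟩ := hA.exists_lower hαβ
  have hb : 0 < β := hA.pos ⟨hαβ, le_rfl⟩
  refine ⟨β / c, by positivity, fun k hk k' hk' m => ?_⟩
  have sum : ‖sig d n₀ N m k + sig d n₀ N m k'‖ = ‖sig d n₀ N m k‖ + ‖sig d n₀ N m k'‖ := by
    unfold sig
    split_ifs
    · rw [← mul_add, norm_mul, norm_mul, norm_mul, norm_neg, Complex.norm_I, one_mul, one_mul,
        one_mul, ← Complex.ofReal_add, Complex.norm_real, Complex.norm_real, Complex.norm_real,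
        Real.norm_of_nonneg, Real.norm_of_nonneg, Real.norm_of_nonneg] <;>
      simp only [waveNumber] <;> positivity
    · rw [← Complex.ofReal_add, Complex.norm_real, Complex.norm_real, Complex.norm_real,
        Real.norm_of_nonneg, Real.norm_of_nonneg, Real.norm_of_nonneg] <;>
      simp only [decayRate] <;> positivity
  have low : ∀ k ∈ Icc α β, c ≤ ‖sig d n₀ N m k‖ := fun k hk =>
    le_trans (le_mul_of_one_le_right c0.le (by linarith [Nat.cast_nonneg (α := ℝ) m])) (hc k hk m)
  have prod : ‖sig d n₀ N m k - sig d n₀ N m k'‖ * ‖sig d n₀ N m k + sig d n₀ N m k'‖ =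
      |k - k'| * (k + k') := by
    rw [← norm_mul, show (sig d n₀ N m k - sig d n₀ N m k') * (sig d n₀ N m k + sig d n₀ N m k') =
      sig d n₀ N m k ^ 2 - sig d n₀ N m k' ^ 2 by ring, hA.sig_sq hk, hA.sig_sq hk',
      ← Complex.ofReal_sub, Complex.norm_real, Real.norm_eq_abs, ← abs_neg,
      show -(lam d m ^ 2 - (mu d n₀ + k ^ 2) - (lam d m ^ 2 - (mu d n₀ + k' ^ 2))) =
        (k - k') * (k + k') by ring, abs_mul, abs_of_pos (add_pos (hA.pos hk) (hA.pos hk'))]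
  have s1 := low k hk
  have s2 := low k' hk'
  have : ‖sig d n₀ N m k - sig d n₀ N m k'‖ * (2 * c) ≤ |k - k'| * (2 * β) := by
    calc _ ≤ ‖sig d n₀ N m k - sig d n₀ N m k'‖ * ‖sig d n₀ N m k + sig d n₀ N m k'‖ := by
          gcongr; linarith
      _ ≤ _ := by rw [prod]; gcongr; linarith [hk.2, hk'.2]
  rw [div_mul_eq_mul_div, le_div_iff₀ c0]
  linarith

end Admissible

end Waveguide

namespace Waveguide

/-! ### The scattering coefficients -/

/-- The pair of coefficients of the trace at `x = 0`. -/
def traceVec (n₀ : ℕ) (r t : ℕ → ℂ) (m : ℕ) : WithLp 2 (ℂ × ℂ) :=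
  WithLp.toLp 2 (leftTrace n₀ r (m + 1), t (m + 1))

/-- The pair of coefficients of an element of `L²(0, d)`. -/
def coeffVec (d : ℝ) (g : L2Interval d) (m : ℕ) : WithLp 2 (ℂ × ℂ) :=
  WithLp.toLp 2 (inner ℂ (chiMinusL2 d (m + 1)) g, inner ℂ (chiPlusL2 d (m + 1)) g)

lemma inner_pair (a b a' b' : ℂ) : inner ℂ (WithLp.toLp 2 (a, b) : WithLp 2 (ℂ × ℂ))
    (WithLp.toLp 2 (a', b')) = star a * a' + star b * b' := by
  rw [WithLp.prod_inner_apply]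
  simp only [RCLike.inner_apply, mul_comm, Complex.star_def]

lemma norm_pair_sq (a b : ℂ) :
    ‖(WithLp.toLp 2 (a, b) : WithLp 2 (ℂ × ℂ))‖ ^ 2 = ‖a‖ ^ 2 + ‖b‖ ^ 2 := by
  rw [WithLp.prod_norm_sq_eq_of_L2]
  rfl

lemma summable_trace_left {d : ℝ} {n₀ : ℕ} {k : ℝ} {r t : ℕ → ℂ}
    (hs : IsScatteringSolution d n₀ k r t) :
    Summable fun m : ℕ => ((m : ℝ) + 1) * ‖leftTrace n₀ r (m + 1)‖ ^ 2 := by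
  have h1 := (summable_nat_add_iff 1).2 hs.summable_left
  push_cast at h1
  refine (summable_congr_cofinite ?_).1 h1
  have : {n₀ - 1}ᶜ ∈ (cofinite : Filter ℕ) := (finite_singleton _).compl_mem_cofinite
  filter_upwards [this] with m hm
  rw [leftTrace, if_neg, zero_add]
  rintro h
  exact hm (by rw [mem_singleton_iff]; omega)

lemma summable_trace_right {d : ℝ} {n₀ : ℕ} {k : ℝ} {r t : ℕ → ℂ}
    (hs : IsScatteringSolution d n₀ k r t) :
    Summable fun m : ℕ => ((m : ℝ) + 1) * ‖t (m + 1)‖ ^ 2 := by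
  have h1 := (summable_nat_add_iff 1).2 hs.summable_right
  push_cast at h1
  exact h1

lemma summable_traceVec {d : ℝ} {n₀ : ℕ} {k : ℝ} {r t : ℕ → ℂ}
    (hs : IsScatteringSolution d n₀ k r t) :
    Summable fun m : ℕ => ((m : ℝ) + 1) * ‖traceVec n₀ r t m‖ ^ 2 := by
  simp_rw [traceVec, norm_pair_sq, mul_add]
  exact (summable_trace_left hs).add (summable_trace_right hs)

section
variable {d : ℝ} {n₀ N : ℕ} {α β : ℝ}

/-- The reflected wave has exponent σ and the incident one -σ = ik. Written through the full trace
coefficient δ + r, the derivative becomes σ(δ + r) plus the source 2ik in the incident channel. -/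
lemma leftDerivTrace_eq (hA : Admissible d n₀ N α β) {k : ℝ} (hk : k ∈ Icc α β) (r : ℕ → ℂ)
    (m : ℕ) : leftDerivTrace d n₀ k r (m + 1) =
      sig d n₀ N m k * leftTrace n₀ r (m + 1) + if m = n₀ - 1 then 2 * Complex.I * k else 0 := by
  have h1 := hA.one_le
  have e : (if m + 1 ≤ nExc d n₀ k then -Complex.I * waveNumber d n₀ k (m + 1) * r (m + 1)
      else decayRate d n₀ k (m + 1) * r (m + 1)) = sig d n₀ N m k * r (m + 1) := by
    rw [hA.exc k hk, sig, ite_mul]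
    rfl
  rw [leftDerivTrace, leftTrace, e]
  by_cases h : m = n₀ - 1
  · have h' : m + 1 = n₀ := by omega
    rw [if_pos h', if_pos h', if_pos h, h, hA.sig_channel hk]
    ring
  · have h' : ¬ m + 1 = n₀ := by omega
    rw [if_neg h', if_neg h', if_neg h]
    ring

lemma rightDerivTrace_eq (hA : Admissible d n₀ N α β) {k : ℝ} (hk : k ∈ Icc α β) (t : ℕ → ℂ)
    (m : ℕ) : rightDerivTrace d n₀ k t (m + 1) = -(sig d n₀ N m k * t (m + 1)) := by
  rw [rightDerivTrace, hA.exc k hk, sig]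
  by_cases h : m + 1 ≤ N
  · rw [if_pos h, if_pos (by omega)]; ring
  · rw [if_neg h, if_neg (by omega)]; ring

lemma summable_sig_mul (hA : Admissible d n₀ N α β) {k : ℝ} (hk : k ∈ Icc α β) {a b : ℕ → ℂ}
    (ha : Summable fun m : ℕ => ((m : ℝ) + 1) * ‖a m‖ ^ 2)
    (hb : Summable fun m : ℕ => ((m : ℝ) + 1) * ‖b m‖ ^ 2) :
    Summable fun m : ℕ => star (sig d n₀ N m k) * (star (a m) * b m) := by
  obtain ⟨C, hC0, hC⟩ := hA.exists_upper
  refine Summable.of_norm_bounded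
    ((summable_mul_of_sq (fun m : ℕ => by positivity) ha hb).mul_left C) fun m => ?_
  rw [norm_mul, norm_mul, norm_star, norm_star, ← mul_assoc C]
  exact mul_le_mul_of_nonneg_right (hC k hk m) (by positivity)

/-- The weak form of the derivative matching. The outgoing derivative on the right is -σ t, so
moving it to the left makes the two sides add up to one form on pairs of coefficients, whose only
source is the incident wave. -/
lemma hasSum_matching (hA : Admissible d n₀ N α β) {k : ℝ} (hk : k ∈ Icc α β) {r t : ℕ → ℂ}
    (hs : IsScatteringSolution d n₀ k r t) {g : L2Interval d} (hg : g ∈ HHalf d) :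
    HasSum (fun m => star (sig d n₀ N m k) * inner ℂ (traceVec n₀ r t m) (coeffVec d g m))
      (2 * Complex.I * k * inner ℂ (chiMinusL2 d (n₀ - 1 + 1)) g) := by
  obtain ⟨g1, g2⟩ := mem_HHalf_iff.1 hg
  have s1 := summable_sig_mul hA hk (summable_trace_left hs) g1
  have s2 := summable_sig_mul hA hk (summable_trace_right hs) g2
  have m1 := hs.matching_deriv g hg
  simp_rw [leftDerivTrace_eq hA hk, rightDerivTrace_eq hA hk] at m1
  have e1 : ∀ m, star (sig d n₀ N m k * leftTrace n₀ r (m + 1) +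
      if m = n₀ - 1 then 2 * Complex.I * k else 0) * inner ℂ (chiMinusL2 d (m + 1)) g =
      star (sig d n₀ N m k) * (star (leftTrace n₀ r (m + 1)) * inner ℂ (chiMinusL2 d (m + 1)) g) +
      if m = n₀ - 1 then -(2 * Complex.I * k * inner ℂ (chiMinusL2 d (n₀ - 1 + 1)) g) else 0 := by
    intro m
    split_ifs with h
    · rw [← h, star_add, star_mul]
      have : star (2 * Complex.I * (k : ℂ)) = -(2 * Complex.I * k) := by simp
      rw [this]
      ring
    · rw [add_zero, add_zero, star_mul]; ring
  have e2 : ∀ m, star (-(sig d n₀ N m k * t (m + 1))) * inner ℂ (chiPlusL2 d (m + 1)) g =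
      -(star (sig d n₀ N m k) * (star (t (m + 1)) * inner ℂ (chiPlusL2 d (m + 1)) g)) := by
    intro m
    rw [star_neg, star_mul]; ring
  simp_rw [e1, e2] at m1
  have s3 := hasSum_ite_eq (n₀ - 1) (-(2 * Complex.I * k * inner ℂ (chiMinusL2 d (n₀ - 1 + 1)) g))
  rw [(s1.hasSum.add s3).tsum_eq, tsum_neg] at m1
  have := s1.hasSum.add s2.hasSum
  convert! this using 1
  · ext m
    rw [traceVec, coeffVec, inner_pair]
    ring
  · linear_combination -m1

/-- Matching of the traces means that one function has both expansions. The decay of `r` and `t`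
then puts it in 𝓗^{1/2}, so the trace is itself an admissible test function; this is what makes the
energy argument possible. -/
lemma exists_trace (hA : Admissible d n₀ N α β) {k : ℝ} {r t : ℕ → ℂ}
    (hs : IsScatteringSolution d n₀ k r t) :
    ∃ φ ∈ HHalf d, ∀ m, coeffVec d φ m = traceVec n₀ r t m := by
  obtain ⟨φ, h1, h2⟩ := hs.matching
  have e1 := inner_of_hasSum (inner_chiMinusL2 hA.pos_d) h1
  have e2 := inner_of_hasSum (inner_chiPlusL2 hA.pos_d) h2
  refine ⟨φ, ?_, fun m => by rw [coeffVec, traceVec, e1, e2]⟩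
  rw [mem_HHalf_iff]
  simp_rw [e1, e2]
  exact ⟨summable_trace_left hs, summable_trace_right hs⟩

lemma coeffVec_sub (φ ψ : L2Interval d) (m : ℕ) :
    coeffVec d (φ - ψ) m = coeffVec d φ m - coeffVec d ψ m := by
  simp only [coeffVec, inner_sub_right]
  rfl

lemma norm_fst_le_pair (v : WithLp 2 (ℂ × ℂ)) : ‖v.fst‖ ≤ ‖v‖ := by
  refine abs_le_of_sq_le_sq' ?_ (norm_nonneg _) |>.2
  rw [WithLp.prod_norm_sq_eq_of_L2]
  linarith [sq_nonneg ‖v.snd‖]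

lemma norm_snd_le_pair (v : WithLp 2 (ℂ × ℂ)) : ‖v.snd‖ ≤ ‖v‖ := by
  refine abs_le_of_sq_le_sq' ?_ (norm_nonneg _) |>.2
  rw [WithLp.prod_norm_sq_eq_of_L2]
  linarith [sq_nonneg ‖v.fst‖]

lemma inner_self_ofReal {V : Type*} [NormedAddCommGroup V] [InnerProductSpace ℂ V] (v : V) :
    inner ℂ v v = ((‖v‖ ^ 2 : ℝ) : ℂ) := by
  rw [inner_self_eq_norm_sq_to_K]
  push_cast
  rfl

/-- A uniform bound of the trace in `𝓗^{1/2}`. -/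
lemma exists_traceVec_bound (hA : Admissible d n₀ N α β) (hαβ : α ≤ β) {r t : ℝ → ℕ → ℂ}
    (hrt : ∀ k ∈ Icc α β, IsScatteringSolution d n₀ k (r k) (t k)) :
    ∃ B, 0 ≤ B ∧ ∀ k ∈ Icc α β,
      ∑' m : ℕ, ((m : ℝ) + 1) * ‖traceVec n₀ (r k) (t k) m‖ ^ 2 ≤ B := by
  obtain ⟨c, c0, hc⟩ := hA.exists_lower hαβ
  refine ⟨4 * (2 * β) ^ 2 / c ^ 2 * 1, by positivity, fun k hk => ?_⟩
  -- Testing with the trace itself turns the form into ∑ conj(σ_m)‖v_m‖², while the right-hand side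
  -- involves only the incident coefficient; hence A = 2β and w the indicator of that channel.
  obtain ⟨φ, hφ, e⟩ := exists_trace hA (hrt k hk)
  have h := hasSum_matching hA hk (hrt k hk) hφ
  simp_rw [e, inner_self_ofReal] at h
  have hw : HasSum (fun m => (if m = n₀ - 1 then (1 : ℝ) else 0) ^ 2) 1 := by
    convert! hasSum_ite_eq (n₀ - 1) (1 : ℝ) using 1
    ext m; split_ifs <;> simp
  refine form_estimate c0 (hc k hk) (fun m => Admissible.sgn m k) (summable_traceVec (hrt k hk)) h
    (u := fun m => if m = n₀ - 1 then
      2 * Complex.I * k * inner ℂ (chiMinusL2 d (n₀ - 1 + 1)) φ else 0)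
    (hasSum_ite_eq _ _) (w := fun m => if m = n₀ - 1 then 1 else 0) (fun m => ?_) hw.summable
    hw.tsum_eq.le
  by_cases hm : m = n₀ - 1
  · rw [if_pos hm, if_pos hm, ← hm, mul_one, norm_mul]
    have h1 : ‖inner ℂ (chiMinusL2 d (m + 1)) φ‖ ≤ ‖traceVec n₀ (r k) (t k) m‖ := by
      rw [← e]; exact norm_fst_le_pair (coeffVec d φ m)
    have h2 : ‖2 * Complex.I * (k : ℂ)‖ ≤ 2 * β := by
      rw [norm_mul, norm_mul, Complex.norm_I, Complex.norm_real,
        Real.norm_of_nonneg (hA.pos hk).le]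
      simpa using hk.2
    have : 0 ≤ 2 * β := (norm_nonneg _).trans h2
    gcongr
  · rw [if_neg hm, if_neg hm]; simp

/-- The trace is Lipschitz continuous in the wave number. -/
lemma exists_traceVec_lipschitz (hA : Admissible d n₀ N α β) (hαβ : α ≤ β) {r t : ℝ → ℕ → ℂ}
    (hrt : ∀ k ∈ Icc α β, IsScatteringSolution d n₀ k (r k) (t k)) :
    ∃ C, ∀ k ∈ Icc α β, ∀ k' ∈ Icc α β, ∀ m,
      ‖traceVec n₀ (r k) (t k) m - traceVec n₀ (r k') (t k') m‖ ^ 2 ≤ C * |k - k'| ^ 2 := by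
  obtain ⟨c, c0, hc⟩ := hA.exists_lower hαβ
  obtain ⟨L, L0, hL⟩ := hA.exists_lipschitz hαβ
  obtain ⟨B, B0, hB⟩ := exists_traceVec_bound hA hαβ hrt
  refine ⟨4 * (2 + L) ^ 2 / c ^ 2 * (2 * B + 2), fun k hk k' hk' m => ?_⟩
  obtain ⟨φ, hφ, e⟩ := exists_trace hA (hrt k hk)
  obtain ⟨φ', hφ', e'⟩ := exists_trace hA (hrt k' hk')
  set v := traceVec n₀ (r k) (t k)
  set v' := traceVec n₀ (r k') (t k')
  have sv' := summable_traceVec (hrt k' hk')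
  have sv := summable_traceVec (hrt k hk)
  have cv : ∀ m, coeffVec d (φ - φ') m = v m - v' m := fun m => by rw [coeffVec_sub, e, e']
  have sD : Summable fun m : ℕ => ((m : ℝ) + 1) * ‖v m - v' m‖ ^ 2 := by
    refine Summable.of_nonneg_of_le (fun m => by positivity) (fun m => ?_)
      ((sv.add sv').mul_left 2)
    have h1 : ‖v m - v' m‖ ^ 2 ≤ 2 * (‖v m‖ ^ 2 + ‖v' m‖ ^ 2) := by
      have := norm_sub_le (v m) (v' m)
      have h2 := pow_le_pow_left₀ (norm_nonneg _) this 2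
      have := two_mul_le_add_sq ‖v m‖ ‖v' m‖
      linarith [add_sq ‖v m‖ ‖v' m‖]
    calc ((m : ℝ) + 1) * ‖v m - v' m‖ ^ 2 ≤ ((m : ℝ) + 1) * (2 * (‖v m‖ ^ 2 + ‖v' m‖ ^ 2)) := by
          gcongr
      _ = 2 * (((m : ℝ) + 1) * ‖v m‖ ^ 2 + ((m : ℝ) + 1) * ‖v' m‖ ^ 2) := by ring
  have hsub : φ - φ' ∈ HHalf d := by
    rw [mem_HHalf_iff]
    constructor
    · refine Summable.of_nonneg_of_le (fun m => by positivity) (fun m => ?_) sD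
      rw [← cv]
      gcongr
      exact norm_fst_le_pair (coeffVec d (φ - φ') m)
    · refine Summable.of_nonneg_of_le (fun m => by positivity) (fun m => ?_) sD
      rw [← cv]
      gcongr
      exact norm_snd_le_pair (coeffVec d (φ - φ') m)
  -- The identities for k and for k' are both tested with the difference of the two traces.
  have h := hasSum_matching hA hk (hrt k hk) hsub
  have h' := hasSum_matching hA hk' (hrt k' hk') hsub
  simp_rw [cv] at h h'
  set G := inner ℂ (chiMinusL2 d (n₀ - 1 + 1)) (φ - φ')
  have hu0 : Summable fun m => star (sig d n₀ N m k' - sig d n₀ N m k) *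
      inner ℂ (v' m) (v m - v' m) := by
    refine Summable.of_norm_bounded (g := fun m : ℕ => L * |k' - k| *
      (((m : ℝ) + 1) * ‖v' m‖ ^ 2 + ((m : ℝ) + 1) * ‖v m - v' m‖ ^ 2))
      ((sv'.add sD).mul_left _) fun m => ?_
    rw [norm_mul, norm_star, ← mul_add]
    have h1 := hL k' hk' k hk m
    have h2 := norm_inner_le_norm (𝕜 := ℂ) (v' m) (v m - v' m)
    have h3 := two_mul_le_add_sq ‖v' m‖ ‖v m - v' m‖
    have h4 : 0 ≤ ‖v' m‖ * ‖v m - v' m‖ := by positivity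
    have h5 : ‖v' m‖ ^ 2 + ‖v m - v' m‖ ^ 2 ≤
        ((m : ℝ) + 1) * (‖v' m‖ ^ 2 + ‖v m - v' m‖ ^ 2) :=
      le_mul_of_one_le_left (by positivity) (by linarith [Nat.cast_nonneg (α := ℝ) m])
    exact mul_le_mul h1 (by linarith) (norm_nonneg _) (by positivity)
  -- With D = v - v': conj(σ)|D|² = conj(σ)⟨v, D⟩ - conj(σ')⟨v', D⟩ + conj(σ' - σ)⟨v', D⟩. The first
  -- two sums are the sources; the third is small because σ is Lipschitz in k uniformly in the
  -- channel.
  have hz : HasSum (fun m => star (sig d n₀ N m k) * ((‖v m - v' m‖ ^ 2 : ℝ) : ℂ))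
      (2 * Complex.I * k * G - 2 * Complex.I * k' * G +
        ∑' m, star (sig d n₀ N m k' - sig d n₀ N m k) * inner ℂ (v' m) (v m - v' m)) := by
    refine ((h.sub h').add hu0.hasSum).congr_fun fun m => ?_
    rw [← inner_self_ofReal, inner_sub_left (v m) (v' m), star_sub]
    ring
  have hw : HasSum (fun m => (if m = n₀ - 1 then (1 : ℝ) else 0) ^ 2) 1 := by
    convert! hasSum_ite_eq (n₀ - 1) (1 : ℝ) using 1
    ext m; split_ifs <;> simp
  have sv1 : Summable fun m => ‖v' m‖ ^ 2 := by
    refine Summable.of_nonneg_of_le (fun m => by positivity) (fun m => ?_) sv'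
    exact le_mul_of_one_le_left (by positivity) (by linarith [Nat.cast_nonneg (α := ℝ) m])
  have sv2 : ∑' m, ‖v' m‖ ^ 2 ≤ B := by
    refine (sv1.tsum_le_tsum (fun m => ?_) sv').trans (hB k' hk')
    exact le_mul_of_one_le_left (by positivity) (by linarith [Nat.cast_nonneg (α := ℝ) m])
  -- The two contributions to the defect: ‖v'‖ from the change of exponents, the indicator from the
  -- change 2i(k - k') of the source. Accordingly A = (2 + L)|k - k'|.
  set w : ℕ → ℝ := fun m => ‖v' m‖ + if m = n₀ - 1 then 1 else 0
  have w0 : ∀ m, 0 ≤ w m := fun m => by simp only [w]; split_ifs <;> positivity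
  have wle : ∀ m, w m ^ 2 ≤ 2 * ‖v' m‖ ^ 2 + 2 * (if m = n₀ - 1 then (1 : ℝ) else 0) ^ 2 := by
    intro m
    simp only [w]
    have := two_mul_le_add_sq ‖v' m‖ (if m = n₀ - 1 then (1 : ℝ) else 0)
    linarith [add_sq ‖v' m‖ (if m = n₀ - 1 then (1 : ℝ) else 0)]
  have sw' := (sv1.mul_left 2).add (hw.summable.mul_left 2)
  have sw : Summable fun m => w m ^ 2 :=
    Summable.of_nonneg_of_le (fun m => by positivity) wle sw'
  have hW : ∑' m, w m ^ 2 ≤ 2 * B + 2 := by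
    refine (sw.tsum_le_tsum wle sw').trans ?_
    rw [(sv1.mul_left 2).tsum_add (hw.summable.mul_left 2), tsum_mul_left, tsum_mul_left,
      hw.tsum_eq]
    linarith
  have hu : HasSum (fun m => (if m = n₀ - 1 then
      2 * Complex.I * k * G - 2 * Complex.I * k' * G else 0) +
      star (sig d n₀ N m k' - sig d n₀ N m k) * inner ℂ (v' m) (v m - v' m)) _ :=
    (hasSum_ite_eq (n₀ - 1) (2 * Complex.I * k * G - 2 * Complex.I * k' * G)).add hu0.hasSum
  have est := form_estimate c0 (hc k hk) (fun m => Admissible.sgn m k) sD hz hu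
    (A := (2 + L) * |k - k'|) (w := w) (fun m => ?_) sw hW
  · have h1 := sD.le_tsum m (fun j _ => by positivity)
    have h2 : ‖v m - v' m‖ ^ 2 ≤ ((m : ℝ) + 1) * ‖v m - v' m‖ ^ 2 :=
      le_mul_of_one_le_left (by positivity) (by linarith [Nat.cast_nonneg (α := ℝ) m])
    refine (h2.trans h1).trans (est.trans_eq ?_)
    ring
  · refine (norm_add_le _ _).trans ?_
    have a1 : ‖star (sig d n₀ N m k' - sig d n₀ N m k) * inner ℂ (v' m) (v m - v' m)‖ ≤
        (2 + L) * |k - k'| * ‖v' m‖ * ‖v m - v' m‖ := by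
      rw [norm_mul, norm_star]
      have h1 := hL k' hk' k hk m
      have h2 := norm_inner_le_norm (𝕜 := ℂ) (v' m) (v m - v' m)
      rw [abs_sub_comm] at h1
      calc _ ≤ L * |k - k'| * (‖v' m‖ * ‖v m - v' m‖) := by gcongr
        _ ≤ (2 + L) * |k - k'| * (‖v' m‖ * ‖v m - v' m‖) := by gcongr; linarith
        _ = _ := by ring
    have a2 : ‖if m = n₀ - 1 then 2 * Complex.I * k * G - 2 * Complex.I * k' * G else 0‖ ≤
        (2 + L) * |k - k'| * (if m = n₀ - 1 then 1 else 0) * ‖v m - v' m‖ := by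
      by_cases hm : m = n₀ - 1
      · rw [if_pos hm, if_pos hm, show 2 * Complex.I * k * G - 2 * Complex.I * k' * G =
          2 * Complex.I * ((k - k' : ℝ) : ℂ) * G by push_cast; ring, norm_mul, norm_mul, norm_mul,
          Complex.norm_I, Complex.norm_real, Complex.norm_two, Real.norm_eq_abs, mul_one, mul_one]
        have : ‖G‖ ≤ ‖v m - v' m‖ := by
          rw [← cv, hm]; exact norm_fst_le_pair (coeffVec d (φ - φ') (n₀ - 1))
        gcongr
        linarith
      · rw [if_neg hm, if_neg hm]; simp
    calc _ ≤ _ := add_le_add a2 a1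
      _ = _ := by simp only [w]; ring

lemma continuousOn_traceVec (hA : Admissible d n₀ N α β) (hαβ : α ≤ β) {r t : ℝ → ℕ → ℂ}
    (hrt : ∀ k ∈ Icc α β, IsScatteringSolution d n₀ k (r k) (t k)) (m : ℕ) :
    ContinuousOn (fun k => traceVec n₀ (r k) (t k) m) (Icc α β) := by
  obtain ⟨C, hC⟩ := exists_traceVec_lipschitz hA hαβ hrt
  have hC' : ∀ k ∈ Icc α β, ∀ k' ∈ Icc α β,
      ‖traceVec n₀ (r k) (t k) m - traceVec n₀ (r k') (t k') m‖ ≤ √C * |k - k'| := by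
    intro k hk k' hk'
    have := Real.sqrt_le_sqrt (hC k hk k' hk' m)
    rwa [Real.sqrt_sq (norm_nonneg _), Real.sqrt_mul' _ (by positivity),
      Real.sqrt_sq (abs_nonneg _)] at this
  refine (LipschitzOnWith.of_dist_le_mul (K := Real.toNNReal √C) fun k hk k' hk' => ?_).continuousOn
  rw [dist_eq_norm, Real.dist_eq, Real.coe_toNNReal _ (Real.sqrt_nonneg _)]
  exact hC' k hk k' hk'

lemma continuousOn_reflection (hA : Admissible d n₀ N α β) (hαβ : α ≤ β) {r t : ℝ → ℕ → ℂ}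
    (hrt : ∀ k ∈ Icc α β, IsScatteringSolution d n₀ k (r k) (t k)) (m : ℕ) :
    ContinuousOn (fun k => r k (m + 1)) (Icc α β) := by
  have h1 : ContinuousOn (fun k => (traceVec n₀ (r k) (t k) m).fst) (Icc α β) :=
    (continuous_fst.comp (WithLp.prod_continuous_ofLp 2 ℂ ℂ)).comp_continuousOn
      (continuousOn_traceVec hA hαβ hrt m)
  refine (h1.sub (continuousOn_const (c := if m + 1 = n₀ then 1 else 0))).congr fun k _ => ?_
  simp [traceVec, leftTrace]

lemma continuousOn_transmission (hA : Admissible d n₀ N α β) (hαβ : α ≤ β) {r t : ℝ → ℕ → ℂ}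
    (hrt : ∀ k ∈ Icc α β, IsScatteringSolution d n₀ k (r k) (t k)) (m : ℕ) :
    ContinuousOn (fun k => t k (m + 1)) (Icc α β) :=
  (continuous_snd.comp (WithLp.prod_continuous_ofLp 2 ℂ ℂ)).comp_continuousOn
      (continuousOn_traceVec hA hαβ hrt m)

/-- A uniform bound of the reflection and transmission coefficients. -/
lemma exists_coefficient_bound (hA : Admissible d n₀ N α β) (hαβ : α ≤ β) {r t : ℝ → ℕ → ℂ}
    (hrt : ∀ k ∈ Icc α β, IsScatteringSolution d n₀ k (r k) (t k)) :
    ∃ B, 0 ≤ B ∧ ∀ k ∈ Icc α β, ∀ s : Finset ℕ,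
      ∑ m ∈ s, ((m : ℝ) + 1) * ‖r k (m + 1)‖ ^ 2 ≤ B ∧
      ∑ m ∈ s, ((m : ℝ) + 1) * ‖t k (m + 1)‖ ^ 2 ≤ B := by
  obtain ⟨B, B0, hB⟩ := exists_traceVec_bound hA hαβ hrt
  -- In the incident channel the trace coefficient is 1 + r, so ‖r‖² ≤ 2T² + 2 with weight m + 1 =
  -- n₀.
  refine ⟨2 * B + 2 * n₀, by positivity, fun k hk s => ?_⟩
  have sv := summable_traceVec (hrt k hk)
  have h1 : ∑ m ∈ s, ((m : ℝ) + 1) * ‖traceVec n₀ (r k) (t k) m‖ ^ 2 ≤ B :=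
    (sv.sum_le_tsum s fun m _ => by positivity).trans (hB k hk)
  constructor
  · have key : ∀ m : ℕ, ((m : ℝ) + 1) * ‖r k (m + 1)‖ ^ 2 ≤
        2 * (((m : ℝ) + 1) * ‖traceVec n₀ (r k) (t k) m‖ ^ 2) +
          if m = n₀ - 1 then 2 * (n₀ : ℝ) else 0 := by
      intro m
      have h2 := norm_fst_le_pair (traceVec n₀ (r k) (t k) m)
      set T := ‖traceVec n₀ (r k) (t k) m‖
      change ‖leftTrace n₀ (r k) (m + 1)‖ ≤ T at h2
      have hn := hA.one_le
      by_cases hm : m = n₀ - 1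
      · have hm' : m + 1 = n₀ := by omega
        rw [if_pos hm, show (m : ℝ) + 1 = n₀ by exact_mod_cast hm']
        rw [leftTrace, if_pos hm'] at h2
        have h3 : ‖r k (m + 1)‖ ≤ T + 1 := by
          calc ‖r k (m + 1)‖ = ‖(1 + r k (m + 1)) - 1‖ := by ring_nf
            _ ≤ ‖1 + r k (m + 1)‖ + ‖(1 : ℂ)‖ := norm_sub_le _ _
            _ ≤ T + 1 := by rw [norm_one]; linarith
        have h4 : ‖r k (m + 1)‖ ^ 2 ≤ 2 * T ^ 2 + 2 := by
          nlinarith [pow_le_pow_left₀ (norm_nonneg _) h3 2, sq_nonneg (T - 1)]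
        nlinarith [mul_le_mul_of_nonneg_left h4 (Nat.cast_nonneg (α := ℝ) n₀)]
      · have hm' : ¬ m + 1 = n₀ := by omega
        rw [if_neg hm, add_zero]
        rw [leftTrace, if_neg hm', zero_add] at h2
        have h4 := pow_le_pow_left₀ (norm_nonneg _) h2 2
        have h5 : 0 ≤ (m : ℝ) + 1 := by positivity
        have h6 : 0 ≤ T ^ 2 := sq_nonneg _
        nlinarith [mul_le_mul_of_nonneg_left h4 h5, mul_nonneg h5 h6]
    refine (Finset.sum_le_sum fun m _ => key m).trans ?_
    rw [Finset.sum_add_distrib, ← Finset.mul_sum, Finset.sum_ite_eq']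
    have : (if n₀ - 1 ∈ s then 2 * (n₀ : ℝ) else 0) ≤ 2 * n₀ := by split_ifs <;> simp
    linarith
  · have key : ∀ m : ℕ, ((m : ℝ) + 1) * ‖t k (m + 1)‖ ^ 2 ≤
        ((m : ℝ) + 1) * ‖traceVec n₀ (r k) (t k) m‖ ^ 2 := by
      intro m
      gcongr
      exact norm_snd_le_pair (traceVec n₀ (r k) (t k) m)
    refine (Finset.sum_le_sum fun m _ => key m).trans (h1.trans ?_)
    have : (0 : ℝ) ≤ n₀ := by positivity
    linarith

/-! ### The matching conditions tested against smooth functions -/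

lemma matching_test (hd : 0 < d) {k : ℝ} {r t : ℕ → ℂ}
    (hs : IsScatteringSolution d n₀ k r t) {g : ℝ → ℝ} (hg : IsTestInterval d g) :
    ∃ z, HasSum (fun m => leftTrace n₀ r (m + 1) * coeff (chiMinus d (m + 1)) g) z ∧
      HasSum (fun m => t (m + 1) * coeff (chiPlus d (m + 1)) g) z := by
  obtain ⟨φ, h1, h2⟩ := hs.matching
  refine ⟨inner ℂ hg.toL2 φ, ?_, ?_⟩
  · refine (h1.mapL (innerSL ℂ hg.toL2)).congr_fun fun m => ?_
    rw [innerSL_apply_apply, inner_smul_right, ← inner_conj_symm, inner_chiMinusL2_test hd,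
      ← Complex.star_def, star_coeff ((transverse_minus hd).real_left m)]
  · refine (h2.mapL (innerSL ℂ hg.toL2)).congr_fun fun m => ?_
    rw [innerSL_apply_apply, inner_smul_right, ← inner_conj_symm, inner_chiPlusL2_test hd,
      ← Complex.star_def, star_coeff ((transverse_plus hd).real_left m)]

/-- The complex conjugate of `hasSum_matching` for a real test function: coefficients of real
functions in real modes are real, so conjugation only frees σ and the trace and flips the sign of
the source. -/
lemma matching_deriv_test (hA : Admissible d n₀ N α β) {k : ℝ} (hk : k ∈ Icc α β) {r t : ℕ → ℂ}
    (hs : IsScatteringSolution d n₀ k r t) {g : ℝ → ℝ} (hg : IsTestInterval d g) :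
    HasSum (fun m => sig d n₀ N m k * (leftTrace n₀ r (m + 1) * coeff (chiMinus d (m + 1)) g +
      t (m + 1) * coeff (chiPlus d (m + 1)) g))
      (-2 * Complex.I * k * coeff (chiMinus d (n₀ - 1 + 1)) g) := by
  have hd := hA.pos_d
  have h := (hasSum_matching hA hk hs (test_mem_HHalf hd hg)).star
  have e1 := fun m => star_coeff ((transverse_minus hd).real_left m) g
  have e2 := fun m => star_coeff ((transverse_plus hd).real_left m) g
  rw [inner_chiMinusL2_test hd] at h
  convert! h using 1
  · ext m
    rw [traceVec, coeffVec, inner_pair, inner_chiMinusL2_test hd, inner_chiPlusL2_test hd]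
    simp only [star_mul', star_add, star_star, e1, e2]
  · rw [star_mul', e1]
    simp
end

end Waveguide

namespace Waveguide

/-! ### Plancherel's inequality for wave packets -/

open scoped FourierTransform in
-- The L² Fourier transform agrees with the transform of tempered distributions, and the latter with
-- the Fourier integral by the multiplication formula ∫ (𝓕φ) h = ∫ φ 𝓕h. Testing with smooth
-- compactly supported φ identifies the two functions almost everywhere.
lemma fourier_ae_eq {h : ℝ → ℂ} (h1 : Integrable h) (h2 : MemLp h 2) :
    𝓕 h =ᵐ[volume] (𝓕 h2.toLp : Lp ℂ 2 (volume : Measure ℝ)) := by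
  have cont : Continuous (𝓕 h) :=
    VectorFourier.fourierIntegral_continuous Real.continuous_fourierChar
      (by exact continuous_inner (𝕜 := ℝ)) h1
  refine ae_eq_of_integral_contDiff_smul_eq cont.locallyIntegrable
    ((Lp.memLp _).locallyIntegrable (by norm_num)) fun g gs gc => ?_
  have hg₁ : HasCompactSupport (Complex.ofRealCLM ∘ g) := gc.comp_left rfl
  have hg₂ : ContDiff ℝ ∞ (Complex.ofRealCLM ∘ g) := by fun_prop
  set φ := hg₁.toSchwartzMap hg₂
  have e := congrArg (fun T => T φ) (Lp.fourier_toTemperedDistribution_eq h2.toLp)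
  simp only [TemperedDistribution.fourier_apply, Lp.toTemperedDistribution_apply] at e
  have e2 : ∫ x, (𝓕 φ) x • (h2.toLp : Lp ℂ 2 (volume : Measure ℝ)) x = ∫ x, (𝓕 φ) x • h x :=
    integral_congr_ae (by filter_upwards [h2.coeFn_toLp] with x hx; rw [hx])
  have e3 : ∫ x, (𝓕 φ) x • h x = ∫ x, φ x • 𝓕 h x := by
    simpa using! VectorFourier.integral_fourierIntegral_smul_eq_flip (L := innerₗ ℝ)
      Real.continuous_fourierChar continuous_inner φ.integrable h1
  rw [e2, e3] at e
  exact e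

open scoped FourierTransform in
lemma memLp_fourier {h : ℝ → ℂ} (h1 : Integrable h) (h2 : MemLp h 2) : MemLp (𝓕 h) 2 :=
  (Lp.memLp _).ae_eq (fourier_ae_eq h1 h2).symm

open scoped FourierTransform in
lemma eLpNorm_fourier {h : ℝ → ℂ} (h1 : Integrable h) (h2 : MemLp h 2) :
    eLpNorm (𝓕 h) 2 = eLpNorm h 2 := by
  have e := Lp.norm_fourier_eq h2.toLp
  rw [eLpNorm_congr_ae (fourier_ae_eq h1 h2), ← Lp.enorm_def, ← eLpNorm_congr_ae h2.coeFn_toLp,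
    ← Lp.enorm_def, ← ofReal_norm, ← ofReal_norm, e]

section Wave
variable {X : Type*} [TopologicalSpace X] [CompactSpace X] [MeasurableSpace X] [BorelSpace X]

/-- The superposition `∫ h(k) e^{τ(k) x} dμ(k)` of exponentials. -/
def wave (μ : Measure X) (τ h : C(X, ℂ)) (x : ℝ) : ℂ := ∫ k, h k * Complex.exp (τ k * x) ∂μ

end Wave

/-- Lebesgue measure on a compact interval. -/
def iccMeasure (α β : ℝ) : Measure (Icc α β) := volume.comap Subtype.val

instance (α β : ℝ) : IsFiniteMeasure (iccMeasure α β) := ⟨by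
  rw [iccMeasure, comap_subtype_coe_apply measurableSet_Icc]
  exact (measure_mono (by rintro _ ⟨k, -, rfl⟩; exact k.2)).trans_lt
    (isCompact_Icc (a := α) (b := β)).measure_lt_top⟩

lemma integral_subtype_Icc {α β : ℝ} (f : ℝ → ℂ) :
    ∫ k : Icc α β, f k ∂iccMeasure α β = ∫ k in Icc α β, f k :=
  integral_subtype_comap measurableSet_Icc f

/-- Plancherel's inequality for the superposition of propagating waves. -/
lemma exists_wave_bound {α β m₀ s : ℝ} (hα : 0 < α) (hs : s ^ 2 = 1)
    (hm : ∀ k ∈ Icc α β, 0 < m₀ + k ^ 2) (τ : C(Icc α β, ℂ))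
    (hτ : ∀ k : Icc α β, τ k = s * Complex.I * (√(m₀ + (k : ℝ) ^ 2) : ℝ)) :
    ∃ C, 0 ≤ C ∧ ∀ h : C(Icc α β, ℂ), MemLp (wave (iccMeasure α β) τ h) 2 ∧
      eLpNorm (wave (iccMeasure α β) τ h) 2 ≤ ENNReal.ofReal (C * ‖h‖) := by
  rcases lt_or_ge β α with hlt | hαβ
  · have hE : IsEmpty (Icc α β) := ⟨fun k => absurd (k.2.1.trans k.2.2) (not_le.2 hlt)⟩
    refine ⟨0, le_rfl, fun h => ?_⟩
    have : wave (iccMeasure α β) τ h = 0 := by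
      ext x
      simp [wave, Measure.eq_zero_of_isEmpty]
    rw [this]
    simp
  have hpi := Real.pi_pos
  -- The frequency ξ = p(k) is chosen so that e^{-2πiξx} = e^{is√(m₀+k²)x}; `q` inverts `p` on [α,
  -- β], and `w` below is the Jacobian 1/|p'| written in the variable ξ.
  set p : ℝ → ℝ := fun k => -s * √(m₀ + k ^ 2) / (2 * Real.pi)
  set q : ℝ → ℝ := fun ξ => √((2 * Real.pi * ξ) ^ 2 - m₀)
  have hp : ∀ k ∈ Icc α β, q (p k) = k := by
    intro k hk
    simp only [p, q]
    rw [mul_div_cancel₀ _ (by positivity), mul_pow, neg_sq, hs, Real.sq_sqrt (hm k hk).le, one_mul,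
      add_sub_cancel_left, Real.sqrt_sq (hα.trans_le hk.1).le]
  have hinj : InjOn p (Icc α β) := fun k hk k' hk' e => by rw [← hp k hk, e, hp k' hk']
  set p' : ℝ → ℝ := fun k => -s * (k / √(m₀ + k ^ 2)) / (2 * Real.pi)
  have hder : ∀ k ∈ Icc α β, HasDerivWithinAt p (p' k) (Icc α β) k := by
    intro k hk
    have h1 : HasDerivAt (fun k : ℝ => m₀ + k ^ 2) (2 * k) k := by
      simpa using (hasDerivAt_pow 2 k).const_add m₀
    have h2 := ((h1.sqrt (hm k hk).ne').const_mul (-s)).div_const (2 * Real.pi)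
    refine (h2.congr_deriv ?_).hasDerivWithinAt
    simp only [p']
    rw [mul_div_mul_left _ _ two_ne_zero]
  have hcont : Continuous p := by simp only [p]; fun_prop
  have hK : IsCompact (p '' Icc α β) := isCompact_Icc.image hcont
  have abs_s : |s| = 1 := (sq_eq_sq₀ (abs_nonneg s) zero_le_one).1 (by rw [sq_abs, hs, one_pow])
  set w : ℝ → ℝ := fun ξ => (2 * Real.pi) ^ 2 * |ξ| / q ξ
  have hw : ∀ k ∈ Icc α β, |p' k| * w (p k) = 1 := by
    intro k hk
    have k0 : 0 < k := hα.trans_le hk.1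
    have r0 : 0 < √(m₀ + k ^ 2) := Real.sqrt_pos.2 (hm k hk)
    simp only [w]
    rw [hp k hk]
    simp only [p, p', abs_div, abs_mul, abs_neg, abs_s, abs_of_pos k0, abs_of_pos r0,
      abs_of_pos (by positivity : 0 < 2 * Real.pi)]
    field_simp
  -- The Jacobian at p(k) is 2π√(m₀+k²)/k, largest numerator at β and smallest denominator at α; α >
  -- 0 is essential.
  set M := 2 * Real.pi * √(m₀ + β ^ 2) / α
  have hwM : ∀ ξ ∈ p '' Icc α β, ‖w ξ‖ ≤ M := by
    rintro _ ⟨k, hk, rfl⟩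
    have k0 : 0 < k := hα.trans_le hk.1
    have r0 : 0 < √(m₀ + k ^ 2) := Real.sqrt_pos.2 (hm k hk)
    simp only [w, M]
    rw [hp k hk]
    simp only [p, abs_div, abs_mul, abs_neg, abs_s, Real.norm_eq_abs, abs_of_pos k0,
      abs_of_pos r0, abs_of_pos hpi, abs_one, abs_two, abs_pow]
    have e : (2 * Real.pi) ^ 2 * (1 * √(m₀ + k ^ 2) / (2 * Real.pi)) / k =
        2 * Real.pi * √(m₀ + k ^ 2) / k := by field_simp
    rw [e]
    have : k ^ 2 ≤ β ^ 2 := pow_le_pow_left₀ k0.le hk.2 2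
    gcongr
    exact hk.1
  have M0 : 0 ≤ M := by positivity
  set V := volume (p '' Icc α β)
  have hV : V ≠ ⊤ := hK.measure_lt_top.ne
  -- G is supported on the image of [α, β], of finite measure V, and bounded by M‖h‖; its L² norm is
  -- at most V^{1/2} M‖h‖.
  refine ⟨(V ^ (1 / 2 : ℝ)).toReal * M, by positivity, fun h => ?_⟩
  set hb : ℝ → ℂ := IccExtend hαβ h
  have hbc : Continuous hb := h.continuous.Icc_extend'
  have hbn : ∀ k, ‖hb k‖ ≤ ‖h‖ := fun k => h.norm_coe_le_norm _
  set G : ℝ → ℂ := (p '' Icc α β).indicator fun ξ => (w ξ : ℂ) * hb (q ξ)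
  have hGm : Measurable fun ξ => (w ξ : ℂ) * hb (q ξ) := by
    have : Measurable q := by simp only [q]; fun_prop
    have : Measurable w := by simp only [w]; fun_prop
    fun_prop
  have bound : ∀ᵐ ξ ∂volume.restrict (p '' Icc α β), ‖(w ξ : ℂ) * hb (q ξ)‖ ≤ M * ‖h‖ := by
    filter_upwards [ae_restrict_mem hK.measurableSet] with ξ hξ
    rw [norm_mul, Complex.norm_real]
    exact mul_le_mul (hwM ξ hξ) (hbn _) (norm_nonneg _) M0
  have fin : IsFiniteMeasure (volume.restrict (p '' Icc α β)) := ⟨by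
    rw [Measure.restrict_apply_univ]; exact hK.measure_lt_top⟩
  have G2 : MemLp G 2 :=
    (memLp_indicator_iff_restrict hK.measurableSet).2
      (MemLp.of_bound hGm.aestronglyMeasurable _ bound)
  have G1 : Integrable G := by
    rw [← memLp_one_iff_integrable]
    exact (memLp_indicator_iff_restrict hK.measurableSet).2
      (MemLp.of_bound hGm.aestronglyMeasurable _ bound)
  have eq : wave (iccMeasure α β) τ h = FourierTransform.fourier G := by
    ext x
    rw [Real.fourier_real_eq_integral_exp_smul]
    have e1 : ∀ v : ℝ, Complex.exp (((-2 * Real.pi * v * x : ℝ)) * Complex.I) • G v =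
        (p '' Icc α β).indicator (fun v => Complex.exp (((-2 * Real.pi * v * x : ℝ)) * Complex.I) •
          ((w v : ℂ) * hb (q v))) v := by
      intro v
      by_cases hv : v ∈ p '' Icc α β
      · simp only [G, indicator_of_mem hv]
      · simp only [G, indicator_of_notMem hv, smul_zero]
    simp_rw [e1]
    rw [integral_indicator hK.measurableSet,
      integral_image_eq_integral_abs_deriv_smul measurableSet_Icc hder hinj, wave]
    have e2 : ∀ k : Icc α β, h k * Complex.exp (τ k * x) =
        hb k * Complex.exp (s * Complex.I * (√(m₀ + (k : ℝ) ^ 2) : ℝ) * x) := by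
      intro k
      rw [hτ]
      simp only [hb, IccExtend_val]
    simp_rw [e2]
    rw [integral_subtype_Icc (fun k : ℝ =>
      hb k * Complex.exp (s * Complex.I * (√(m₀ + (k : ℝ) ^ 2) : ℝ) * x))]
    refine setIntegral_congr_fun measurableSet_Icc fun k hk => ?_
    rw [hp k hk, Complex.real_smul, smul_eq_mul]
    have e3 : ((-2 * Real.pi * p k * x : ℝ) : ℂ) * Complex.I =
        s * Complex.I * (√(m₀ + (k : ℝ) ^ 2) : ℝ) * x := by
      simp only [p]
      push_cast
      have : (Real.pi : ℂ) ≠ 0 := by exact_mod_cast hpi.ne'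
      field_simp
    have e4 : ((|p' k| : ℝ) : ℂ) * (w (p k) : ℂ) = 1 := by exact_mod_cast hw k hk
    rw [e3]
    linear_combination -(hb k * Complex.exp (s * Complex.I * (√(m₀ + (k : ℝ) ^ 2) : ℝ) * x)) * e4
  rw [eq]
  refine ⟨memLp_fourier G1 G2, ?_⟩
  rw [eLpNorm_fourier G1 G2, eLpNorm_indicator_eq_eLpNorm_restrict hK.measurableSet]
  refine (eLpNorm_le_of_ae_bound bound).trans_eq ?_
  rw [Measure.restrict_apply_univ, mul_assoc (_ : ℝ) M, ENNReal.ofReal_mul ENNReal.toReal_nonneg,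
    ENNReal.ofReal_toReal (by simp [hV, ENNReal.rpow_eq_top_iff])]
  norm_num [V]

end Waveguide

namespace Waveguide

/-! ### Calculus of wave packets in one dimension -/

section Wave
variable {X : Type*} [TopologicalSpace X] [CompactSpace X] [MeasurableSpace X] [BorelSpace X]
  {μ : Measure X} [IsFiniteMeasure μ]

lemma integrable_continuousMap (f : C(X, ℂ)) : Integrable f μ := by
  rw [← memLp_one_iff_integrable]
  exact MemLp.of_bound f.continuous.aestronglyMeasurable ‖f‖ (ae_of_all _ f.norm_coe_le_norm)

lemma integrable_of_continuous {f : X → ℂ} (hf : Continuous f) : Integrable f μ :=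
  integrable_continuousMap ⟨f, hf⟩

/-- Differentiation in x multiplies the amplitude by the exponent. The dominating constant is taken
on the unit ball around x, since the exponentials may grow on one side. -/
lemma hasDerivAt_wave (τ h : C(X, ℂ)) (x : ℝ) :
    HasDerivAt (wave μ τ h) (wave μ τ (τ * h) x) x := by
  refine (hasDerivAt_integral_of_dominated_loc_of_deriv_le (s := Metric.ball x 1)
    (F := fun (x : ℝ) k => h k * Complex.exp (τ k * x))
    (F' := fun (x : ℝ) k => (τ * h) k * Complex.exp (τ k * x))
    (bound := fun _ => ‖τ * h‖ * Real.exp (‖τ‖ * (|x| + 1)))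
    (Metric.ball_mem_nhds x one_pos) (Eventually.of_forall fun x => ?_) ?_ ?_ ?_
    (integrable_const _) ?_).2
  · exact (by fun_prop : Continuous fun k => h k * Complex.exp (τ k * x)).aestronglyMeasurable
  · exact integrable_of_continuous (by fun_prop)
  · exact (by fun_prop :
      Continuous fun k => (τ * h) k * Complex.exp (τ k * x)).aestronglyMeasurable
  · refine ae_of_all _ fun k z hz => ?_
    rw [norm_mul]
    refine mul_le_mul ((τ * h).norm_coe_le_norm k) ?_ (norm_nonneg _) (norm_nonneg _)
    rw [Complex.norm_exp]
    refine Real.exp_le_exp.2 ?_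
    refine (Complex.re_le_norm _).trans ?_
    rw [norm_mul, Complex.norm_real, Real.norm_eq_abs]
    have : |z| ≤ |x| + 1 := by
      rw [Metric.mem_ball, Real.dist_eq] at hz
      have := abs_sub_abs_le_abs_sub z x
      linarith
    exact mul_le_mul (τ.norm_coe_le_norm k) this (abs_nonneg _) (norm_nonneg _)
  · refine ae_of_all _ fun k z _ => ?_
    have h1 : HasDerivAt (fun z : ℝ => τ k * (z : ℂ)) (τ k) z := by
      simpa using (Complex.ofRealCLM.hasDerivAt (x := z)).const_mul (τ k)
    have := (h1.cexp).const_mul (h k)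
    convert! this using 1
    simp only [ContinuousMap.mul_apply]
    ring

lemma continuous_wave (τ h : C(X, ℂ)) : Continuous (wave μ τ h) :=
  continuous_iff_continuousAt.2 fun x => (hasDerivAt_wave τ h x).continuousAt

lemma wave_add (τ h h' : C(X, ℂ)) : wave μ τ (h + h') = wave μ τ h + wave μ τ h' := by
  ext x
  simp only [wave, Pi.add_apply, ContinuousMap.add_apply, add_mul]
  exact integral_add (integrable_of_continuous (by fun_prop))
    (integrable_of_continuous (by fun_prop))

lemma wave_smul (τ : C(X, ℂ)) (a : ℂ) (h : C(X, ℂ)) : wave μ τ (a • h) = a • wave μ τ h := by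
  ext x
  simp only [wave, Pi.smul_apply, ContinuousMap.smul_apply, smul_eq_mul, mul_assoc]
  exact integral_const_mul _ _

lemma norm_wave_le {τ h : C(X, ℂ)} {x M : ℝ} (hM : ∀ k, ‖h k * Complex.exp (τ k * x)‖ ≤ M) :
    ‖wave μ τ h x‖ ≤ M * μ.real univ :=
  norm_integral_le_of_norm_le_const (ae_of_all _ hM)

end Wave

lemma integral_exp_neg_abs {κ : ℝ} (hκ : 0 < κ) :
    ∫ x : ℝ, Real.exp (-κ * |x|) = 2 / κ := by
  rw [integral_comp_abs (f := fun x => Real.exp (-κ * x)), integral_exp_mul_Ioi (by linarith)]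
  simp
  field_simp

lemma eLpNorm_exp_neg_abs {κ A : ℝ} (hκ : 0 < κ) (hA : 0 ≤ A) :
    MemLp (fun x : ℝ => A * Real.exp (-κ * |x|)) 2 ∧
    eLpNorm (fun x : ℝ => A * Real.exp (-κ * |x|)) 2 = ENNReal.ofReal (A / √κ) := by
  have e : ∀ x : ℝ, (A * Real.exp (-κ * |x|)) ^ 2 = A ^ 2 * Real.exp (-(2 * κ) * |x|) := by
    intro x
    rw [mul_pow, ← Real.exp_nat_mul]
    congr 2
    push_cast; ring
  have i := integral_exp_neg_abs (by positivity : 0 < 2 * κ)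
  have int : Integrable fun x : ℝ => Real.exp (-(2 * κ) * |x|) := by
    -- A non-integrable function has integral 0 by convention, which contradicts the positive value
    -- just computed.
    by_contra h
    rw [integral_undef h] at i
    have : 0 < 2 / (2 * κ) := by positivity
    linarith
  have m : MemLp (fun x : ℝ => A * Real.exp (-κ * |x|)) 2 := by
    rw [memLp_two_iff_integrable_sq (by fun_prop)]
    simp_rw [e]
    exact int.const_mul _
  refine ⟨m, ?_⟩
  rw [m.eLpNorm_eq_integral_rpow_norm (by norm_num) (by norm_num)]
  congr 1
  have : ∀ x : ℝ, ‖A * Real.exp (-κ * |x|)‖ ^ (2 : ENNReal).toReal =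
      A ^ 2 * Real.exp (-(2 * κ) * |x|) := by
    intro x
    rw [Real.norm_of_nonneg (by positivity), ENNReal.toReal_ofNat, Real.rpow_ofNat, e]
  simp_rw [this]
  rw [integral_const_mul, i, ENNReal.toReal_ofNat, ← one_div, ← Real.sqrt_eq_rpow,
    Real.sqrt_mul (by positivity), Real.sqrt_sq hA, div_eq_mul_inv A, ← Real.sqrt_inv]
  congr 2
  field_simp

section Wave
variable {X : Type*} [TopologicalSpace X] [CompactSpace X] [MeasurableSpace X] [BorelSpace X]
  {μ : Measure X} [IsFiniteMeasure μ]

/-- The `L²` bound of a superposition of evanescent waves. -/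
lemma eLpNorm_evanescent {s : Set ℝ} (hs : MeasurableSet s) {κ : ℝ} (hκ : 0 < κ)
    {τ : C(X, ℂ)} (hτ : ∀ k, ∀ x ∈ s, (τ k).re * x ≤ -κ * |x|) (h : C(X, ℂ)) :
    MemLp (s.indicator (wave μ τ h)) 2 ∧
      eLpNorm (s.indicator (wave μ τ h)) 2 ≤ ENNReal.ofReal ((∫ k, ‖h k‖ ∂μ) / √κ) := by
  have I0 : 0 ≤ ∫ k, ‖h k‖ ∂μ := integral_nonneg fun _ => norm_nonneg _
  obtain ⟨m, e⟩ := eLpNorm_exp_neg_abs hκ I0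
  have b : ∀ x, ‖s.indicator (wave μ τ h) x‖ ≤ (∫ k, ‖h k‖ ∂μ) * Real.exp (-κ * |x|) := by
    intro x
    by_cases hx : x ∈ s
    · rw [indicator_of_mem hx, wave, ← integral_mul_const]
      refine norm_integral_le_of_norm_le ((integrable_continuousMap h).norm.mul_const _)
        (ae_of_all _ fun k => ?_)
      rw [norm_mul, Complex.norm_exp, Complex.re_mul_ofReal]
      exact mul_le_mul_of_nonneg_left (Real.exp_le_exp.2 (hτ k x hx)) (norm_nonneg _)
    · rw [indicator_of_notMem hx, norm_zero]
      positivity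
  have meas : AEStronglyMeasurable (s.indicator (wave μ τ h)) :=
    ((continuous_wave τ h).aestronglyMeasurable).indicator hs
  have b' : ∀ᵐ x : ℝ, ‖s.indicator (wave μ τ h) x‖ ≤
      ‖(∫ k, ‖h k‖ ∂μ) * Real.exp (-κ * |x|)‖ := ae_of_all _ fun x =>
    (b x).trans (le_abs_self _)
  exact ⟨m.of_le meas b', (eLpNorm_mono_ae b').trans_eq e⟩

end Wave

/-! ### Integration by parts on a half-line or on the line -/

/-- `s` is a half-line starting at `0` or the whole line, and `ε` is the sign of the boundary term
at `0` in the integration by parts. -/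
def IsSide (s : Set ℝ) (ε : ℂ) : Prop :=
  (s = Iio 0 ∧ ε = 1) ∨ (s = Ioi 0 ∧ ε = -1) ∨ (s = univ ∧ ε = 0)

lemma IsSide.measurableSet {s : Set ℝ} {ε : ℂ} (h : IsSide s ε) : MeasurableSet s := by
  rcases h with ⟨rfl, -⟩ | ⟨rfl, -⟩ | ⟨rfl, -⟩
  exacts [measurableSet_Iio, measurableSet_Ioi, MeasurableSet.univ]

/-- Compact support of g kills the contribution at infinity, so only the endpoint 0 can contribute;
ε encodes its sign and vanishes for the whole line, which lets all packets share one computation. -/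
lemma IsSide.integral_by_parts {s : Set ℝ} {ε : ℂ} (h : IsSide s ε) {g : ℝ → ℝ} {F F' : ℝ → ℂ}
    (hg : ContDiff ℝ ∞ g) (hc : HasCompactSupport g) (hF : ∀ x, HasDerivAt F (F' x) x)
    (hF' : Continuous F') :
    ∫ x in s, ((deriv g x : ℝ) : ℂ) * F x = ε * (g 0 * F 0) - ∫ x in s, (g x : ℂ) * F' x := by
  have cF : Continuous F := continuous_iff_continuousAt.2 fun y => (hF y).continuousAt
  have cg : Continuous (deriv g) := (contDiff_infty_iff_deriv.1 hg).2.continuous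
  have cg0 := hg.continuous
  have hc1 : HasCompactSupport fun x => ((deriv g x : ℝ) : ℂ) :=
    hc.deriv.comp_left (g := fun x : ℝ => (x : ℂ)) (by simp)
  have hc2 : HasCompactSupport fun x => (g x : ℂ) :=
    hc.comp_left (g := fun x : ℝ => (x : ℂ)) (by simp)
  have i1 : Integrable fun x => ((deriv g x : ℝ) : ℂ) * F x :=
    (by fun_prop : Continuous fun x => ((deriv g x : ℝ) : ℂ) * F x).integrable_of_hasCompactSupport
      hc1.mul_right
  have i2 : Integrable fun x => (g x : ℂ) * F' x :=
    (by fun_prop : Continuous fun x => (g x : ℂ) * F' x).integrable_of_hasCompactSupport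
      hc2.mul_right
  have hd : ∀ x, HasDerivAt (fun x => (g x : ℂ) * F x)
      (((deriv g x : ℝ) : ℂ) * F x + g x * F' x) x :=
    fun x => ((hg.differentiable (by simp) x).hasDerivAt.ofReal_comp).mul (hF x)
  have hde : deriv (fun x => (g x : ℂ) * F x) =
      fun x => ((deriv g x : ℝ) : ℂ) * F x + g x * F' x := funext fun x => (hd x).deriv
  have hC1 : ContDiff ℝ 1 fun x => (g x : ℂ) * F x := by
    rw [contDiff_one_iff_deriv, hde]
    exact ⟨fun x => (hd x).differentiableAt, by fun_prop⟩
  have key : ∫ x in s, deriv (fun x => (g x : ℂ) * F x) x = ε * (g 0 * F 0) := by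
    rcases h with ⟨rfl, rfl⟩ | ⟨rfl, rfl⟩ | ⟨rfl, rfl⟩
    · rw [← integral_Iic_eq_integral_Iio, HasCompactSupport.integral_Iic_deriv_eq hC1 hc2.mul_right,
        one_mul]
    · rw [HasCompactSupport.integral_Ioi_deriv_eq hC1 hc2.mul_right, neg_one_mul]
    · rw [setIntegral_univ, hde, integral_add i1 i2,
        integral_deriv_mul_of_compact hg hc hF hF', zero_mul, neg_add_cancel]
  rw [hde, integral_add i1.integrableOn i2.integrableOn] at key
  exact eq_sub_of_add_eq key

/-! ### Integration by parts in the strip -/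

lemma IsTest.dx {d : ℝ} {φ : ℝ × ℝ → ℝ} (h : IsTest d φ) : IsTest d (dx φ) :=
  ⟨contDiff_dx h.smooth, hasCompactSupport_dx h.compact, by
    refine subset_trans (closure_minimal ?_ (isClosed_tsupport φ)) h.subset
    refine subset_trans (fun z hz => ?_) (support_fderiv_subset ℝ (f := φ))
    rw [Function.mem_support] at hz ⊢
    intro h0
    exact hz (by rw [Waveguide.dx, h0]; rfl)⟩

lemma IsTest.dy {d : ℝ} {φ : ℝ × ℝ → ℝ} (h : IsTest d φ) : IsTest d (dy φ) :=
  ⟨contDiff_dy h.smooth, hasCompactSupport_dy h.compact, by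
    refine subset_trans (closure_minimal ?_ (isClosed_tsupport φ)) h.subset
    refine subset_trans (fun z hz => ?_) (support_fderiv_subset ℝ (f := φ))
    rw [Function.mem_support] at hz ⊢
    intro h0
    exact hz (by rw [Waveguide.dy, h0]; rfl)⟩

lemma IsTest.laplacian {d : ℝ} {φ : ℝ × ℝ → ℝ} (h : IsTest d φ) :
    IsTest d fun z => Waveguide.dx (Waveguide.dx φ) z + Waveguide.dy (Waveguide.dy φ) z :=
  ⟨h.dx.dx.smooth.add h.dy.dy.smooth, h.dx.dx.compact.add h.dy.dy.compact,
    (tsupport_add _ _).trans (union_subset h.dx.dx.subset h.dy.dy.subset)⟩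

lemma IsTest.eq_zero {d : ℝ} {φ : ℝ × ℝ → ℝ} (h : IsTest d φ) {z : ℝ × ℝ} (hz : z ∉ strip d) :
    φ z = 0 :=
  image_eq_zero_of_notMem_tsupport fun h' => hz (h.subset h')

lemma deriv_slice_x {φ : ℝ × ℝ → ℝ} (h : ContDiff ℝ ∞ φ) (y : ℝ) :
    deriv (fun x => φ (x, y)) = fun x => dx φ (x, y) := by
  ext x
  have h1 : HasDerivAt (fun x : ℝ => (x, y)) ((1 : ℝ), (0 : ℝ)) x :=
    (hasDerivAt_id x).prodMk (hasDerivAt_const x y)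
  exact (((h.differentiable (by simp)) (x, y)).hasFDerivAt.comp_hasDerivAt x h1).deriv

lemma deriv_slice_y {φ : ℝ × ℝ → ℝ} (h : ContDiff ℝ ∞ φ) (x : ℝ) :
    deriv (fun y => φ (x, y)) = fun y => dy φ (x, y) := by
  ext y
  have h1 : HasDerivAt (fun y : ℝ => (x, y)) ((0 : ℝ), (1 : ℝ)) y :=
    (hasDerivAt_const y x).prodMk (hasDerivAt_id y)
  exact (((h.differentiable (by simp)) (x, y)).hasFDerivAt.comp_hasDerivAt y h1).deriv

lemma IsTest.compact_slice_x {d : ℝ} {φ : ℝ × ℝ → ℝ} (h : IsTest d φ) (y : ℝ) :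
    HasCompactSupport fun x => φ (x, y) := by
  refine HasCompactSupport.intro (h.compact.image continuous_fst) fun x hx => ?_
  exact image_eq_zero_of_notMem_tsupport fun h' => hx ⟨(x, y), h', rfl⟩

lemma IsTest.slice {d : ℝ} {φ : ℝ × ℝ → ℝ} (h : IsTest d φ) (x : ℝ) :
    IsTestInterval d fun y => φ (x, y) := by
  have sub : tsupport (fun y => φ (x, y)) ⊆ (fun y => (x, y)) ⁻¹' tsupport φ :=
    closure_minimal (fun y hy => subset_tsupport φ hy)
      ((isClosed_tsupport φ).preimage (by fun_prop))
  refine ⟨h.smooth.comp (contDiff_const.prodMk contDiff_id), ?_, fun y hy =>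
    (h.subset (sub hy)).2⟩
  refine HasCompactSupport.intro (h.compact.image continuous_snd) fun y hy => ?_
  exact image_eq_zero_of_notMem_tsupport fun h' => hy ⟨(x, y), h', rfl⟩

/-- The product `F(x) χ(y)`, cut off to `x ∈ s`. -/
def cutProd (s : Set ℝ) (F χ : ℝ → ℂ) (z : ℝ × ℝ) : ℂ := s.indicator F z.1 * χ z.2

lemma integrable_test_cutProd {d : ℝ} {φ : ℝ × ℝ → ℝ} (h : IsTest d φ) {s : Set ℝ}
    (hs : MeasurableSet s) {F χ : ℝ → ℂ} (hF : Continuous F) (hχ : Continuous χ) :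
    Integrable fun z => (φ z : ℂ) * cutProd s F χ z := by
  have cφ := h.smooth.continuous
  have hc : HasCompactSupport fun z => (φ z : ℂ) :=
    h.compact.comp_left (g := fun x : ℝ => (x : ℂ)) (by simp)
  have i : Integrable fun z : ℝ × ℝ => (φ z : ℂ) * (F z.1 * χ z.2) :=
    (by fun_prop : Continuous fun z : ℝ × ℝ =>
      (φ z : ℂ) * (F z.1 * χ z.2)).integrable_of_hasCompactSupport hc.mul_right
  refine (i.indicator (hs.preimage measurable_fst)).congr (ae_of_all _ fun z => ?_)
  by_cases hz : z.1 ∈ s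
  · simp [cutProd, hz]
  · simp [cutProd, hz]

lemma integral_strip_test {d : ℝ} {φ : ℝ × ℝ → ℝ} (h : IsTest d φ) (f : ℝ × ℝ → ℂ) :
    ∫ z in strip d, φ z • f z = ∫ z, (φ z : ℂ) * f z := by
  rw [setIntegral_eq_integral_of_forall_compl_eq_zero fun z hz => by rw [h.eq_zero hz, zero_smul]]
  simp_rw [Complex.real_smul]

lemma integral_test_cutProd {d : ℝ} {φ : ℝ × ℝ → ℝ} (h : IsTest d φ) {s : Set ℝ}
    (hs : MeasurableSet s) {F χ : ℝ → ℂ} (hF : Continuous F) (hχ : Continuous χ) :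
    ∫ z, (φ z : ℂ) * cutProd s F χ z = ∫ y, (∫ x in s, (φ (x, y) : ℂ) * F x) * χ y := by
  rw [Measure.volume_eq_prod, integral_prod_symm _ (integrable_test_cutProd h hs hF hχ)]
  congr 1 with y
  rw [← integral_mul_const, ← integral_indicator hs]
  congr 1 with x
  by_cases hx : x ∈ s
  · simp [cutProd, hx, mul_assoc]
  · simp [cutProd, hx]

lemma integral_test_cutProd' {d : ℝ} {φ : ℝ × ℝ → ℝ} (h : IsTest d φ) {s : Set ℝ}
    (hs : MeasurableSet s) {F χ : ℝ → ℂ} (hF : Continuous F) (hχ : Continuous χ) :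
    ∫ z, (φ z : ℂ) * cutProd s F χ z =
      ∫ x, s.indicator F x * coeff χ (fun y => φ (x, y)) := by
  rw [Measure.volume_eq_prod, integral_prod _ (integrable_test_cutProd h hs hF hχ)]
  congr 1 with x
  rw [coeff, ← integral_const_mul]
  congr 1 with y
  simp only [cutProd]
  ring

/-- Integration by parts on each horizontal line. The boundary values on x = 0, integrated over y,
form the transversal coefficient of the slice φ(0, ·), the quantity in which matching is expressed.
-/
lemma integral_dx_cutProd {d : ℝ} {φ : ℝ × ℝ → ℝ} (h : IsTest d φ) {s : Set ℝ} {ε : ℂ}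
    (hs : IsSide s ε) {F F' χ : ℝ → ℂ} (hF : ∀ x, HasDerivAt F (F' x) x) (hF' : Continuous F')
    (hχ : Continuous χ) :
    ∫ z, (dx φ z : ℂ) * cutProd s F χ z =
      ε * (F 0 * coeff χ (fun y => φ (0, y))) - ∫ z, (φ z : ℂ) * cutProd s F' χ z := by
  have cF : Continuous F := continuous_iff_continuousAt.2 fun y => (hF y).continuousAt
  have int := integrable_test_cutProd h hs.measurableSet hF' hχ
  rw [Measure.volume_eq_prod] at int
  have cφ := h.smooth.continuous
  have hc : HasCompactSupport fun y => (φ (0, y) : ℂ) :=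
    (h.slice 0).compact.comp_left (g := fun x : ℝ => (x : ℂ)) (by simp)
  have i1 : Integrable fun y => ε * F 0 * ((φ (0, y) : ℂ) * χ y) :=
    ((by fun_prop : Continuous fun y => (φ (0, y) : ℂ) * χ y).integrable_of_hasCompactSupport
      hc.mul_right).const_mul _
  have i2 : Integrable fun y => (∫ x in s, (φ (x, y) : ℂ) * F' x) * χ y := by
    refine int.integral_prod_right.congr (ae_of_all _ fun y => ?_)
    simp only
    rw [← integral_mul_const, ← integral_indicator hs.measurableSet]
    congr 1 with x
    by_cases hx : x ∈ s
    · simp [cutProd, hx, mul_assoc]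
    · simp [cutProd, hx]
  rw [integral_test_cutProd h.dx hs.measurableSet cF hχ,
    integral_test_cutProd h hs.measurableSet hF' hχ, coeff, ← mul_assoc, ← integral_const_mul,
    ← integral_sub i1 i2]
  congr 1 with y
  have := hs.integral_by_parts (g := fun x => φ (x, y))
    (h.smooth.comp (contDiff_id.prodMk contDiff_const)) (h.compact_slice_x y) hF hF'
  rw [deriv_slice_x h.smooth] at this
  rw [this]
  ring

lemma integral_dy_cutProd {d : ℝ} {φ : ℝ × ℝ → ℝ} (h : IsTest d φ) {s : Set ℝ}
    (hs : MeasurableSet s) {F χ χ' : ℝ → ℂ} (hF : Continuous F)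
    (hχ : ∀ y, HasDerivAt χ (χ' y) y) (hχ' : Continuous χ') :
    ∫ z, (dy φ z : ℂ) * cutProd s F χ z = -∫ z, (φ z : ℂ) * cutProd s F χ' z := by
  have cχ : Continuous χ := continuous_iff_continuousAt.2 fun y => (hχ y).continuousAt
  rw [integral_test_cutProd' h.dy hs hF cχ, integral_test_cutProd' h hs hF hχ', ← integral_neg]
  congr 1 with x
  rw [coeff, coeff, ← mul_neg]
  congr 1
  have := integral_deriv_mul_of_compact (g := fun y => φ (x, y)) (h.slice x).smooth
    (h.slice x).compact hχ hχ'
  rwa [deriv_slice_y h.smooth] at this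

/-- Green's formula for a product function in a half-strip. -/
lemma integral_laplacian_cutProd {d : ℝ} {φ : ℝ × ℝ → ℝ} (h : IsTest d φ) {s : Set ℝ} {ε : ℂ}
    (hs : IsSide s ε) {F F' F'' χ χ' χ'' : ℝ → ℂ} (hF : ∀ x, HasDerivAt F (F' x) x)
    (hF' : ∀ x, HasDerivAt F' (F'' x) x) (hF'' : Continuous F'')
    (hχ : ∀ y, HasDerivAt χ (χ' y) y) (hχ' : ∀ y, HasDerivAt χ' (χ'' y) y)
    (hχ'' : Continuous χ'') :
    ∫ z, ((dx (dx φ) z + dy (dy φ) z : ℝ) : ℂ) * cutProd s F χ z =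
      ε * (F 0 * coeff χ (fun y => dx φ (0, y)) - F' 0 * coeff χ (fun y => φ (0, y))) +
        ((∫ z, (φ z : ℂ) * cutProd s F'' χ z) + ∫ z, (φ z : ℂ) * cutProd s F χ'' z) := by
  have cF : Continuous F := continuous_iff_continuousAt.2 fun y => (hF y).continuousAt
  have cF' : Continuous F' := continuous_iff_continuousAt.2 fun y => (hF' y).continuousAt
  have cχ : Continuous χ := continuous_iff_continuousAt.2 fun y => (hχ y).continuousAt
  have cχ' : Continuous χ' := continuous_iff_continuousAt.2 fun y => (hχ' y).continuousAt
  simp_rw [Complex.ofReal_add, add_mul]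
  rw [integral_add (integrable_test_cutProd h.dx.dx hs.measurableSet cF cχ)
    (integrable_test_cutProd h.dy.dy hs.measurableSet cF cχ),
    integral_dx_cutProd h.dx hs hF cF' cχ, integral_dx_cutProd h hs hF' hF'' cχ,
    integral_dy_cutProd h.dy hs.measurableSet cF hχ cχ',
    integral_dy_cutProd h hs.measurableSet cF hχ' hχ'']
  ring

end Waveguide

namespace Waveguide

/-! ### Product functions in `L²(Ω)` -/

lemma volume_restrict_strip (d : ℝ) : (volume : Measure (ℝ × ℝ)).restrict (strip d) =
    (volume : Measure ℝ).prod (volume.restrict (Ioo 0 d)) := by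
  rw [strip, Measure.volume_eq_prod, ← Measure.prod_restrict, Measure.restrict_univ]

lemma aestronglyMeasurable_cutProd {d : ℝ} {s : Set ℝ} {F χ : ℝ → ℂ}
    (hF : AEStronglyMeasurable (s.indicator F)) (hχ : Continuous χ) :
    AEStronglyMeasurable (cutProd s F χ) (volume.restrict (strip d)) := by
  rw [volume_restrict_strip]
  exact hF.comp_fst.mul (hχ.comp continuous_snd).aestronglyMeasurable

lemma eLpNorm_cutProd {d : ℝ} {s : Set ℝ} {F χ : ℝ → ℂ}
    (hF : AEStronglyMeasurable (s.indicator F)) (hχ : Continuous χ) :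
    eLpNorm (cutProd s F χ) 2 (volume.restrict (strip d)) =
      eLpNorm (s.indicator F) 2 * eLpNorm χ 2 (volume.restrict (Ioo 0 d)) := by
  rw [eLpNorm_eq_lintegral_rpow_enorm_toReal (by norm_num) (by norm_num),
    eLpNorm_eq_lintegral_rpow_enorm_toReal (by norm_num) (by norm_num),
    eLpNorm_eq_lintegral_rpow_enorm_toReal (by norm_num) (by norm_num),
    ← ENNReal.mul_rpow_of_nonneg _ _ (by positivity), volume_restrict_strip,
    ← lintegral_prod_mul (hF.enorm.pow_const _) (hχ.aestronglyMeasurable.enorm.pow_const _)]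
  congr 2 with z
  rw [cutProd, enorm_mul, ENNReal.mul_rpow_of_nonneg _ _ (by norm_num)]

lemma memLp_cutProd {d : ℝ} {s : Set ℝ} {F χ : ℝ → ℂ} (hF : MemLp (s.indicator F) 2)
    (hχ : Continuous χ) : MemLp (cutProd s F χ) 2 (volume.restrict (strip d)) := by
  refine ⟨aestronglyMeasurable_cutProd hF.1 hχ, ?_⟩
  rw [eLpNorm_cutProd hF.1 hχ]
  exact ENNReal.mul_lt_top hF.2 (memLp_of_continuous hχ).2

lemma inner_cutProd {d : ℝ} {s : Set ℝ} {F G χ ξ : ℝ → ℂ} (hF : MemLp (s.indicator F) 2)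
    (hG : MemLp (s.indicator G) 2) (hχ : Continuous χ) (hξ : Continuous ξ)
    (real : ∀ y, star (χ y) = χ y) (orth : ∫ y in Ioo 0 d, χ y * ξ y = 0) :
    inner ℂ ((memLp_cutProd hF hχ).toLp : L2Strip d) (memLp_cutProd hG hξ).toLp = 0 := by
  rw [L2.inner_def]
  have : ∫ z in strip d, (s.indicator G z.1 * star (s.indicator F z.1)) * (χ z.2 * ξ z.2) = 0 := by
    rw [volume_restrict_strip, integral_prod_mul (f := fun x => s.indicator G x *
      star (s.indicator F x)) (g := fun y => χ y * ξ y), orth, mul_zero]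
  rw [← this]
  refine integral_congr_ae ?_
  filter_upwards [(memLp_cutProd (d := d) hF hχ).coeFn_toLp,
    (memLp_cutProd (d := d) hG hξ).coeFn_toLp] with z h1 h2
  rw [h1, h2, RCLike.inner_apply, cutProd, cutProd, ← Complex.star_def, star_mul', real]
  ring

lemma Transverse.eLpNorm_left {d : ℝ} {χ η : ℕ → ℝ → ℂ} (h : Transverse d χ η) (m : ℕ) :
    eLpNorm (χ m) 2 (volume.restrict (Ioo 0 d)) = 1 := by
  have hm := memLp_of_continuous (d := d) (h.continuous_left m)
  have e : inner ℂ (hm.toLp : L2Interval d) hm.toLp = 1 := by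
    rw [inner_toLp_interval]
    simp_rw [h.real_left]
    rw [h.orth_left, if_pos rfl]
  rw [inner_self_ofReal] at e
  have e' : ‖(hm.toLp : L2Interval d)‖ ^ 2 = 1 := by exact_mod_cast e
  have e2 : ‖(hm.toLp : L2Interval d)‖ = 1 :=
    (sq_eq_sq₀ (norm_nonneg _) zero_le_one).1 (by rw [e', one_pow])
  rw [Lp.norm_toLp] at e2
  rw [← ENNReal.ofReal_toReal hm.2.ne, e2, ENNReal.ofReal_one]

lemma norm_cutProd_le {d : ℝ} {s : Set ℝ} {F χ : ℝ → ℂ} (hF : MemLp (s.indicator F) 2)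
    (hχ : Continuous χ) (h1 : eLpNorm χ 2 (volume.restrict (Ioo 0 d)) = 1) {A : ℝ} (hA : 0 ≤ A)
    (hle : eLpNorm (s.indicator F) 2 ≤ ENNReal.ofReal A) :
    ‖((memLp_cutProd hF hχ).toLp : L2Strip d)‖ ≤ A := by
  rw [Lp.norm_toLp, eLpNorm_cutProd hF.1 hχ, h1, mul_one]
  exact ENNReal.toReal_le_of_le_ofReal hA hle

/-- Needed for the gradients: their channel norms are known only to be square summable. -/
lemma summable_of_orthogonal {H : Type*} [NormedAddCommGroup H] [InnerProductSpace ℂ H]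
    [CompleteSpace H] {v : ℕ → H} (orth : ∀ i j, i ≠ j → inner ℂ (v i) (v j) = 0)
    (hs : Summable fun i => ‖v i‖ ^ 2) : Summable v := by
  have hO : OrthogonalFamily ℂ (fun i => Submodule.span ℂ {v i})
      fun i => (Submodule.span ℂ {v i}).subtypeₗᵢ := by
    refine OrthogonalFamily.of_pairwise fun i j hij => ?_
    refine Submodule.isOrtho_span.2 ?_
    rintro _ rfl _ rfl
    exact orth i j hij
  exact (hO.summable_iff_norm_sq_summable
    fun i => ⟨v i, Submodule.mem_span_singleton_self _⟩).2 hs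

/-- Links L² sums with pointwise sums: norm convergence gives a subsequence of partial sums
converging almost everywhere, and its limit must be the pointwise sum. -/
lemma ae_eq_of_hasSum {d : ℝ} {u : ℕ → L2Strip d} {U : L2Strip d} (hU : HasSum u U)
    {f : ℕ → ℝ × ℝ → ℂ} (hf : ∀ m, u m =ᵐ[volume.restrict (strip d)] f m) {g : ℝ × ℝ → ℂ}
    (hg : ∀ z, HasSum (fun m => f m z) (g z)) : U =ᵐ[volume.restrict (strip d)] g := by
  have h1 := tendstoInMeasure_of_tendsto_Lp hU.tendsto_sum_nat
  obtain ⟨ns, hns, h2⟩ := h1.exists_seq_tendsto_ae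
  have h3 : ∀ᵐ z ∂volume.restrict (strip d), ∀ n,
      (∑ i ∈ Finset.range n, u i : L2Strip d) z = ∑ i ∈ Finset.range n, f i z := by
    rw [ae_all_iff]
    intro n
    have h4 : ∀ᵐ z ∂volume.restrict (strip d), ∀ m, u m z = f m z := ae_all_iff.2 hf
    filter_upwards [h4, Lp.coeFn_finsetSum (Finset.range n) u] with z hz1 hz2
    rw [hz2, Finset.sum_apply]
    exact Finset.sum_congr rfl fun i _ => hz1 i
  filter_upwards [h2, h3] with z hz1 hz2
  simp_rw [hz2] at hz1
  exact tendsto_nhds_unique hz1 ((hg z).tendsto_sum_nat.comp hns.tendsto_atTop)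

lemma hasSum_pairing {d : ℝ} {φ : ℝ × ℝ → ℝ} (h : Continuous φ) (hc : HasCompactSupport φ)
    {u : ℕ → L2Strip d} {U : L2Strip d} (hU : HasSum u U) :
    HasSum (fun m => ∫ z in strip d, φ z • u m z) (∫ z in strip d, φ z • U z) := by
  have hm : MemLp (fun z => (φ z : ℂ)) 2 (volume.restrict (strip d)) :=
    (Complex.continuous_ofReal.comp h).memLp_of_hasCompactSupport
      (hc.comp_left (g := fun x : ℝ => (x : ℂ)) (by simp))
  have e : ∀ w : L2Strip d, innerSL ℂ (hm.toLp : L2Strip d) w = ∫ z in strip d, φ z • w z := by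
    intro w
    rw [innerSL_apply_apply, L2.inner_def]
    refine integral_congr_ae ?_
    filter_upwards [hm.coeFn_toLp] with z hz
    rw [hz, RCLike.inner_apply, Complex.conj_ofReal, Complex.real_smul, mul_comm]
  have := hU.mapL (innerSL ℂ (hm.toLp : L2Strip d))
  simp_rw [e] at this
  exact this

/-! ### Traces of series of product functions -/

lemma hasSum_cutProd_val {s : Set ℝ} {F ξ : ℕ → ℝ → ℂ}
    (decay : ∀ K, IsCompact K → K ⊆ s → ∃ M : ℕ → ℝ,
      Summable (fun m : ℕ => ((m : ℝ) + 1) ^ 2 * M m) ∧ ∀ m, ∀ x ∈ K, ‖F m x‖ ≤ M m)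
    {C : ℝ} (hC : ∀ (m : ℕ) y, ‖ξ m y‖ ≤ C * ((m : ℝ) + 1) ^ 2) (z : ℝ × ℝ) :
    Summable fun m => cutProd s (F m) (ξ m) z := by
  by_cases hz : z.1 ∈ s
  · obtain ⟨M, hM, hb⟩ := decay {z.1} isCompact_singleton (singleton_subset_iff.2 hz)
    refine Summable.of_norm_bounded (hM.mul_left C) fun m => ?_
    rw [cutProd, indicator_of_mem hz, norm_mul, mul_comm, ← mul_assoc]
    exact mul_le_mul (hC m _) (hb m _ rfl) (norm_nonneg _) ((norm_nonneg _).trans (hC m z.2))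
  · simp [cutProd, hz]

/-- The pointwise sum of the series serves as the representative in the trace condition. On a
compact K ⊆ Γ ⊆ s the decay of the profiles outweighs the factor (m+1)² and gives ‖v(x, y)‖ ≤ C S |y
- y₀|. If Γ misses s, the representative vanishes above Γ. -/
lemma hasZeroTrace_series {d : ℝ} {s : Set ℝ} {F ξ : ℕ → ℝ → ℂ} (hs : MeasurableSet s)
    (hF : ∀ m, Continuous (F m)) (hξ : ∀ m, Continuous (ξ m))
    (decay : ∀ K, IsCompact K → K ⊆ s → ∃ M : ℕ → ℝ,
      Summable (fun m : ℕ => ((m : ℝ) + 1) ^ 2 * M m) ∧ ∀ m, ∀ x ∈ K, ‖F m x‖ ≤ M m)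
    {C y₀ : ℝ} (hC : ∀ (m : ℕ) y, ‖ξ m y‖ ≤ C * ((m : ℝ) + 1) ^ 2) {Γ : Set ℝ}
    (hΓ : (Γ ⊆ s ∧ ∀ (m : ℕ) y, ‖ξ m y‖ ≤ C * ((m : ℝ) + 1) ^ 2 * |y - y₀|) ∨ Disjoint Γ s)
    {l : Filter ℝ} (hl : l ≤ 𝓝 y₀)
    {u : ℕ → L2Strip d} {U : L2Strip d} (hU : HasSum u U)
    (hu : ∀ m, u m =ᵐ[volume.restrict (strip d)] cutProd s (F m) (ξ m)) :
    HasZeroTrace U Γ l := by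
  have sum := hasSum_cutProd_val decay hC
  set v : ℝ × ℝ → ℂ := fun z => ∑' m, cutProd s (F m) (ξ m) z
  have hv : ∀ z, HasSum (fun m => cutProd s (F m) (ξ m) z) (v z) := fun z => (sum z).hasSum
  have meas : Measurable v := by
    refine measurable_of_tendsto_metrizable
      (f := fun n z => ∑ m ∈ Finset.range n, cutProd s (F m) (ξ m) z) (fun n => ?_)
      (tendsto_pi_nhds.2 fun z => (hv z).tendsto_sum_nat)
    refine Finset.measurable_fun_sum _ fun m _ => ?_
    exact (((hF m).measurable.indicator hs).comp measurable_fst).mul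
      ((hξ m).measurable.comp measurable_snd)
  refine ⟨v, meas, ae_eq_of_hasSum hU hu hv, fun K hK hKΓ => ?_⟩
  rcases hΓ with ⟨hΓs, hlip⟩ | hdisj
  · obtain ⟨M, hM, hb⟩ := decay K hK (hKΓ.trans hΓs)
    set S := ∑' m : ℕ, ((m : ℝ) + 1) ^ 2 * M m
    have bound : ∀ x ∈ K, ∀ y, ‖v (x, y)‖ ≤ C * S * |y - y₀| := by
      intro x hx y
      have h1 : HasSum (fun m : ℕ => C * (((m : ℝ) + 1) ^ 2 * M m) * |y - y₀|)
          (C * S * |y - y₀|) := (hM.hasSum.mul_left C).mul_right _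
      refine tsum_of_norm_bounded h1 fun m => ?_
      rw [cutProd, indicator_of_mem (hΓs (hKΓ hx)), norm_mul]
      calc ‖F m x‖ * ‖ξ m y‖ ≤ M m * (C * ((m : ℝ) + 1) ^ 2 * |y - y₀|) :=
            mul_le_mul (hb m x hx) (hlip m y) (norm_nonneg _) ((norm_nonneg _).trans (hb m x hx))
        _ = _ := by ring
    have up : ∀ y, ∫⁻ x in K, ‖v (x, y)‖ₑ ^ 2 ≤
        ENNReal.ofReal (C * S * |y - y₀|) ^ 2 * volume K := by
      intro y
      rw [← setLIntegral_const]
      refine setLIntegral_mono measurable_const fun x hx => ?_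
      gcongr
      rw [← ofReal_norm]
      exact ENNReal.ofReal_le_ofReal (bound x hx y)
    have lim : Tendsto (fun y => ENNReal.ofReal (C * S * |y - y₀|) ^ 2 * volume K) l (𝓝 0) := by
      have h1 : Tendsto (fun y => ENNReal.ofReal (C * S * |y - y₀|)) (𝓝 y₀) (𝓝 0) := by
        have : Continuous fun y => ENNReal.ofReal (C * S * |y - y₀|) :=
          ENNReal.continuous_ofReal.comp (by fun_prop)
        simpa using this.tendsto y₀
      have h2 := ENNReal.Tendsto.mul_const (ENNReal.Tendsto.pow (n := 2) (h1.mono_left hl))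
        (Or.inr hK.measure_lt_top.ne : (0 : ℝ≥0∞) ^ 2 ≠ 0 ∨ volume K ≠ ⊤)
      simpa using h2
    exact tendsto_of_tendsto_of_tendsto_of_le_of_le tendsto_const_nhds lim
      (fun _ => bot_le) up
  · have zero : ∀ y, ∫⁻ x in K, ‖v (x, y)‖ₑ ^ 2 = 0 := by
      intro y
      rw [setLIntegral_congr_fun (g := fun _ => 0) hK.measurableSet]
      · simp
      intro x hx
      have hxs : x ∉ s := fun h => hdisj.le_bot ⟨hKΓ hx, h⟩
      have : v (x, y) = 0 := by simp [v, cutProd, hxs]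
      simp [this]
    simp_rw [zero]
    exact tendsto_const_nhds

end Waveguide

namespace Waveguide

/-! ### Superpositions of transversal modes -/

lemma lam_le {d : ℝ} (hd : 0 < d) (m : ℕ) : lam d m ≤ Real.pi / d * ((m : ℝ) + 1) := by
  have := Real.pi_pos
  rw [lam, div_mul_eq_mul_div, div_le_div_iff₀ (by positivity) (by positivity)]
  have : 0 ≤ Real.pi * d := by positivity
  nlinarith [Nat.cast_nonneg (α := ℝ) m]

variable {X : Type*} [TopologicalSpace X] [CompactSpace X] [MeasurableSpace X] [BorelSpace X]

/-- Coefficients `c m` and exponents `τ m` of the waves `c m e^{τ m x}` in the transversal channels,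
on the side `s`, for the energies `E`. -/
structure ModeFamily (μ : Measure X) (d : ℝ) (s : Set ℝ) (E : C(X, ℂ)) where
  τ : ℕ → C(X, ℂ)
  c : ℕ → C(X, ℂ)
  A : ℕ → ℝ
  A_nonneg : ∀ m, 0 ≤ A m
  sq : ∀ m k, τ m k ^ 2 = (lam d m : ℂ) ^ 2 - E k
  memLp : ∀ m b, MemLp (s.indicator (wave μ (τ m) (b * c m))) 2
  le : ∀ m b, eLpNorm (s.indicator (wave μ (τ m) (b * c m))) 2 ≤ ENNReal.ofReal (A m * ‖b‖)
  memLp_deriv : ∀ m b, MemLp (s.indicator (wave μ (τ m) (τ m * (b * c m)))) 2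
  le_deriv : ∀ m b, eLpNorm (s.indicator (wave μ (τ m) (τ m * (b * c m)))) 2 ≤
    ENNReal.ofReal (((m : ℝ) + 1) * A m * ‖b‖)
  summ : Summable fun m : ℕ => (((m : ℝ) + 1) * A m) ^ 2
  decay : ∀ K, IsCompact K → K ⊆ s → ∃ M : ℕ → ℝ,
    Summable (fun m : ℕ => ((m : ℝ) + 1) ^ 2 * M m) ∧
      ∀ m, ∀ x ∈ K, ∀ k, ‖c m k * Complex.exp (τ m k * (x : ℝ))‖ ≤ M m

namespace ModeFamily
variable {μ : Measure X} [IsFiniteMeasure μ] {d : ℝ} {s : Set ℝ} {E : C(X, ℂ)}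

/-- The profile of the wave packet with amplitude `b` in the `m`-th channel. -/
def prof (Φ : ModeFamily μ d s E) (b : C(X, ℂ)) (m : ℕ) : ℝ → ℂ := wave μ (Φ.τ m) (b * Φ.c m)

/-- The derivative of the profile. -/
def prof' (Φ : ModeFamily μ d s E) (b : C(X, ℂ)) (m : ℕ) : ℝ → ℂ :=
  wave μ (Φ.τ m) (Φ.τ m * (b * Φ.c m))

lemma hasDerivAt_prof (Φ : ModeFamily μ d s E) (b : C(X, ℂ)) (m : ℕ) (x : ℝ) :
    HasDerivAt (Φ.prof b m) (Φ.prof' b m x) x := hasDerivAt_wave _ _ _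

lemma continuous_prof (Φ : ModeFamily μ d s E) (b : C(X, ℂ)) (m : ℕ) :
    Continuous (Φ.prof b m) := continuous_wave _ _

lemma continuous_prof' (Φ : ModeFamily μ d s E) (b : C(X, ℂ)) (m : ℕ) :
    Continuous (Φ.prof' b m) := continuous_wave _ _

/-- The dispersion relation τ² = λ² - E turned into a differential equation: the energy can be moved
onto the amplitude, since it depends on k and not on x. -/
lemma hasDerivAt_prof' (Φ : ModeFamily μ d s E) (b : C(X, ℂ)) (m : ℕ) (x : ℝ) :
    HasDerivAt (Φ.prof' b m) ((lam d m : ℂ) ^ 2 * Φ.prof b m x - Φ.prof (E * b) m x) x := by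
  have h := hasDerivAt_wave (μ := μ) (Φ.τ m) (Φ.τ m * (b * Φ.c m)) x
  convert! h using 1
  have e : Φ.τ m * (Φ.τ m * (b * Φ.c m)) =
      ((lam d m : ℂ) ^ 2) • (b * Φ.c m) + (-1 : ℂ) • (E * b * Φ.c m) := by
    ext k
    simp only [ContinuousMap.mul_apply, ContinuousMap.add_apply, ContinuousMap.smul_apply,
      smul_eq_mul]
    linear_combination (b k * Φ.c m k) * Φ.sq m k
  rw [e, wave_add, wave_smul, wave_smul]
  simp only [prof, Pi.add_apply, Pi.smul_apply, smul_eq_mul]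
  ring

variable {χ η : ℕ → ℝ → ℂ}

/-- The wave packet in the `m`-th channel. -/
def term (Φ : ModeFamily μ d s E) (hT : Transverse d χ η) (b : C(X, ℂ)) (m : ℕ) : L2Strip d :=
  (memLp_cutProd (Φ.memLp m b) (hT.continuous_left m)).toLp

/-- The `x`-derivative of the wave packet in the `m`-th channel. -/
def termX (Φ : ModeFamily μ d s E) (hT : Transverse d χ η) (b : C(X, ℂ)) (m : ℕ) : L2Strip d :=
  (memLp_cutProd (Φ.memLp_deriv m b) (hT.continuous_left m)).toLp

/-- The `y`-derivative of the wave packet in the `m`-th channel. -/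
def termY (Φ : ModeFamily μ d s E) (hT : Transverse d χ η) (b : C(X, ℂ)) (m : ℕ) : L2Strip d :=
  (lam d m : ℂ) • (memLp_cutProd (Φ.memLp m b) (hT.continuous_right m)).toLp

lemma term_ae (Φ : ModeFamily μ d s E) (hT : Transverse d χ η) (b : C(X, ℂ)) (m : ℕ) :
    Φ.term hT b m =ᵐ[volume.restrict (strip d)] cutProd s (Φ.prof b m) (χ m) :=
  MemLp.coeFn_toLp _

lemma termX_ae (Φ : ModeFamily μ d s E) (hT : Transverse d χ η) (b : C(X, ℂ)) (m : ℕ) :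
    Φ.termX hT b m =ᵐ[volume.restrict (strip d)] cutProd s (Φ.prof' b m) (χ m) :=
  MemLp.coeFn_toLp _

lemma termY_ae (Φ : ModeFamily μ d s E) (hT : Transverse d χ η) (b : C(X, ℂ)) (m : ℕ) :
    Φ.termY hT b m =ᵐ[volume.restrict (strip d)]
      cutProd s (Φ.prof b m) (fun y => lam d m * η m y) := by
  filter_upwards [Lp.coeFn_smul (lam d m : ℂ) (((memLp_cutProd (d := d) (Φ.memLp m b)
    (hT.continuous_right m)).toLp) : L2Strip d),
    (memLp_cutProd (d := d) (Φ.memLp m b) (hT.continuous_right m)).coeFn_toLp] with z h1 h2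
  rw [termY, h1, Pi.smul_apply, h2, smul_eq_mul, cutProd, cutProd, prof]
  ring

lemma norm_term_le (Φ : ModeFamily μ d s E) (hT : Transverse d χ η) (b : C(X, ℂ)) (m : ℕ) :
    ‖Φ.term hT b m‖ ≤ Φ.A m * ‖b‖ :=
  norm_cutProd_le (Φ.memLp m b) (hT.continuous_left m) (hT.eLpNorm_left m)
    (mul_nonneg (Φ.A_nonneg m) (norm_nonneg _)) (Φ.le m b)

lemma norm_termX_le (Φ : ModeFamily μ d s E) (hT : Transverse d χ η) (b : C(X, ℂ)) (m : ℕ) :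
    ‖Φ.termX hT b m‖ ≤ ((m : ℝ) + 1) * Φ.A m * ‖b‖ :=
  norm_cutProd_le (Φ.memLp_deriv m b) (hT.continuous_left m) (hT.eLpNorm_left m)
    (mul_nonneg (mul_nonneg (by positivity) (Φ.A_nonneg m)) (norm_nonneg _)) (Φ.le_deriv m b)

lemma norm_termY_le (Φ : ModeFamily μ d s E) (hd : 0 < d) (hT : Transverse d χ η) (b : C(X, ℂ))
    (m : ℕ) : ‖Φ.termY hT b m‖ ≤ Real.pi / d * (((m : ℝ) + 1) * Φ.A m * ‖b‖) := by
  rw [termY, norm_smul, Complex.norm_real, Real.norm_of_nonneg (lam_pos hd m).le]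
  have h1 := norm_cutProd_le (Φ.memLp m b) (hT.continuous_right m) (hT.symm.eLpNorm_left m)
    (mul_nonneg (Φ.A_nonneg m) (norm_nonneg b)) (Φ.le m b)
  have h2 := lam_le hd m
  calc _ ≤ (Real.pi / d * ((m : ℝ) + 1)) * (Φ.A m * ‖b‖) :=
        mul_le_mul h2 h1 (norm_nonneg _) ((lam_pos hd m).le.trans h2)
    _ = _ := by ring

/-- From 2A_m ≤ ((m+1)A_m)² + (m+1)^{-2}. Thus the packet itself converges absolutely in operator
norm, without orthogonality. -/
lemma summable_A (Φ : ModeFamily μ d s E) : Summable Φ.A := by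
  have s2 : Summable fun m : ℕ => 1 / ((m : ℝ) + 1) ^ 2 := by
    have := (summable_nat_add_iff 1).2 (Real.summable_one_div_nat_pow.2 (by norm_num : 1 < 2))
    simpa using this
  refine Summable.of_nonneg_of_le Φ.A_nonneg (fun m => ?_) (Φ.summ.add s2)
  have h := two_mul_le_add_sq (((m : ℝ) + 1) * Φ.A m) (1 / ((m : ℝ) + 1))
  have e : 2 * (((m : ℝ) + 1) * Φ.A m) * (1 / ((m : ℝ) + 1)) = 2 * Φ.A m := by field_simp
  rw [e, div_pow, one_pow] at h
  linarith [Φ.A_nonneg m]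

/-- The wave packet in the `m`-th channel as a bounded linear function of the amplitude. -/
def termCLM (Φ : ModeFamily μ d s E) (hT : Transverse d χ η) (m : ℕ) : C(X, ℂ) →L[ℂ] L2Strip d :=
  LinearMap.mkContinuous
    { toFun := fun b => Φ.term hT b m
      map_add' := fun b b' => by
        rw [term, term, term, ← MemLp.toLp_add]
        refine MemLp.toLp_congr _ _ (ae_of_all _ fun z => ?_)
        simp only [cutProd, add_mul, wave_add, indicator_add', Pi.add_apply]
      map_smul' := fun a b => by
        rw [term, term, RingHom.id_apply, ← MemLp.toLp_const_smul]
        refine MemLp.toLp_congr _ _ (ae_of_all _ fun z => ?_)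
        simp only [cutProd, smul_mul_assoc, wave_smul, Pi.smul_apply, smul_eq_mul]
        by_cases hz : z.1 ∈ s
        · simp [hz, mul_assoc]
        · simp [hz] } (Φ.A m) (fun b => Φ.norm_term_le hT b m)

lemma summable_termCLM (Φ : ModeFamily μ d s E) (hT : Transverse d χ η) :
    Summable (Φ.termCLM hT) :=
  Summable.of_norm_bounded Φ.summable_A fun m => LinearMap.mkContinuous_norm_le _ (Φ.A_nonneg m) _

/-- The wave packet as a bounded linear function of the amplitude. -/
def packetCLM (Φ : ModeFamily μ d s E) (hT : Transverse d χ η) : C(X, ℂ) →L[ℂ] L2Strip d :=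
  ∑' m, Φ.termCLM hT m

lemma hasSum_term (Φ : ModeFamily μ d s E) (hT : Transverse d χ η) (b : C(X, ℂ)) :
    HasSum (Φ.term hT b) (Φ.packetCLM hT b) :=
  (Φ.summable_termCLM hT).hasSum.mapL (ContinuousLinearMap.apply ℂ (L2Strip d) b)

/-- The bound for one channel carries the weight m + 1, for which only square summability is
available; different channels are orthogonal in L²(Ω). -/
lemma summable_termX (Φ : ModeFamily μ d s E) (hT : Transverse d χ η) (b : C(X, ℂ)) :
    Summable (Φ.termX hT b) := by
  refine summable_of_orthogonal (fun i j hij => ?_) ?_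
  · exact inner_cutProd (Φ.memLp_deriv i b) (Φ.memLp_deriv j b) (hT.continuous_left i)
      (hT.continuous_left j) (hT.real_left i) (by rw [hT.orth_left, if_neg hij])
  · refine Summable.of_nonneg_of_le (fun m => by positivity) (fun m => ?_)
      (Φ.summ.mul_right (‖b‖ ^ 2))
    rw [← mul_pow]
    exact pow_le_pow_left₀ (norm_nonneg _) (Φ.norm_termX_le hT b m) 2

lemma summable_termY (Φ : ModeFamily μ d s E) (hd : 0 < d) (hT : Transverse d χ η) (b : C(X, ℂ)) :
    Summable (Φ.termY hT b) := by
  refine summable_of_orthogonal (fun i j hij => ?_) ?_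
  · rw [termY, termY, inner_smul_left, inner_smul_right,
      inner_cutProd (Φ.memLp i b) (Φ.memLp j b) (hT.continuous_right i)
        (hT.continuous_right j) (hT.real_right i) (by rw [hT.orth_right, if_neg hij]), mul_zero,
      mul_zero]
  · refine Summable.of_nonneg_of_le (fun m => by positivity) (fun m => ?_)
      ((Φ.summ.mul_right (‖b‖ ^ 2)).mul_left ((Real.pi / d) ^ 2))
    rw [← mul_pow, ← mul_pow]
    exact pow_le_pow_left₀ (norm_nonneg _) (Φ.norm_termY_le hd hT b m) 2

/-- The `x`-derivative of the wave packet. -/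
def packetX (Φ : ModeFamily μ d s E) (hT : Transverse d χ η) (b : C(X, ℂ)) : L2Strip d :=
  ∑' m, Φ.termX hT b m

/-- The `y`-derivative of the wave packet. -/
def packetY (Φ : ModeFamily μ d s E) (hT : Transverse d χ η) (b : C(X, ℂ)) : L2Strip d :=
  ∑' m, Φ.termY hT b m

/-! #### Weak derivatives -/

lemma integral_strip_term {φ : ℝ × ℝ → ℝ} (hφ : IsTest d φ) {u : L2Strip d} {f : ℝ × ℝ → ℂ}
    (hu : u =ᵐ[volume.restrict (strip d)] f) :
    ∫ z in strip d, φ z • u z = ∫ z, (φ z : ℂ) * f z := by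
  rw [← integral_strip_test hφ]
  refine integral_congr_ae ?_
  filter_upwards [hu] with z hz
  rw [hz]

/-- The defect in the weak derivative is exactly the sum of the boundary terms on x = 0. It is kept
as an unevaluated series so that the two sides can be combined before summation. -/
lemma hasSum_weakDx (Φ : ModeFamily μ d s E) (hT : Transverse d χ η) {ε : ℂ} (hs : IsSide s ε)
    (b : C(X, ℂ)) {φ : ℝ × ℝ → ℝ} (hφ : IsTest d φ) :
    HasSum (fun m => ε * (Φ.prof b m 0 * coeff (χ m) (fun y => φ (0, y))))
      ((∫ z in strip d, dx φ z • Φ.packetCLM hT b z) +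
        ∫ z in strip d, φ z • Φ.packetX hT b z) := by
  have h1 := hasSum_pairing hφ.dx.smooth.continuous hφ.dx.compact (Φ.hasSum_term hT b)
  have h2 := hasSum_pairing hφ.smooth.continuous hφ.compact (Φ.summable_termX hT b).hasSum
  refine (h1.add h2).congr_fun fun m => ?_
  rw [integral_strip_term hφ.dx (Φ.term_ae hT b m), integral_strip_term hφ (Φ.termX_ae hT b m),
    integral_dx_cutProd hφ hs (Φ.hasDerivAt_prof b m) (Φ.continuous_prof' b m)
      (hT.continuous_left m)]
  ring

lemma hasWeakDy (Φ : ModeFamily μ d s E) (hd : 0 < d) (hT : Transverse d χ η)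
    (hs : MeasurableSet s) (b : C(X, ℂ)) : HasWeakDy (Φ.packetCLM hT b) (Φ.packetY hT b) := by
  intro φ hφ
  have h1 := hasSum_pairing hφ.dy.smooth.continuous hφ.dy.compact (Φ.hasSum_term hT b)
  have h2 := hasSum_pairing hφ.smooth.continuous hφ.compact (Φ.summable_termY hd hT b).hasSum
  refine h1.unique (h2.neg.congr_fun fun m => ?_)
  have := hT.continuous_right m
  rw [integral_strip_term hφ.dy (Φ.term_ae hT b m), integral_strip_term hφ (Φ.termY_ae hT b m),
    integral_dy_cutProd hφ hs (Φ.continuous_prof b m) (hT.deriv_left m) (by fun_prop)]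

/-- The x-part gives λ² u minus the packet with amplitude E b, and the y-part gives -λ² u. The
unbounded factors cancel within each channel, so the Laplacian is in L² with no bound on second
derivatives. -/
lemma hasSum_weakLaplacian (Φ : ModeFamily μ d s E) (hT : Transverse d χ η) {ε : ℂ}
    (hs : IsSide s ε) (b : C(X, ℂ)) {φ : ℝ × ℝ → ℝ} (hφ : IsTest d φ) :
    HasSum (fun m => ε * (Φ.prof b m 0 * coeff (χ m) (fun y => dx φ (0, y)) -
        Φ.prof' b m 0 * coeff (χ m) (fun y => φ (0, y))))
      ((∫ z in strip d, (dx (dx φ) z + dy (dy φ) z) • Φ.packetCLM hT b z) +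
        ∫ z in strip d, φ z • Φ.packetCLM hT (E * b) z) := by
  have hL := hφ.laplacian
  have h1 := hasSum_pairing hL.smooth.continuous hL.compact (Φ.hasSum_term hT b)
  have h2 := hasSum_pairing hφ.smooth.continuous hφ.compact (Φ.hasSum_term hT (E * b))
  refine (h1.add h2).congr_fun fun m => ?_
  have c1 := hT.continuous_left m
  have c2 := hT.continuous_right m
  have c3 := Φ.continuous_prof b m
  have c4 := Φ.continuous_prof (E * b) m
  have hms := hs.measurableSet
  rw [integral_strip_term hL (Φ.term_ae hT b m), integral_strip_term hφ (Φ.term_ae hT (E * b) m),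
    integral_laplacian_cutProd hφ hs (Φ.hasDerivAt_prof b m) (Φ.hasDerivAt_prof' b m)
      (by fun_prop) (hT.deriv_left m)
      (fun y => ((hT.deriv_right m y).const_mul (lam d m : ℂ))) (by fun_prop)]
  have key : (∫ z, (φ z : ℂ) * cutProd s
        (fun x => (lam d m : ℂ) ^ 2 * Φ.prof b m x - Φ.prof (E * b) m x) (χ m) z) +
      (∫ z, (φ z : ℂ) * cutProd s (Φ.prof b m)
        (fun y => lam d m * -(lam d m * χ m y)) z) +
      ∫ z, (φ z : ℂ) * cutProd s (Φ.prof (E * b) m) (χ m) z = 0 := by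
    have i1 := integrable_test_cutProd hφ hms (F := fun x => (lam d m : ℂ) ^ 2 * Φ.prof b m x -
      Φ.prof (E * b) m x) (by fun_prop) c1
    have i2 := integrable_test_cutProd hφ hms (χ := fun y => lam d m * -(lam d m * χ m y)) c3
      (by fun_prop)
    rw [← integral_add' i1 i2, ← integral_add' (i1.add i2)
      (integrable_test_cutProd hφ hms c4 c1)]
    refine integral_eq_zero_of_ae (ae_of_all _ fun z => ?_)
    by_cases hz : z.1 ∈ s
    · simp only [cutProd, indicator_of_mem hz, Pi.zero_apply, Pi.add_apply]
      ring
    · simp [cutProd, hz]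
  linear_combination -key

/-! #### Traces -/

lemma prof_decay (Φ : ModeFamily μ d s E) (b : C(X, ℂ)) (K : Set ℝ) (hK : IsCompact K)
    (hKs : K ⊆ s) : ∃ M : ℕ → ℝ, Summable (fun m : ℕ => ((m : ℝ) + 1) ^ 2 * M m) ∧
      ∀ m, ∀ x ∈ K, ‖Φ.prof b m x‖ ≤ M m := by
  obtain ⟨M, hM, hb⟩ := Φ.decay K hK hKs
  refine ⟨fun m => ‖b‖ * M m * μ.real univ, ?_, fun m x hx => ?_⟩
  · convert! hM.mul_left (‖b‖ * μ.real univ) using 2 with m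
    ring
  · refine norm_wave_le fun k => ?_
    rw [ContinuousMap.mul_apply, mul_assoc, norm_mul]
    exact mul_le_mul (b.norm_coe_le_norm k) (hb m x hx k) (norm_nonneg _) (norm_nonneg _)

lemma hasZeroTrace_packet (Φ : ModeFamily μ d s E) (hd : 0 < d) (hT : Transverse d χ η)
    (hs : MeasurableSet s) (b : C(X, ℂ)) {Γ : Set ℝ} {y₀ : ℝ}
    (hΓ : (Γ ⊆ s ∧ ∀ m, χ m y₀ = 0) ∨ Disjoint Γ s) {l : Filter ℝ} (hl : l ≤ 𝓝 y₀) :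
    HasZeroTrace (Φ.packetCLM hT b) Γ l := by
  have hp := Real.pi_pos
  have h1 : ∀ m : ℕ, (1 : ℝ) ≤ (m : ℝ) + 1 := fun m => by linarith [Nat.cast_nonneg (α := ℝ) m]
  refine hasZeroTrace_series (C := √(2 / d) * (1 + Real.pi / d)) (y₀ := y₀) hs
    (Φ.continuous_prof b) hT.continuous_left (Φ.prof_decay b) (fun m y => ?_) ?_ hl
    (Φ.hasSum_term hT b) (Φ.term_ae hT b)
  · refine (hT.bound_left m y).trans ?_
    have : (1 : ℝ) ≤ (1 + Real.pi / d) * ((m : ℝ) + 1) ^ 2 :=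
      one_le_mul_of_one_le_of_one_le (le_add_of_nonneg_right (by positivity))
        (one_le_pow₀ (h1 m))
    rw [mul_assoc]
    exact le_mul_of_one_le_right (Real.sqrt_nonneg _) this
  · refine hΓ.imp_left fun ⟨h, hz⟩ => ⟨h, fun m y => ?_⟩
    have := hT.lipschitz hd m y y₀
    rw [hz, sub_zero] at this
    refine this.trans (mul_le_mul_of_nonneg_right ?_ (abs_nonneg _))
    have h2 : lam d m ≤ (1 + Real.pi / d) * ((m : ℝ) + 1) ^ 2 := by
      refine (lam_le hd m).trans ?_
      have : (m : ℝ) + 1 ≤ ((m : ℝ) + 1) ^ 2 := by nlinarith [h1 m]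
      have : 0 ≤ Real.pi / d := by positivity
      gcongr
      linarith
    rw [mul_comm, mul_assoc]
    gcongr

/-- Here both the size of the y-derivative and its Lipschitz constant in y bring a factor λ_m, hence
the weight (m+1)². -/
lemma hasZeroTrace_packetY (Φ : ModeFamily μ d s E) (hd : 0 < d) (hT : Transverse d χ η)
    (hs : MeasurableSet s) (b : C(X, ℂ)) {Γ : Set ℝ} {y₀ : ℝ}
    (hΓ : (Γ ⊆ s ∧ ∀ m, η m y₀ = 0) ∨ Disjoint Γ s) {l : Filter ℝ} (hl : l ≤ 𝓝 y₀) :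
    HasZeroTrace (Φ.packetY hT b) Γ l := by
  have hp := Real.pi_pos
  have h1 : ∀ m : ℕ, (1 : ℝ) ≤ (m : ℝ) + 1 := fun m => by linarith [Nat.cast_nonneg (α := ℝ) m]
  have hpd : 0 ≤ Real.pi / d := by positivity
  have nrm : ∀ m y, ‖(lam d m : ℂ) * η m y‖ = lam d m * ‖η m y‖ := fun m y => by
    rw [norm_mul, Complex.norm_real, Real.norm_of_nonneg (lam_pos hd m).le]
  refine hasZeroTrace_series (C := √(2 / d) * (1 + Real.pi / d) ^ 2) (y₀ := y₀)
    (ξ := fun m y => lam d m * η m y) hs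
    (Φ.continuous_prof b) (fun m => by have := hT.continuous_right m; fun_prop)
    (Φ.prof_decay b) (fun m y => ?_) ?_ hl
    (Φ.summable_termY hd hT b).hasSum (Φ.termY_ae hT b)
  · rw [nrm]
    have h2 : lam d m ≤ (1 + Real.pi / d) ^ 2 * ((m : ℝ) + 1) ^ 2 := by
      refine (lam_le hd m).trans ?_
      rw [← mul_pow]
      have h3 : Real.pi / d * ((m : ℝ) + 1) ≤ (1 + Real.pi / d) * ((m : ℝ) + 1) := by
        gcongr; linarith
      have h4 : 1 ≤ (1 + Real.pi / d) * ((m : ℝ) + 1) :=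
        one_le_mul_of_one_le_of_one_le (le_add_of_nonneg_right hpd) (h1 m)
      nlinarith
    calc _ ≤ (1 + Real.pi / d) ^ 2 * ((m : ℝ) + 1) ^ 2 * √(2 / d) :=
          mul_le_mul h2 (hT.bound_right m y) (norm_nonneg _) (by positivity)
      _ = _ := by ring
  · refine hΓ.imp_left fun ⟨h, hz⟩ => ⟨h, fun m y => ?_⟩
    have := hT.symm.lipschitz hd m y y₀
    rw [hz, sub_zero] at this
    rw [nrm]
    have h2 : lam d m ^ 2 ≤ ((1 + Real.pi / d) * ((m : ℝ) + 1)) ^ 2 := by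
      refine pow_le_pow_left₀ (lam_pos hd m).le ((lam_le hd m).trans ?_) 2
      gcongr; linarith
    calc _ ≤ lam d m * (lam d m * √(2 / d) * |y - y₀|) :=
          mul_le_mul_of_nonneg_left this (lam_pos hd m).le
      _ = lam d m ^ 2 * (√(2 / d) * |y - y₀|) := by ring
      _ ≤ ((1 + Real.pi / d) * ((m : ℝ) + 1)) ^ 2 * (√(2 / d) * |y - y₀|) := by gcongr
      _ = _ := by ring

/-! #### Pointwise representation -/

/-- The superposition of all channels at the spectral parameter `k`. -/
def fibre (Φ : ModeFamily μ d s E) (χ : ℕ → ℝ → ℂ) (k : X) (x y : ℝ) : ℂ :=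
  ∑' m, Φ.c m k * Complex.exp (Φ.τ m k * x) * χ m y

lemma exists_fibre_bound (Φ : ModeFamily μ d s E) (hT : Transverse d χ η) {x : ℝ} (hx : x ∈ s)
    (y : ℝ) : ∃ M : ℕ → ℝ, Summable M ∧
      ∀ m k, ‖Φ.c m k * Complex.exp (Φ.τ m k * x) * χ m y‖ ≤ M m := by
  obtain ⟨M, hM, hb⟩ := Φ.decay {x} isCompact_singleton (singleton_subset_iff.2 hx)
  refine ⟨fun m => √(2 / d) * (((m : ℝ) + 1) ^ 2 * M m), hM.mul_left _, fun m k => ?_⟩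
  have h0 := hb m x rfl k
  have h1 : (1 : ℝ) ≤ ((m : ℝ) + 1) ^ 2 :=
    one_le_pow₀ (by linarith [Nat.cast_nonneg (α := ℝ) m])
  rw [norm_mul, mul_comm]
  exact mul_le_mul (hT.bound_left m y)
    (h0.trans (le_mul_of_one_le_left ((norm_nonneg _).trans h0) h1)) (norm_nonneg _)
    (Real.sqrt_nonneg _)

lemma summable_fibre (Φ : ModeFamily μ d s E) (hT : Transverse d χ η) {x : ℝ} (hx : x ∈ s)
    (k : X) (y : ℝ) : Summable fun m => Φ.c m k * Complex.exp (Φ.τ m k * x) * χ m y := by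
  obtain ⟨M, hM, hb⟩ := Φ.exists_fibre_bound hT hx y
  exact Summable.of_norm_bounded hM fun m => hb m k

lemma continuous_fibre (Φ : ModeFamily μ d s E) (hT : Transverse d χ η) {x : ℝ} (hx : x ∈ s)
    (y : ℝ) : Continuous fun k => Φ.fibre χ k x y := by
  obtain ⟨M, hM, hb⟩ := Φ.exists_fibre_bound hT hx y
  exact continuous_tsum (fun m => by fun_prop) hM hb

/-- Exchanges the sum over channels with the integral over k; off x = 0 the decay bound dominates
the terms uniformly in k. -/
lemma hasSum_prof (Φ : ModeFamily μ d s E) (hT : Transverse d χ η) (b : C(X, ℂ)) {x : ℝ}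
    (hx : x ∈ s) (y : ℝ) :
    HasSum (fun m => Φ.prof b m x * χ m y) (∫ k, b k * Φ.fibre χ k x y ∂μ) := by
  obtain ⟨M, hM, hb⟩ := Φ.exists_fibre_bound hT hx y
  have e : ∀ m, Φ.prof b m x * χ m y =
      ∫ k, b k * (Φ.c m k * Complex.exp (Φ.τ m k * x) * χ m y) ∂μ := by
    intro m
    rw [prof, wave, ← integral_mul_const]
    congr 1 with k
    rw [ContinuousMap.mul_apply]
    ring
  have e2 : ∀ k, b k * Φ.fibre χ k x y =
      ∑' m, b k * (Φ.c m k * Complex.exp (Φ.τ m k * x) * χ m y) := fun k => by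
    rw [fibre, tsum_mul_left]
  simp_rw [e, e2]
  refine hasSum_integral_of_summable_integral_norm
    (fun m => integrable_of_continuous (by fun_prop)) ?_
  refine Summable.of_nonneg_of_le (fun m => integral_nonneg fun _ => norm_nonneg _) (fun m => ?_)
    ((hM.mul_left ‖b‖).mul_right (μ.real univ))
  refine (Real.le_norm_self _).trans (norm_integral_le_of_norm_le_const (ae_of_all _ fun k => ?_))
  rw [norm_norm, norm_mul]
  exact mul_le_mul (b.norm_coe_le_norm k) (hb m k) (norm_nonneg _) (norm_nonneg _)

lemma packetCLM_ae (Φ : ModeFamily μ d s E) (hT : Transverse d χ η) (b : C(X, ℂ)) :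
    Φ.packetCLM hT b =ᵐ[volume.restrict (strip d)]
      fun z => s.indicator (fun x => ∫ k, b k * Φ.fibre χ k x z.2 ∂μ) z.1 := by
  refine ae_eq_of_hasSum (Φ.hasSum_term hT b) (Φ.term_ae hT b) fun z => ?_
  by_cases hz : z.1 ∈ s
  · simp only [cutProd, indicator_of_mem hz]
    exact Φ.hasSum_prof hT b hz z.2
  · simp only [cutProd, indicator_of_notMem hz, zero_mul]
    exact hasSum_zero

end ModeFamily

end Waveguide

namespace Waveguide

/-! ### The mode families of the scattering problem -/

section
variable {X : Type*} [TopologicalSpace X] [CompactSpace X] [MeasurableSpace X] [BorelSpace X]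
  {μ : Measure X} [IsFiniteMeasure μ]

/-- Cauchy–Schwarz, from ∫ (V‖f‖ - I)² = V(VJ - I²) ≥ 0; the case V = 0 is separate because one then
cannot divide by V. -/
lemma sq_integral_norm_le (f : C(X, ℂ)) :
    (∫ k, ‖f k‖ ∂μ) ^ 2 ≤ μ.real univ * ∫ k, ‖f k‖ ^ 2 ∂μ := by
  set V := μ.real univ
  set I := ∫ k, ‖f k‖ ∂μ
  set J := ∫ k, ‖f k‖ ^ 2 ∂μ
  have i1 : Integrable (fun k => ‖f k‖) μ := (integrable_continuousMap f).norm
  have i2 : Integrable (fun k => ‖f k‖ ^ 2) μ := by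
    have := (integrable_of_continuous (μ := μ) (f := fun k => f k ^ 2) (by fun_prop)).norm
    simpa only [norm_pow] using this
  have J0 : 0 ≤ J := integral_nonneg fun k => by positivity
  have key : 0 ≤ ∫ k, (V * ‖f k‖ - I) ^ 2 ∂μ := integral_nonneg fun k => sq_nonneg _
  have e : ∫ k, (V * ‖f k‖ - I) ^ 2 ∂μ = V ^ 2 * J - 2 * V * I * I + I ^ 2 * V := by
    have : ∀ k, (V * ‖f k‖ - I) ^ 2 = V ^ 2 * ‖f k‖ ^ 2 - 2 * V * I * ‖f k‖ + I ^ 2 := fun k => by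
      ring
    simp_rw [this]
    have i5 : Integrable (fun k => V ^ 2 * ‖f k‖ ^ 2 - 2 * V * I * ‖f k‖) μ :=
      (i2.const_mul _).sub (i1.const_mul _)
    rw [integral_add i5 (integrable_const _), integral_sub (i2.const_mul _) (i1.const_mul _),
      integral_const_mul, integral_const_mul, integral_const, smul_eq_mul]
    ring
  have V0 : 0 ≤ V := measureReal_nonneg
  rcases V0.eq_or_lt with h | h
  · have h0 : μ univ = 0 := (measureReal_eq_zero_iff (measure_ne_top _ _)).1 h.symm
    have : μ = 0 := Measure.measure_univ_eq_zero.1 h0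
    have hI : I = 0 := by simp only [I, this, integral_zero_measure]
    rw [hI, ← h]; simp
  · rw [e] at key
    have : 0 ≤ V * (V * J - I ^ 2) := by nlinarith
    linarith [nonneg_of_mul_nonneg_right this h]

/-- The 𝓗^{1/2} bound, uniform in k, survives integration over k; finite partial sums avoid any
question of measurability of the full series. -/
lemma summable_integral_norm_sq {c : ℕ → C(X, ℂ)} {B : ℝ}
    (hB : ∀ k, ∀ S : Finset ℕ, ∑ m ∈ S, ((m : ℝ) + 1) * ‖c m k‖ ^ 2 ≤ B) :
    Summable fun m : ℕ => ((m : ℝ) + 1) * (∫ k, ‖c m k‖ ∂μ) ^ 2 := by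
  refine summable_of_sum_le (c := μ.real univ * (B * μ.real univ)) (fun m => by positivity)
    fun S => ?_
  have i2 : ∀ m, Integrable (fun k => ‖c m k‖ ^ 2) μ := fun m => by
    have := (integrable_of_continuous (μ := μ) (f := fun k => c m k ^ 2) (by fun_prop)).norm
    simpa only [norm_pow] using this
  calc ∑ m ∈ S, ((m : ℝ) + 1) * (∫ k, ‖c m k‖ ∂μ) ^ 2
      ≤ ∑ m ∈ S, ((m : ℝ) + 1) * (μ.real univ * ∫ k, ‖c m k‖ ^ 2 ∂μ) := by
        gcongr with m _
        exact sq_integral_norm_le _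
    _ = μ.real univ * ∫ k, ∑ m ∈ S, ((m : ℝ) + 1) * ‖c m k‖ ^ 2 ∂μ := by
        rw [integral_finsetSum _ fun m _ => (i2 m).const_mul _, Finset.mul_sum]
        refine Finset.sum_congr rfl fun m _ => ?_
        rw [integral_const_mul]
        ring
    _ ≤ μ.real univ * (B * μ.real univ) := by
        refine mul_le_mul_of_nonneg_left ?_ measureReal_nonneg
        refine (le_abs_self _).trans (norm_integral_le_of_norm_le_const (f := fun k =>
          ∑ m ∈ S, ((m : ℝ) + 1) * ‖c m k‖ ^ 2) (ae_of_all _ fun k => ?_))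
        rw [Real.norm_of_nonneg (Finset.sum_nonneg fun m _ => by positivity)]
        exact hB k S
end

lemma norm_le_of_bound {X : Type*} [TopologicalSpace X] {c : ℕ → C(X, ℂ)} {B : ℝ}
    (hB : ∀ k, ∀ S : Finset ℕ, ∑ m ∈ S, ((m : ℝ) + 1) * ‖c m k‖ ^ 2 ≤ B) (m : ℕ) (k : X) :
    ‖c m k‖ ≤ 1 + B := by
  have h1 := hB k {m}
  rw [Finset.sum_singleton] at h1
  have h2 : ‖c m k‖ ^ 2 ≤ ((m : ℝ) + 1) * ‖c m k‖ ^ 2 :=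
    le_mul_of_one_le_left (by positivity) (by linarith [Nat.cast_nonneg (α := ℝ) m])
  nlinarith [sq_nonneg (‖c m k‖ - 1)]

/-- The energy `μ_{n₀} + k²` as a function on the interval of wave numbers. -/
def energy (d : ℝ) (n₀ : ℕ) (α β : ℝ) : C(Icc α β, ℂ) :=
  ⟨fun k => ((mu d n₀ + (k : ℝ) ^ 2 : ℝ) : ℂ), by fun_prop⟩

/-- The exponents `± σ_m` as continuous functions on the interval of wave numbers. -/
def expo (d : ℝ) (n₀ N : ℕ) (α β : ℝ) (ς : ℝ) (m : ℕ) : C(Icc α β, ℂ) :=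
  ⟨fun k => ς * sig d n₀ N m k, by
    have := Admissible.continuous_sig (d := d) (n₀ := n₀) (N := N) m
    fun_prop⟩

/-- Bounds in one channel. -/
lemma exists_channel_bound {d : ℝ} {n₀ N : ℕ} {α β : ℝ} (hA : Admissible d n₀ N α β)
    (hαβ : α ≤ β) {s : Set ℝ} (hs : MeasurableSet s) {ς : ℝ} (hς : ς ^ 2 = 1)
    {κ : ℝ} (κ0 : 0 < κ)
    (hκ : ∀ k ∈ Icc α β, ∀ m : ℕ, κ * ((m : ℝ) + 1) ≤ ‖sig d n₀ N m k‖)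
    {C : ℝ} (hC : ∀ k ∈ Icc α β, ∀ m : ℕ, ‖sig d n₀ N m k‖ ≤ C * ((m : ℝ) + 1)) (C1 : 1 ≤ C)
    (m : ℕ) (c : C(Icc α β, ℂ)) (hc : N ≤ m → c = 0 ∨ ∀ x ∈ s, ς * x = -|x|) :
    ∃ A, 0 ≤ A ∧ (∀ b : C(Icc α β, ℂ),
      (MemLp (s.indicator (wave (iccMeasure α β) (expo d n₀ N α β ς m) (b * c))) 2 ∧
      eLpNorm (s.indicator (wave (iccMeasure α β) (expo d n₀ N α β ς m) (b * c))) 2 ≤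
        ENNReal.ofReal (A * ‖b‖)) ∧
      MemLp (s.indicator (wave (iccMeasure α β) (expo d n₀ N α β ς m)
        (expo d n₀ N α β ς m * (b * c)))) 2 ∧
      eLpNorm (s.indicator (wave (iccMeasure α β) (expo d n₀ N α β ς m)
        (expo d n₀ N α β ς m * (b * c)))) 2 ≤
        ENNReal.ofReal (((m : ℝ) + 1) * A * ‖b‖)) ∧
      (N ≤ m → A = C * (∫ k, ‖c k‖ ∂iccMeasure α β) / √(κ * ((m : ℝ) + 1))) := by
  have hα : 0 < α := hA.pos ⟨le_rfl, hαβ⟩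
  have m1 : (1 : ℝ) ≤ (m : ℝ) + 1 := by linarith [Nat.cast_nonneg (α := ℝ) m]
  set τ := expo d n₀ N α β ς m
  have abs_s : |ς| = 1 := (sq_eq_sq₀ (abs_nonneg ς) zero_le_one).1 (by rw [sq_abs, hς, one_pow])
  rcases lt_or_ge m N with hm | hm
  -- Open channel: Plancherel on the whole line, then restriction to s. The sign is -ς because the
  -- exponent is ς σ = -ς i k_{m+1}. The factor 1 + ‖τ‖ in the constant makes it serve for the
  -- derivative as well.
  · obtain ⟨D, D0, hD⟩ := exists_wave_bound (α := α) (β := β)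
      (m₀ := mu d n₀ - mu d (m + 1)) (s := -ς) hα (by rw [neg_sq, hς])
      (fun k hk => by linarith [hA.lt hk hm]) τ (fun k => by
        simp only [τ, expo, ContinuousMap.coe_mk, sig, if_pos hm, waveNumber]
        push_cast; ring)
    refine ⟨D * (‖c‖ * (1 + ‖τ‖)), by positivity, fun b => ⟨⟨(hD _).1.indicator hs, ?_⟩,
      (hD _).1.indicator hs, ?_⟩, fun h => absurd h (not_le.2 hm)⟩
    · refine (eLpNorm_indicator_le _).trans ((hD _).2.trans (ENNReal.ofReal_le_ofReal ?_))
      have h1 : ‖b * c‖ ≤ ‖b‖ * ‖c‖ := norm_mul_le _ _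
      calc D * ‖b * c‖ ≤ D * (‖b‖ * ‖c‖) := by gcongr
        _ ≤ D * (‖b‖ * ‖c‖) * (1 + ‖τ‖) :=
            le_mul_of_one_le_right (by positivity) (by linarith [norm_nonneg τ])
        _ = _ := by ring
    · refine (eLpNorm_indicator_le _).trans ((hD _).2.trans (ENNReal.ofReal_le_ofReal ?_))
      have h1 : ‖τ * (b * c)‖ ≤ ‖τ‖ * (‖b‖ * ‖c‖) :=
        (norm_mul_le _ _).trans (by gcongr; exact norm_mul_le _ _)
      calc D * ‖τ * (b * c)‖ ≤ D * (‖τ‖ * (‖b‖ * ‖c‖)) := by gcongr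
        _ ≤ D * ((1 + ‖τ‖) * (‖b‖ * ‖c‖)) := by gcongr; linarith
        _ ≤ ((m : ℝ) + 1) * (D * ((1 + ‖τ‖) * (‖b‖ * ‖c‖))) :=
            le_mul_of_one_le_left (by positivity) m1
        _ = _ := by ring
  · have w0 : 0 ≤ ∫ k, ‖c k‖ ∂iccMeasure α β := integral_nonneg fun _ => norm_nonneg _
    have κm : 0 < κ * ((m : ℝ) + 1) := by positivity
    have A0 : 0 ≤ C * (∫ k, ‖c k‖ ∂iccMeasure α β) / √(κ * ((m : ℝ) + 1)) :=
      div_nonneg (mul_nonneg (by linarith) w0) (Real.sqrt_nonneg _)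
    -- Closed channel: the derivative costs C(m+1), which is the weight in the second estimate, and
    -- 1 ≤ C lets the same constant bound the function. The explicit formula is exported because
    -- summability over m depends on it.
    refine ⟨_, A0, fun b => ?_, fun _ => rfl⟩
    rcases hc hm with rfl | hx
    · have z : ∀ h : C(Icc α β, ℂ), h = 0 →
          s.indicator (wave (iccMeasure α β) τ h) = 0 := by
        rintro h rfl
        ext x
        have : wave (iccMeasure α β) τ 0 = 0 := by ext x; simp [wave]
        rw [this]; simp
      rw [z (b * 0) (mul_zero b), z (τ * (b * 0)) (by rw [mul_zero, mul_zero])]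
      simp
    · have hτ : ∀ k, ∀ x ∈ s, (τ k).re * x ≤ -(κ * ((m : ℝ) + 1)) * |x| := by
        intro k x hxs
        have h1 := hκ k k.2 m
        have e : τ k = ((ς * decayRate d n₀ k (m + 1) : ℝ) : ℂ) := by
          simp only [τ, expo, ContinuousMap.coe_mk, sig, if_neg (not_lt.2 hm)]
          push_cast; ring
        rw [sig, if_neg (not_lt.2 hm), Complex.norm_real,
          Real.norm_of_nonneg (by simp only [decayRate]; positivity)] at h1
        rw [e, Complex.ofReal_re, mul_right_comm, hx x hxs]
        nlinarith [abs_nonneg x]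
      obtain ⟨a1, a2⟩ := eLpNorm_evanescent (μ := iccMeasure α β) hs κm hτ (b * c)
      obtain ⟨a3, a4⟩ := eLpNorm_evanescent (μ := iccMeasure α β) hs κm hτ (τ * (b * c))
      have ic := (integrable_continuousMap (μ := iccMeasure α β) c).norm
      have j1 : ∫ k, ‖(b * c) k‖ ∂iccMeasure α β ≤ ‖b‖ * ∫ k, ‖c k‖ ∂iccMeasure α β := by
        rw [← integral_const_mul]
        refine integral_mono (integrable_continuousMap (b * c)).norm (ic.const_mul _) fun k => ?_
        simp only [ContinuousMap.mul_apply, norm_mul]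
        gcongr
        exact b.norm_coe_le_norm k
      have j2 : ∫ k, ‖(τ * (b * c)) k‖ ∂iccMeasure α β ≤
          C * ((m : ℝ) + 1) * ‖b‖ * ∫ k, ‖c k‖ ∂iccMeasure α β := by
        rw [← integral_const_mul]
        refine integral_mono (integrable_continuousMap (τ * (b * c))).norm (ic.const_mul _)
          fun k => ?_
        have ht : ‖τ k‖ ≤ C * ((m : ℝ) + 1) := by
          simp only [τ, expo, ContinuousMap.coe_mk, norm_mul, Complex.norm_real, Real.norm_eq_abs,
            abs_s, one_mul]
          exact hC k k.2 m
        simp only [ContinuousMap.mul_apply, norm_mul]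
        rw [← mul_assoc]
        gcongr
        exact b.norm_coe_le_norm k
      refine ⟨⟨a1, a2.trans (ENNReal.ofReal_le_ofReal ?_)⟩, a3,
        a4.trans (ENNReal.ofReal_le_ofReal ?_)⟩
      · rw [div_mul_eq_mul_div]
        gcongr
        calc _ ≤ 1 * (‖b‖ * ∫ k, ‖c k‖ ∂iccMeasure α β) := by rw [one_mul]; exact j1
          _ ≤ C * (‖b‖ * ∫ k, ‖c k‖ ∂iccMeasure α β) := by gcongr
          _ = _ := by ring
      · rw [mul_div_assoc', div_mul_eq_mul_div]
        gcongr
        refine j2.trans_eq ?_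
        ring

/-- The family of modes with given coefficients and exponents `± σ_m`. -/
lemma exists_modeFamily {d : ℝ} {n₀ N : ℕ} {α β : ℝ} (hA : Admissible d n₀ N α β)
    (hαβ : α ≤ β) {s : Set ℝ} (hs : MeasurableSet s) {ς : ℝ} (hς : ς ^ 2 = 1)
    (c : ℕ → C(Icc α β, ℂ)) {B : ℝ}
    (hB : ∀ k, ∀ S : Finset ℕ, ∑ m ∈ S, ((m : ℝ) + 1) * ‖c m k‖ ^ 2 ≤ B)
    (hc : (∀ m, N ≤ m → c m = 0) ∨ (0 ∉ s ∧ ∀ x ∈ s, ς * x = -|x|)) :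
    ∃ Φ : ModeFamily (iccMeasure α β) d s (energy d n₀ α β),
      Φ.τ = expo d n₀ N α β ς ∧ Φ.c = c := by
  obtain ⟨κ, κ0, hκ⟩ := hA.exists_lower hαβ
  obtain ⟨C', -, hC'⟩ := hA.exists_upper
  have hC : ∀ k ∈ Icc α β, ∀ m : ℕ, ‖sig d n₀ N m k‖ ≤ max 1 C' * ((m : ℝ) + 1) :=
    fun k hk m => (hC' k hk m).trans (by gcongr; exact le_max_right _ _)
  have hB0 := norm_le_of_bound hB
  choose A A0 hle hform using fun m => exists_channel_bound hA hαβ hs hς κ0 hκ hC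
    (le_max_left _ _) m (c m) (fun hm => hc.imp (fun h => h m hm) (fun h => h.2))
  refine ⟨⟨expo d n₀ N α β ς, c, A, A0, fun m k => ?_, fun m b => (hle m b).1.1,
    fun m b => (hle m b).1.2, fun m b => (hle m b).2.1, fun m b => (hle m b).2.2, ?_, ?_⟩, rfl, rfl⟩
  · have hς' : (ς : ℂ) ^ 2 = 1 := by exact_mod_cast hς
    simp only [expo, energy, ContinuousMap.coe_mk]
    rw [mul_pow, hς', one_mul, hA.sig_sq k.2]
    push_cast; ring
  -- In closed channels ((m+1)A_m)² = (C²/κ)(m+1)(∫‖c_m‖)²; the finitely many open channels do not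
  -- affect convergence.
  · have s1 := (summable_integral_norm_sq (μ := iccMeasure α β) hB).mul_left (max 1 C' ^ 2 / κ)
    refine (summable_congr_cofinite ?_).1 s1
    have : {m : ℕ | N ≤ m} ∈ (cofinite : Filter ℕ) := by
      rw [Nat.cofinite_eq_atTop]; exact Ici_mem_atTop N
    filter_upwards [this] with m hm
    rw [hform m hm, mul_pow, div_pow, Real.sq_sqrt (by positivity)]
    field_simp
  · intro K hK hKs
    -- δ bounds from below the distance from K to the origin, positive since 0 ∉ s; if the closed
    -- channels are absent any δ will do.
    obtain ⟨δ, δ0, hδ⟩ : ∃ δ, 0 < δ ∧ ∀ m, N ≤ m → ∀ x ∈ K, ∀ k,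
        ‖c m k * Complex.exp (expo d n₀ N α β ς m k * (x : ℝ))‖ ≤
          (1 + B) * Real.exp (-(κ * δ) * ((m : ℝ) + 1)) := by
      rcases hc with h0 | ⟨h0, h1⟩
      · refine ⟨1, one_pos, fun m hm x _ k => ?_⟩
        rw [h0 m hm]
        have : 0 ≤ 1 + B := (norm_nonneg _).trans (hB0 m k)
        simp only [ContinuousMap.zero_apply, zero_mul, norm_zero]
        positivity
      · have : Kᶜ ∈ 𝓝 (0 : ℝ) := hK.isClosed.isOpen_compl.mem_nhds fun h => h0 (hKs h)
        obtain ⟨δ, δ0, hδ⟩ := Metric.mem_nhds_iff.1 this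
        refine ⟨δ, δ0, fun m hm x hx k => ?_⟩
        have hxδ : δ ≤ |x| := by
          by_contra! h
          exact hδ (by rwa [Metric.mem_ball, Real.dist_eq, sub_zero]) hx
        have h2 := hκ k k.2 m
        have e : expo d n₀ N α β ς m k = ((ς * decayRate d n₀ k (m + 1) : ℝ) : ℂ) := by
          simp only [expo, ContinuousMap.coe_mk, sig, if_neg (not_lt.2 hm)]
          push_cast; ring
        rw [sig, if_neg (not_lt.2 hm), Complex.norm_real,
          Real.norm_of_nonneg (by simp only [decayRate]; positivity)] at h2
        rw [norm_mul, e, Complex.norm_exp, Complex.re_mul_ofReal, Complex.ofReal_re,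
          mul_right_comm, h1 x (hKs hx)]
        refine mul_le_mul (hB0 m k) (Real.exp_le_exp.2 ?_) (Real.exp_nonneg _)
          ((norm_nonneg _).trans (hB0 m k))
        have : δ * (κ * ((m : ℝ) + 1)) ≤ |x| * decayRate d n₀ k (m + 1) :=
          mul_le_mul hxδ h2 (by positivity) (abs_nonneg _)
        linarith
    set q := Real.exp (-(κ * δ))
    have q1 : q < 1 := by
      rw [Real.exp_lt_one_iff]
      have := mul_pos κ0 δ0
      linarith
    have eq : ∀ m : ℕ, Real.exp (-(κ * δ) * ((m : ℝ) + 1)) = q ^ (m + 1) := by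
      intro m
      rw [← Real.exp_nat_mul]
      congr 1
      push_cast; ring
    -- A geometric majorant for all channels at once: e^{κδN} compensates q^{m+1} for m < N, where
    -- the waves have modulus one and do not decay.
    refine ⟨fun m => (1 + B) * Real.exp (κ * δ * N) * q ^ (m + 1), ?_, fun m x hx k => ?_⟩
    · have s1 := summable_pow_mul_geometric_of_norm_lt_one (R := ℝ) 2
        (r := q) (by rwa [Real.norm_of_nonneg (Real.exp_nonneg _)])
      have s2 := ((summable_nat_add_iff 1).2 s1).mul_left ((1 + B) * Real.exp (κ * δ * N))
      convert! s2 using 2 with m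
      push_cast
      ring
    · have B0 : 0 ≤ 1 + B := (norm_nonneg _).trans (hB0 m k)
      rcases lt_or_ge m N with hm | hm
      · have e : (expo d n₀ N α β ς m k * (x : ℝ)).re = 0 := by
          simp only [expo, ContinuousMap.coe_mk, sig, if_pos hm]
          simp
        simp only
        rw [norm_mul, Complex.norm_exp, e, Real.exp_zero, mul_one, ← eq, mul_assoc, ← Real.exp_add]
        refine (hB0 m k).trans (le_mul_of_one_le_right B0 (Real.one_le_exp ?_))
        have : (m : ℝ) + 1 ≤ N := by exact_mod_cast hm
        have : 0 ≤ κ * δ * (N - (m + 1)) := mul_nonneg (by positivity) (by linarith)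
        linarith
      · refine (hδ m hm x hx k).trans ?_
        rw [eq]
        have : 1 ≤ Real.exp (κ * δ * N) := Real.one_le_exp (by positivity)
        have hq : 0 ≤ q ^ (m + 1) := pow_nonneg (Real.exp_nonneg _) _
        exact mul_le_mul_of_nonneg_right (le_mul_of_one_le_right B0 this) hq

end Waveguide

namespace Waveguide

/-! ### Wave packets as solutions of the Schrödinger equation -/

section
variable {d : ℝ} {n₀ : ℕ} {α β : ℝ}

/-- The amplitude `a(k) e^{-i(μ_{n₀} + k²)t}` on the interval of wave numbers. -/
def amplitude (d : ℝ) (n₀ : ℕ) {α β : ℝ} (a : C(Icc α β, ℂ)) (t : ℝ) : C(Icc α β, ℂ) :=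
  NormedSpace.exp (t • (-Complex.I • energy d n₀ α β)) * a

/-- Evaluation at k is a continuous algebra homomorphism, so it commutes with the exponential of
C([α, β]). Defining the amplitude by that exponential gives its differentiability in sup norm
directly. -/
lemma amplitude_apply (a : C(Icc α β, ℂ)) (t : ℝ) (k : Icc α β) :
    amplitude d n₀ a t k =
      a k * Complex.exp (-Complex.I * (mu d n₀ + ((k : ℝ) : ℂ) ^ 2) * t) := by
  have h := NormedSpace.map_exp (ContinuousMap.evalAlgHom (S := ℝ) (R := ℂ) k)
    (continuous_eval_const k) (t • (-Complex.I • energy d n₀ α β))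
  rw [← Complex.exp_eq_exp_ℂ] at h
  rw [amplitude, ContinuousMap.mul_apply, mul_comm]
  congr 1
  refine h.trans (congrArg _ ?_)
  change t • (-Complex.I • energy d n₀ α β k) = _
  rw [Complex.real_smul, smul_eq_mul, energy, ContinuousMap.coe_mk]
  push_cast
  ring

lemma hasDerivAt_amplitude (a : C(Icc α β, ℂ)) (t : ℝ) :
    HasDerivAt (amplitude d n₀ a)
      (-Complex.I • (energy d n₀ α β * amplitude d n₀ a t)) t := by
  have h := (hasDerivAt_exp_smul_const (𝕂 := ℝ) (-Complex.I • energy d n₀ α β) t).mul_const a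
  convert! h using 1
  rw [amplitude]
  simp only [smul_mul_assoc, mul_smul_comm]
  congr 1
  ring

/-- A family of wave packets which depends linearly on the amplitude, and on which the Laplace
operator acts as multiplication of the amplitude by `-(μ_{n₀} + k²)`, solves the Schrödinger
equation. -/
lemma packetSolves_of_clm {B : BoundaryConditions} {F : ℝ → ℝ → ℝ → ℂ} {a : ℝ → ℂ}
    (ha : Continuous a) (hsupp : tsupport a ⊆ Icc α β) (T : C(Icc α β, ℂ) →L[ℂ] L2Strip d)
    (hdom : ∀ b, MemLaplaceDomain B (T b))
    (hlap : ∀ b, HasWeakLaplacian (T b) (-T (energy d n₀ α β * b)))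
    (hT : ∀ b, T b =ᵐ[volume.restrict (strip d)]
      fun z => ∫ k : Icc α β, b k * F k z.1 z.2 ∂iccMeasure α β)
    (hF : ∀ x y, x ≠ 0 → y ∈ Ioo 0 d → Continuous fun k : Icc α β => F k x y) :
    PacketSolves d n₀ a (-laplaceOp d B) F := by
  have h0 : ∀ t x y k, k ∉ Icc α β → packetIntegrand d n₀ a F t x y k = 0 := by
    intro t x y k hk
    rw [packetIntegrand, image_eq_zero_of_notMem_tsupport fun h => hk (hsupp h), zero_mul, zero_mul]
  refine ⟨fun t x y hx hy => ?_, ?_⟩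
  · have h1 : IntegrableOn (packetIntegrand d n₀ a F t x y) (Icc α β) := by
      rw [integrableOn_iff_comap_subtypeVal measurableSet_Icc]
      change Integrable _ (iccMeasure α β)
      have h2 : Continuous fun k : Icc α β =>
          a k * Complex.exp (-Complex.I * (mu d n₀ + ((k : ℝ) : ℂ) ^ 2) * t) := by fun_prop
      exact integrable_of_continuous (h2.mul (hF x y hx hy))
    exact h1.integrable_of_forall_notMem_eq_zero (h0 t x y)
  · set A : C(Icc α β, ℂ) := ⟨fun k => a k, by fun_prop⟩
    refine ⟨fun t => T (amplitude d n₀ A t), fun t => ?_, fun t => ?_⟩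
    · refine (hT _).trans (ae_of_all _ fun z => ?_)
      change _ = ∫ k, packetIntegrand d n₀ a F t z.1 z.2 k
      rw [← setIntegral_eq_integral_of_forall_compl_eq_zero (h0 t z.1 z.2), ← integral_subtype_Icc]
      refine integral_congr_ae (ae_of_all _ fun k => ?_)
      simp only [amplitude_apply, packetIntegrand]
      rfl
    -- The chain rule: T is bounded, so T applied to the curve of amplitudes is differentiable in
    -- L²(Ω), and i times its derivative is T(E b), the negative of the distributional Laplacian.
    · refine ⟨hdom _, _, (T.restrictScalars ℝ).hasFDerivAt.comp_hasDerivAt t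
        (hasDerivAt_amplitude A t), ?_⟩
      rw [LinearPMap.neg_apply]
      have := (laplaceOp_spec (B := B) ⟨_, hdom (amplitude d n₀ A t)⟩).unique (hlap _)
      rw [this, neg_neg, ContinuousLinearMap.coe_restrictScalars', map_smul, smul_smul]
      simp
end

end Waveguide

namespace Waveguide

/-! ### From mode families to solutions -/

lemma pairing_add {d : ℝ} {φ : ℝ × ℝ → ℝ} (h : Continuous φ) (hc : HasCompactSupport φ)
    (u v : L2Strip d) : ∫ z in strip d, φ z • (u + v) z =
      (∫ z in strip d, φ z • u z) + ∫ z in strip d, φ z • v z := by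
  have := pairing_comb h hc 1 u v
  rwa [one_smul, one_mul] at this

lemma pairing_neg {d : ℝ} {φ : ℝ × ℝ → ℝ} (h : Continuous φ) (hc : HasCompactSupport φ)
    (u : L2Strip d) : ∫ z in strip d, φ z • (-u) z = -∫ z in strip d, φ z • u z := by
  have := pairing_comb h hc (-1) u 0
  rwa [neg_one_smul, add_zero, pairing_zero, add_zero, neg_one_mul] at this

lemma HasZeroTrace.add {d : ℝ} {u v : L2Strip d} {Γ : Set ℝ} {l : Filter ℝ}
    (hu : HasZeroTrace u Γ l) (hv : HasZeroTrace v Γ l) : HasZeroTrace (u + v) Γ l := by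
  have := hu.comb 1 hv
  rwa [one_smul] at this

lemma HasWeakDy.add {d : ℝ} {u v g k : L2Strip d} (hu : HasWeakDy u g) (hv : HasWeakDy v k) :
    HasWeakDy (u + v) (g + k) := by
  have := hu.comb 1 hv
  rwa [one_smul, one_smul] at this

section
variable {d : ℝ} {n₀ : ℕ} {α β : ℝ} {χ η : ℕ → ℝ → ℂ}

/-- Superpositions of modes of the whole strip solve the Schrödinger equation. -/
lemma packetSolves_of_modes (hd : 0 < d)
    (Φ : ModeFamily (iccMeasure α β) d univ (energy d n₀ α β)) (hT : Transverse d χ η)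
    {B : BoundaryConditions} {F : ℝ → ℝ → ℝ → ℂ} {a : ℝ → ℂ}
    (ha : Continuous a) (hsupp : tsupport a ⊆ Icc α β)
    (h1 : (∀ m, χ m 0 = 0) ∨ B.dirichletLower = ∅) (h2 : (∀ m, χ m d = 0) ∨ B.dirichletUpper = ∅)
    (h3 : (∀ m, η m 0 = 0) ∨ B.neumannLower = ∅) (h4 : (∀ m, η m d = 0) ∨ B.neumannUpper = ∅)
    (hF : ∀ k : Icc α β, ∀ x y, F k x y = Φ.fibre χ k x y) :
    PacketSolves d n₀ a (-laplaceOp d B) F := by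
  have hs : IsSide univ 0 := Or.inr (Or.inr ⟨rfl, rfl⟩)
  have hlap : ∀ b, HasWeakLaplacian (Φ.packetCLM hT b)
      (-Φ.packetCLM hT (energy d n₀ α β * b)) := fun b φ hφ => by
    have h := Φ.hasSum_weakLaplacian hT hs b hφ
    simp only [zero_mul] at h
    rw [pairing_neg hφ.smooth.continuous hφ.compact]
    exact eq_neg_of_add_eq_zero_left (h.unique hasSum_zero)
  have key : ∀ {Γ : Set ℝ} {ξ : ℕ → ℝ → ℂ} {y₀ : ℝ}, ((∀ m, ξ m y₀ = 0) ∨ Γ = ∅) →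
      (Γ ⊆ univ ∧ ∀ m, ξ m y₀ = 0) ∨ Disjoint Γ (univ : Set ℝ) := by
    rintro Γ ξ y₀ (h | rfl)
    · exact Or.inl ⟨subset_univ _, h⟩
    · exact Or.inr (empty_disjoint _)
  refine packetSolves_of_clm ha hsupp (Φ.packetCLM hT) (fun b => ?_) hlap (fun b => ?_)
    fun x y _ _ => ?_
  · refine ⟨Φ.packetX hT b, Φ.packetY hT b, _, fun φ hφ => ?_, Φ.hasWeakDy hd hT .univ b, hlap b,
      Φ.hasZeroTrace_packet hd hT .univ b (key h1) nhdsWithin_le_nhds,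
      Φ.hasZeroTrace_packet hd hT .univ b (key h2) nhdsWithin_le_nhds,
      Φ.hasZeroTrace_packetY hd hT .univ b (key h3) nhdsWithin_le_nhds,
      Φ.hasZeroTrace_packetY hd hT .univ b (key h4) nhdsWithin_le_nhds⟩
    have h := Φ.hasSum_weakDx hT hs b hφ
    simp only [zero_mul] at h
    exact eq_neg_of_add_eq_zero_left (h.unique hasSum_zero)
  · refine (Φ.packetCLM_ae hT b).trans (ae_of_all _ fun z => ?_)
    simp only [indicator_univ, hF]
  · simp only [hF]
    exact Φ.continuous_fibre hT (mem_univ x) y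

lemma ae_fst_ne_zero (d : ℝ) : ∀ᵐ z : ℝ × ℝ ∂volume.restrict (strip d), z.1 ≠ 0 := by
  rw [volume_restrict_strip]
  exact Measure.quasiMeasurePreserving_fst.ae (compl_mem_ae_iff.2 (measure_singleton (0 : ℝ)))

/-- Superpositions of modes on both sides of `x = 0` which satisfy the matching conditions solve
the Schrödinger equation. -/
lemma packetSolves_of_matching (hd : 0 < d)
    (Φ₁ Φ₂ : ModeFamily (iccMeasure α β) d (Iio 0) (energy d n₀ α β))
    (Φ₃ : ModeFamily (iccMeasure α β) d (Ioi 0) (energy d n₀ α β))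
    {F : ℝ → ℝ → ℝ → ℂ} {a : ℝ → ℂ} (ha : Continuous a) (hsupp : tsupport a ⊆ Icc α β)
    (h : ∀ b g, IsTestInterval d g → HasSum (fun m =>
      (Φ₁.prof b m 0 + Φ₂.prof b m 0) * coeff (chiMinus d (m + 1)) g -
        Φ₃.prof b m 0 * coeff (chiPlus d (m + 1)) g) 0)
    (h' : ∀ b g, IsTestInterval d g → HasSum (fun m =>
      (Φ₁.prof' b m 0 + Φ₂.prof' b m 0) * coeff (chiMinus d (m + 1)) g -
        Φ₃.prof' b m 0 * coeff (chiPlus d (m + 1)) g) 0)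
    (hFl : ∀ k : Icc α β, ∀ x < 0, ∀ y, F k x y =
      Φ₁.fibre (fun m => chiMinus d (m + 1)) k x y + Φ₂.fibre (fun m => chiMinus d (m + 1)) k x y)
    (hFr : ∀ k : Icc α β, ∀ x > 0, ∀ y, F k x y = Φ₃.fibre (fun m => chiPlus d (m + 1)) k x y) :
    PacketSolves d n₀ a (hamiltonian d) F := by
  have hl : IsSide (Iio 0) 1 := Or.inl ⟨rfl, rfl⟩
  have hr : IsSide (Ioi 0) (-1) := Or.inr (Or.inl ⟨rfl, rfl⟩)
  have dis : Disjoint (Iio (0 : ℝ)) (Ioi 0) :=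
    (Iio_disjoint_Ici le_rfl).mono_right Ioi_subset_Ici_self
  have hM := transverse_minus hd
  have hP := transverse_plus hd
  set T := Φ₁.packetCLM hM + Φ₂.packetCLM hM + Φ₃.packetCLM hP
  have Tb : ∀ b, T b = Φ₁.packetCLM hM b + Φ₂.packetCLM hM b + Φ₃.packetCLM hP b := fun _ => rfl
  have hlap : ∀ b, HasWeakLaplacian (T b) (-T (energy d n₀ α β * b)) := fun b φ hφ => by
    have c0 := hφ.smooth.continuous
    have c1 := hφ.laplacian.smooth.continuous
    have c2 := hφ.compact
    have c3 := hφ.laplacian.compact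
    have e := ((Φ₁.hasSum_weakLaplacian hM hl b hφ).add (Φ₂.hasSum_weakLaplacian hM hl b hφ)).add
      (Φ₃.hasSum_weakLaplacian hP hr b hφ)
    -- The boundary terms of Green's formula involve the trace against ∂ₓφ(0, ·) and the normal
    -- derivative against φ(0, ·); each combination vanishes by its own matching condition.
    have e2 := ((h b _ (hφ.dx.slice 0)).sub (h' b _ (hφ.slice 0)))
    rw [sub_zero] at e2
    have e3 := e.unique (e2.congr_fun fun m => by ring)
    rw [pairing_neg c0 c2, Tb, Tb, pairing_add c0 c2, pairing_add c0 c2, pairing_add c1 c3,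
      pairing_add c1 c3]
    linear_combination e3
  refine packetSolves_of_clm ha hsupp T (fun b => ?_) hlap (fun b => ?_) fun x y hx _ => ?_
  · refine ⟨Φ₁.packetX hM b + Φ₂.packetX hM b + Φ₃.packetX hP b,
      Φ₁.packetY hM b + Φ₂.packetY hM b + Φ₃.packetY hP b, _, fun φ hφ => ?_,
      ((Φ₁.hasWeakDy hd hM measurableSet_Iio b).add (Φ₂.hasWeakDy hd hM measurableSet_Iio b)).add
        (Φ₃.hasWeakDy hd hP measurableSet_Ioi b), hlap b, ?_, ?_, ?_, ?_⟩
    · have c0 := hφ.smooth.continuous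
      have c1 := hφ.dx.smooth.continuous
      have c2 := hφ.compact
      have c3 := hφ.dx.compact
      have e := ((Φ₁.hasSum_weakDx hM hl b hφ).add (Φ₂.hasSum_weakDx hM hl b hφ)).add
        (Φ₃.hasSum_weakDx hP hr b hφ)
      have e3 := e.unique ((h b _ (hφ.slice 0)).congr_fun fun m => by ring)
      rw [Tb, pairing_add c0 c2, pairing_add c0 c2, pairing_add c1 c3, pairing_add c1 c3]
      linear_combination e3
    · have g : (Iio (0 : ℝ) ⊆ Iio 0 ∧ ∀ m, chiMinus d (m + 1) 0 = 0) ∨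
          Disjoint (Iio (0 : ℝ)) (Iio 0) := Or.inl ⟨subset_rfl, fun m => chiMinus_zero d _⟩
      exact ((Φ₁.hasZeroTrace_packet hd hM measurableSet_Iio b g nhdsWithin_le_nhds).add
        (Φ₂.hasZeroTrace_packet hd hM measurableSet_Iio b g nhdsWithin_le_nhds)).add
        (Φ₃.hasZeroTrace_packet hd hP measurableSet_Ioi b (Or.inr dis) nhdsWithin_le_nhds)
    · exact ((Φ₁.hasZeroTrace_packet hd hM measurableSet_Iio b (Or.inr dis.symm)
          nhdsWithin_le_nhds).add
        (Φ₂.hasZeroTrace_packet hd hM measurableSet_Iio b (Or.inr dis.symm)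
          nhdsWithin_le_nhds)).add
        (Φ₃.hasZeroTrace_packet hd hP measurableSet_Ioi b
          (Or.inl ⟨subset_rfl, chiPlus_top hd⟩) nhdsWithin_le_nhds)
    · exact ((Φ₁.hasZeroTrace_packetY hd hM measurableSet_Iio b (Or.inr dis.symm)
          nhdsWithin_le_nhds).add
        (Φ₂.hasZeroTrace_packetY hd hM measurableSet_Iio b (Or.inr dis.symm)
          nhdsWithin_le_nhds)).add
        (Φ₃.hasZeroTrace_packetY hd hP measurableSet_Ioi b
          (Or.inl ⟨subset_rfl, fun m => by rw [chiMinus_zero, neg_zero]⟩) nhdsWithin_le_nhds)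
    · have g : (Iio (0 : ℝ) ⊆ Iio 0 ∧ ∀ m, chiPlus d (m + 1) d = 0) ∨
          Disjoint (Iio (0 : ℝ)) (Iio 0) := Or.inl ⟨subset_rfl, chiPlus_top hd⟩
      exact ((Φ₁.hasZeroTrace_packetY hd hM measurableSet_Iio b g nhdsWithin_le_nhds).add
        (Φ₂.hasZeroTrace_packetY hd hM measurableSet_Iio b g nhdsWithin_le_nhds)).add
        (Φ₃.hasZeroTrace_packetY hd hP measurableSet_Ioi b (Or.inr dis) nhdsWithin_le_nhds)
  · filter_upwards [Lp.coeFn_add (Φ₁.packetCLM hM b + Φ₂.packetCLM hM b) (Φ₃.packetCLM hP b),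
      Lp.coeFn_add (Φ₁.packetCLM hM b) (Φ₂.packetCLM hM b), Φ₁.packetCLM_ae hM b,
      Φ₂.packetCLM_ae hM b, Φ₃.packetCLM_ae hP b, ae_fst_ne_zero d] with z e1 e2 e3 e4 e5 hz
    rw [Tb, e1, Pi.add_apply, e2, Pi.add_apply, e3, e4, e5]
    rcases lt_or_gt_of_ne hz with h0 | h0
    · rw [indicator_of_mem (mem_Iio.2 h0), indicator_of_mem (mem_Iio.2 h0),
        indicator_of_notMem (notMem_Ioi.2 h0.le), add_zero]
      have i1 := Φ₁.continuous_fibre hM (mem_Iio.2 h0) z.2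
      have i2 := Φ₂.continuous_fibre hM (mem_Iio.2 h0) z.2
      rw [← integral_add (integrable_of_continuous (by fun_prop))
        (integrable_of_continuous (by fun_prop))]
      refine integral_congr_ae (ae_of_all _ fun k => ?_)
      simp only [hFl k _ h0, mul_add]
    · rw [indicator_of_mem (mem_Ioi.2 h0), indicator_of_notMem (notMem_Iio.2 h0.le),
        indicator_of_notMem (notMem_Iio.2 h0.le), add_zero, zero_add]
      simp only [hFr _ _ h0]
  · rcases lt_or_gt_of_ne hx with h0 | h0
    · simp only [hFl _ x h0]
      exact (Φ₁.continuous_fibre hM (mem_Iio.2 h0) y).add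
        (Φ₂.continuous_fibre hM (mem_Iio.2 h0) y)
    · simp only [hFr _ x h0]
      exact Φ₃.continuous_fibre hP (mem_Ioi.2 h0) y
end

end Waveguide

namespace Waveguide

/-! ### The wave packets of the scattering problem -/

/-- Integrates a matching condition, valid for each k, against the amplitude. The fast decay of the
coefficients p, q of a test function dominates the polynomially bounded coefficients u, v, so sum
and integral may be exchanged. -/
lemma hasSum_integral_matching {X : Type*} [TopologicalSpace X] [CompactSpace X]
    [MeasurableSpace X] [BorelSpace X] {μ : Measure X} [IsFiniteMeasure μ]
    (b : C(X, ℂ)) {u v : ℕ → C(X, ℂ)} {p q : ℕ → ℂ} {K : ℝ}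
    (hu : ∀ m k, ‖u m k‖ ≤ K * ((m : ℝ) + 1) ^ 2) (hv : ∀ m k, ‖v m k‖ ≤ K * ((m : ℝ) + 1) ^ 2)
    (hp : Summable fun m : ℕ => ((m : ℝ) + 1) ^ 2 * ‖p m‖)
    (hq : Summable fun m : ℕ => ((m : ℝ) + 1) ^ 2 * ‖q m‖)
    (h : ∀ k, HasSum (fun m => u m k * p m - v m k * q m) 0) :
    HasSum (fun m => (∫ k, b k * u m k ∂μ) * p m - (∫ k, b k * v m k ∂μ) * q m) 0 := by
  have e : ∀ m, (∫ k, b k * u m k ∂μ) * p m - (∫ k, b k * v m k ∂μ) * q m =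
      ∫ k, b k * (u m k * p m - v m k * q m) ∂μ := fun m => by
    rw [← integral_mul_const, ← integral_mul_const,
      ← integral_sub (integrable_of_continuous (by fun_prop))
        (integrable_of_continuous (by fun_prop))]
    refine integral_congr_ae (ae_of_all _ fun k => ?_)
    ring
  have e0 : ∫ k, ∑' m, b k * (u m k * p m - v m k * q m) ∂μ = 0 := by
    simp only [tsum_mul_left, (h _).tsum_eq, mul_zero, integral_zero]
  simp_rw [e]
  rw [← e0]
  refine hasSum_integral_of_summable_integral_norm
    (fun m => integrable_of_continuous (by fun_prop)) ?_
  refine Summable.of_nonneg_of_le (fun m => integral_nonneg fun _ => norm_nonneg _) (fun m => ?_)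
    (((hp.add hq).mul_left (‖b‖ * K)).mul_right (μ.real univ))
  refine (Real.le_norm_self _).trans (norm_integral_le_of_norm_le_const (ae_of_all _ fun k => ?_))
  rw [norm_norm, norm_mul, mul_assoc]
  refine mul_le_mul (b.norm_coe_le_norm k) ((norm_sub_le _ _).trans ?_) (norm_nonneg _)
    (norm_nonneg _)
  rw [norm_mul, norm_mul, mul_add, ← mul_assoc, ← mul_assoc]
  gcongr
  · exact hu m k
  · exact hv m k

lemma sum_Icc_one_eq_sum_range (f : ℕ → ℂ) (N : ℕ) :
    ∑ l ∈ Finset.Icc 1 N, f l = ∑ m ∈ Finset.range N, f (m + 1) := by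
  rw [Finset.range_eq_Ico, Finset.sum_Ico_add' f 0 N 1]
  rfl

section
variable {d : ℝ} {n₀ N : ℕ} {α β : ℝ} {r t : ℝ → ℕ → ℂ}

/-- The coefficients of the incident wave. -/
def incidentCoeff (n₀ : ℕ) (α β : ℝ) (m : ℕ) : C(Icc α β, ℂ) := if m = n₀ - 1 then 1 else 0

/-- The reflection coefficients as continuous functions of the wave number. -/
def reflectionCoeff (hA : Admissible d n₀ N α β) (hαβ : α ≤ β)
    (hrt : ∀ k ∈ Icc α β, IsScatteringSolution d n₀ k (r k) (t k)) (m : ℕ) : C(Icc α β, ℂ) :=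
  ⟨fun k => r k (m + 1), (continuousOn_reflection hA hαβ hrt m).domRestrict⟩

/-- The transmission coefficients as continuous functions of the wave number. -/
def transmissionCoeff (hA : Admissible d n₀ N α β) (hαβ : α ≤ β)
    (hrt : ∀ k ∈ Icc α β, IsScatteringSolution d n₀ k (r k) (t k)) (m : ℕ) : C(Icc α β, ℂ) :=
  ⟨fun k => t k (m + 1), (continuousOn_transmission hA hαβ hrt m).domRestrict⟩

/-- The coefficients of the propagating modes. -/
def truncate (N : ℕ) (c : ℕ → C(Icc α β, ℂ)) (m : ℕ) : C(Icc α β, ℂ) := if m < N then c m else 0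

lemma incidentCoeff_bound (hn₀ : 1 ≤ n₀) (k : Icc α β) (S : Finset ℕ) :
    ∑ m ∈ S, ((m : ℝ) + 1) * ‖incidentCoeff n₀ α β m k‖ ^ 2 ≤ (n₀ : ℝ) := by
  have e : ∀ m : ℕ, ((m : ℝ) + 1) * ‖incidentCoeff n₀ α β m k‖ ^ 2 =
      if m = n₀ - 1 then (n₀ : ℝ) else 0 := fun m => by
    rw [incidentCoeff]
    split_ifs with h
    · rw [h, Nat.cast_sub hn₀]
      simp
    · simp
  rw [Finset.sum_congr rfl fun m _ => e m, Finset.sum_ite_eq']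
  split_ifs
  exacts [le_rfl, Nat.cast_nonneg _]

lemma truncate_bound {c : ℕ → C(Icc α β, ℂ)} {B : ℝ} (N : ℕ)
    (hB : ∀ k, ∀ S : Finset ℕ, ∑ m ∈ S, ((m : ℝ) + 1) * ‖c m k‖ ^ 2 ≤ B) (k : Icc α β)
    (S : Finset ℕ) : ∑ m ∈ S, ((m : ℝ) + 1) * ‖truncate N c m k‖ ^ 2 ≤ B := by
  refine (Finset.sum_le_sum fun m _ => ?_).trans (hB k S)
  rw [truncate]
  split_ifs
  · exact le_rfl
  · rw [ContinuousMap.zero_apply, norm_zero, zero_pow two_ne_zero, mul_zero]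
    positivity

lemma incidentCoeff_eq (hn₀ : 1 ≤ n₀) (m : ℕ) (k : Icc α β) :
    incidentCoeff n₀ α β m k = if m + 1 = n₀ then 1 else 0 := by
  rw [incidentCoeff]
  by_cases h : m = n₀ - 1
  · rw [if_pos h, if_pos (by omega), ContinuousMap.one_apply]
  · rw [if_neg h, if_neg (by omega), ContinuousMap.zero_apply]

variable {s : Set ℝ}

lemma prof_zero {E : C(Icc α β, ℂ)} (Φ : ModeFamily (iccMeasure α β) d s E) (b : C(Icc α β, ℂ))
    (m : ℕ) : Φ.prof b m 0 = ∫ k, b k * Φ.c m k ∂iccMeasure α β := by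
  simp [ModeFamily.prof, wave]

lemma prof'_zero {E : C(Icc α β, ℂ)} (Φ : ModeFamily (iccMeasure α β) d s E) (b : C(Icc α β, ℂ))
    (m : ℕ) : Φ.prof' b m 0 = ∫ k, b k * (Φ.τ m * Φ.c m) k ∂iccMeasure α β := by
  simp only [ModeFamily.prof', wave, ContinuousMap.mul_apply, Complex.ofReal_zero, mul_zero,
    Complex.exp_zero, mul_one]
  congr 1 with k
  ring

/-- The incident wave is a mode family with a single channel and the sign ς = -1, since -σ_{n₀-1} =
ik. -/
lemma fibre_incident (hA : Admissible d n₀ N α β) {E : C(Icc α β, ℂ)}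
    (Φ : ModeFamily (iccMeasure α β) d s E) (hτ : Φ.τ = expo d n₀ N α β (-1))
    (hc : Φ.c = incidentCoeff n₀ α β) (k : Icc α β) (x y : ℝ) :
    Φ.fibre (fun m => chiMinus d (m + 1)) k x y = incidentWave d n₀ k x y := by
  rw [ModeFamily.fibre, tsum_eq_single (n₀ - 1), hc, incidentCoeff_eq hA.one_le, hτ, expo,
    ContinuousMap.coe_mk, hA.sig_channel k.2, Nat.sub_add_cancel hA.one_le, if_pos rfl,
    incidentWave]
  · simp
  · intro m hm
    rw [hc, incidentCoeff, if_neg hm]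
    simp

lemma sum_reflected (hA : Admissible d n₀ N α β) (k : Icc α β) (ρ : ℕ → ℂ) (x y : ℝ) :
    ∑ m ∈ Finset.range N, ρ (m + 1) * Complex.exp (expo d n₀ N α β 1 m k * x) *
      chiMinus d (m + 1) y = reflectedWave d n₀ k ρ x y := by
  rw [reflectedWave, hA.exc k k.2, sum_Icc_one_eq_sum_range]
  refine Finset.sum_congr rfl fun m hm => ?_
  rw [expo, ContinuousMap.coe_mk, sig, if_pos (Finset.mem_range.1 hm), Complex.ofReal_one, one_mul]

lemma sum_transmitted (hA : Admissible d n₀ N α β) (k : Icc α β) (ρ : ℕ → ℂ) (x y : ℝ) :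
    ∑ m ∈ Finset.range N, ρ (m + 1) * Complex.exp (expo d n₀ N α β (-1) m k * x) *
      chiPlus d (m + 1) y = transmittedWave d n₀ k ρ x y := by
  rw [transmittedWave, hA.exc k k.2, sum_Icc_one_eq_sum_range]
  refine Finset.sum_congr rfl fun m hm => ?_
  rw [expo, ContinuousMap.coe_mk, sig, if_pos (Finset.mem_range.1 hm)]
  congr 3
  push_cast
  ring

lemma tsum_truncate {c : ℕ → C(Icc α β, ℂ)} (k : Icc α β) (w : ℕ → ℂ) (v : ℕ → ℂ) :
    ∑' m, truncate N c m k * w m * v m = ∑ m ∈ Finset.range N, c m k * w m * v m := by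
  rw [tsum_eq_sum (s := Finset.range N) fun m hm => ?_]
  · refine Finset.sum_congr rfl fun m hm => ?_
    rw [truncate, if_pos (Finset.mem_range.1 hm)]
  · rw [truncate, if_neg (by simpa using hm)]
    simp

/-- Splits the series at N into propagating and evanescent modes. Channel m + N counted from 0 is
mode N + 1 + m counted from 1. -/
lemma fibre_reflected (hA : Admissible d n₀ N α β) {E : C(Icc α β, ℂ)}
    (Φ : ModeFamily (iccMeasure α β) d (Iio 0) E) (hτ : Φ.τ = expo d n₀ N α β 1)
    (k : Icc α β) {ρ : ℕ → ℂ} (hc : ∀ m, Φ.c m k = ρ (m + 1)) {x : ℝ} (hx : x < 0) (y : ℝ) :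
    Φ.fibre (fun m => chiMinus d (m + 1)) k x y = reflectedWave d n₀ k ρ x y +
      ∑' m : ℕ, ρ (nExc d n₀ k + 1 + m) *
        Complex.exp (decayRate d n₀ k (nExc d n₀ k + 1 + m) * x) *
        chiMinus d (nExc d n₀ k + 1 + m) y := by
  have h := Φ.summable_fibre (transverse_minus hA.pos_d) (mem_Iio.2 hx) k y
  rw [ModeFamily.fibre, ← h.sum_add_tsum_nat_add N, ← sum_reflected hA, hA.exc k k.2, hτ]
  simp only [hc]
  congr 1
  refine tsum_congr fun m => ?_
  rw [expo, ContinuousMap.coe_mk, sig, if_neg (by omega), Complex.ofReal_one, one_mul,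
    show m + N + 1 = N + 1 + m by omega]

lemma fibre_transmitted (hA : Admissible d n₀ N α β) {E : C(Icc α β, ℂ)}
    (Φ : ModeFamily (iccMeasure α β) d (Ioi 0) E) (hτ : Φ.τ = expo d n₀ N α β (-1))
    (k : Icc α β) {ρ : ℕ → ℂ} (hc : ∀ m, Φ.c m k = ρ (m + 1)) {x : ℝ} (hx : 0 < x) (y : ℝ) :
    Φ.fibre (fun m => chiPlus d (m + 1)) k x y = transmittedWave d n₀ k ρ x y +
      ∑' m : ℕ, ρ (nExc d n₀ k + 1 + m) *
        Complex.exp (-decayRate d n₀ k (nExc d n₀ k + 1 + m) * x) *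
        chiPlus d (nExc d n₀ k + 1 + m) y := by
  have h := Φ.summable_fibre (transverse_plus hA.pos_d) (mem_Ioi.2 hx) k y
  rw [ModeFamily.fibre, ← h.sum_add_tsum_nat_add N, ← sum_transmitted hA, hA.exc k k.2, hτ]
  simp only [hc]
  congr 1
  refine tsum_congr fun m => ?_
  rw [expo, ContinuousMap.coe_mk, sig, if_neg (by omega), Complex.ofReal_neg, Complex.ofReal_one,
    neg_one_mul, show m + N + 1 = N + 1 + m by omega]

lemma incidentCoeff_eq_zero (hA : Admissible d n₀ N α β) (hαβ : α ≤ β) {m : ℕ} (hm : N ≤ m) :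
    incidentCoeff n₀ α β m = 0 := by
  have := hA.lt_exc.resolve_right (nonempty_iff_ne_empty.1 (nonempty_Icc.2 hαβ))
  rw [incidentCoeff, if_neg (by omega)]

/-- The incident wave packet. -/
theorem packetSolves_incident (hA : Admissible d n₀ N α β) (hαβ : α ≤ β) {a : ℝ → ℂ}
    (ha : Continuous a) (hsupp : tsupport a ⊆ Icc α β) :
    PacketSolves d n₀ a (-laplaceDN d) (incidentWave d n₀) := by
  obtain ⟨Φ, hτ, hc⟩ := exists_modeFamily hA hαβ (s := univ) .univ (ς := -1) (by norm_num)
    (incidentCoeff n₀ α β) (incidentCoeff_bound hA.one_le)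
    (Or.inl fun m => incidentCoeff_eq_zero hA hαβ)
  exact packetSolves_of_modes hA.pos_d Φ (transverse_minus hA.pos_d) ha hsupp
    (Or.inl fun m => chiMinus_zero d _) (Or.inr rfl) (Or.inr rfl)
    (Or.inl (chiPlus_top hA.pos_d)) fun k x y => (fibre_incident hA Φ hτ hc k x y).symm

/-- The reflected wave packet. -/
theorem packetSolves_reflected (hA : Admissible d n₀ N α β) (hαβ : α ≤ β)
    (hrt : ∀ k ∈ Icc α β, IsScatteringSolution d n₀ k (r k) (t k)) {a : ℝ → ℂ}
    (ha : Continuous a) (hsupp : tsupport a ⊆ Icc α β) :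
    PacketSolves d n₀ a (-laplaceDN d) fun k => reflectedWave d n₀ k (r k) := by
  obtain ⟨B, -, hB⟩ := exists_coefficient_bound hA hαβ hrt
  obtain ⟨Φ, hτ, hc⟩ := exists_modeFamily hA hαβ (s := univ) .univ (ς := 1) (by norm_num)
    -- Only open channels are kept, so the waves are bounded on the whole line and the packet
    -- extends across x = 0 without boundary terms.
    (truncate N (reflectionCoeff hA hαβ hrt)) (truncate_bound N fun k S => (hB k k.2 S).1)
    (Or.inl fun m hm => if_neg hm.not_gt)
  refine packetSolves_of_modes hA.pos_d Φ (transverse_minus hA.pos_d) ha hsupp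
    (Or.inl fun m => chiMinus_zero d _) (Or.inr rfl) (Or.inr rfl)
    (Or.inl (chiPlus_top hA.pos_d)) fun k x y => ?_
  rw [ModeFamily.fibre, hτ, hc, tsum_truncate, ← sum_reflected hA]
  rfl

/-- The transmitted wave packet. -/
theorem packetSolves_transmitted (hA : Admissible d n₀ N α β) (hαβ : α ≤ β)
    (hrt : ∀ k ∈ Icc α β, IsScatteringSolution d n₀ k (r k) (t k)) {a : ℝ → ℂ}
    (ha : Continuous a) (hsupp : tsupport a ⊆ Icc α β) :
    PacketSolves d n₀ a (-laplaceND d) fun k => transmittedWave d n₀ k (t k) := by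
  obtain ⟨B, -, hB⟩ := exists_coefficient_bound hA hαβ hrt
  obtain ⟨Φ, hτ, hc⟩ := exists_modeFamily hA hαβ (s := univ) .univ (ς := -1) (by norm_num)
    (truncate N (transmissionCoeff hA hαβ hrt)) (truncate_bound N fun k S => (hB k k.2 S).2)
    (Or.inl fun m hm => if_neg hm.not_gt)
  refine packetSolves_of_modes hA.pos_d Φ (transverse_plus hA.pos_d) ha hsupp (Or.inr rfl)
    (Or.inl (chiPlus_top hA.pos_d)) (Or.inl fun m => by rw [chiMinus_zero, neg_zero])
    (Or.inr rfl) fun k x y => ?_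
  rw [ModeFamily.fibre, hτ, hc, tsum_truncate, ← sum_transmitted hA]
  rfl

/-- The wave packet built from the generalized eigenfunctions. -/
theorem packetSolves_eigenfunction (hA : Admissible d n₀ N α β) (hαβ : α ≤ β)
    (hrt : ∀ k ∈ Icc α β, IsScatteringSolution d n₀ k (r k) (t k)) {a : ℝ → ℂ}
    (ha : Continuous a) (hsupp : tsupport a ⊆ Icc α β) :
    PacketSolves d n₀ a (hamiltonian d) fun k => eigenfunction d n₀ k (r k) (t k) := by
  have hd := hA.pos_d
  obtain ⟨B, B0, hB⟩ := exists_coefficient_bound hA hαβ hrt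
  have hB₂ : ∀ (k : Icc α β) (S : Finset ℕ),
      ∑ m ∈ S, ((m : ℝ) + 1) * ‖reflectionCoeff hA hαβ hrt m k‖ ^ 2 ≤ B :=
    fun k S => (hB k k.2 S).1
  have hB₃ : ∀ (k : Icc α β) (S : Finset ℕ),
      ∑ m ∈ S, ((m : ℝ) + 1) * ‖transmissionCoeff hA hαβ hrt m k‖ ^ 2 ≤ B :=
    fun k S => (hB k k.2 S).2
  -- On the left the incident and reflected waves have opposite exponents in the same channel, so
  -- they need separate families. The sign ς is 1 for the reflected and -1 for the transmitted
  -- family, so that closed channels decay away from x = 0.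
  obtain ⟨Φ₁, hτ₁, hc₁⟩ := exists_modeFamily hA hαβ measurableSet_Iio (ς := -1) (by norm_num)
    (incidentCoeff n₀ α β) (incidentCoeff_bound hA.one_le)
    (Or.inl fun m => incidentCoeff_eq_zero hA hαβ)
  obtain ⟨Φ₂, hτ₂, hc₂⟩ := exists_modeFamily hA hαβ measurableSet_Iio (ς := 1) (by norm_num)
    (reflectionCoeff hA hαβ hrt) hB₂
    (Or.inr ⟨lt_irrefl (0 : ℝ), fun x hx => by rw [abs_of_neg hx]; ring⟩)
  obtain ⟨Φ₃, hτ₃, hc₃⟩ := exists_modeFamily hA hαβ measurableSet_Ioi (ς := -1) (by norm_num)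
    (transmissionCoeff hA hαβ hrt) hB₃
    (Or.inr ⟨lt_irrefl (0 : ℝ), fun x hx => by rw [abs_of_pos hx]; ring⟩)
  have hi : ∀ m (k : Icc α β), ‖incidentCoeff n₀ α β m k‖ ≤ 1 := fun m k => by
    rw [incidentCoeff_eq hA.one_le]
    split_ifs <;> simp
  have hone : ∀ m : ℕ, (1 : ℝ) ≤ (m : ℝ) + 1 := fun m => by
    linarith [Nat.cast_nonneg (α := ℝ) m]
  have hsq : ∀ m : ℕ, (1 : ℝ) ≤ ((m : ℝ) + 1) ^ 2 := fun m => one_le_pow₀ (hone m)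
  have hinc : ∀ m (k : Icc α β), leftTrace n₀ (r k) (m + 1) =
      incidentCoeff n₀ α β m k + reflectionCoeff hA hαβ hrt m k := fun m k => by
    rw [incidentCoeff_eq hA.one_le]; rfl
  refine packetSolves_of_matching hd Φ₁ Φ₂ Φ₃ ha hsupp (fun b g hg => ?_) (fun b g hg => ?_)
    (fun k x hx y => ?_) (fun k x hx y => ?_)
  · have := hasSum_integral_matching (μ := iccMeasure α β) b
      (u := fun m => incidentCoeff n₀ α β m + reflectionCoeff hA hαβ hrt m)
      (v := transmissionCoeff hA hαβ hrt) (K := 2 + B)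
      (fun m k => ?_) (fun m k => ?_)
      ((transverse_minus hd).summable_coeff hd hg) ((transverse_plus hd).summable_coeff hd hg)
      (fun k => ?_)
    · refine this.congr_fun fun m => ?_
      rw [prof_zero, prof_zero, prof_zero, hc₁, hc₂, hc₃,
        ← integral_add (integrable_of_continuous (by fun_prop))
          (integrable_of_continuous (by fun_prop))]
      simp only [ContinuousMap.add_apply, mul_add]
    · refine ((norm_add_le _ _).trans (add_le_add (hi m k) (norm_le_of_bound hB₂ m k))).trans ?_
      nlinarith [hsq m]
    · refine (norm_le_of_bound hB₃ m k).trans ?_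
      nlinarith [hsq m]
    · obtain ⟨z, h1, h2⟩ := matching_test hd (hrt k k.2) hg
      have h3 := h1.sub h2
      rw [sub_self] at h3
      refine h3.congr_fun fun m => ?_
      rw [hinc]
      rfl
  · obtain ⟨C, C0, hC⟩ := hA.exists_upper
    have := hasSum_integral_matching (μ := iccMeasure α β) b
      (u := fun m => expo d n₀ N α β (-1) m * incidentCoeff n₀ α β m +
        expo d n₀ N α β 1 m * reflectionCoeff hA hαβ hrt m)
      (v := fun m => expo d n₀ N α β (-1) m * transmissionCoeff hA hαβ hrt m) (K := C * (2 + B))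
      (fun m k => ?_) (fun m k => ?_)
      ((transverse_minus hd).summable_coeff hd hg) ((transverse_plus hd).summable_coeff hd hg)
      (fun k => ?_)
    · refine this.congr_fun fun m => ?_
      rw [prof'_zero, prof'_zero, prof'_zero, hc₁, hc₂, hc₃, hτ₁, hτ₂, hτ₃,
        ← integral_add (integrable_of_continuous (by fun_prop))
          (integrable_of_continuous (by fun_prop))]
      simp only [ContinuousMap.add_apply, mul_add]
    · have h1 : ‖expo d n₀ N α β (-1) m k‖ ≤ C * ((m : ℝ) + 1) := by
        simpa [expo] using hC k k.2 m
      have h2 : ‖expo d n₀ N α β 1 m k‖ ≤ C * ((m : ℝ) + 1) := by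
        simpa [expo] using hC k k.2 m
      have h3 : 0 ≤ C * ((m : ℝ) + 1) := (norm_nonneg _).trans h1
      calc _ ≤ C * ((m : ℝ) + 1) * 1 + C * ((m : ℝ) + 1) * (1 + B) := by
            refine (norm_add_le _ _).trans (add_le_add ?_ ?_)
            · rw [ContinuousMap.mul_apply, norm_mul]
              exact mul_le_mul h1 (hi m k) (norm_nonneg _) h3
            · rw [ContinuousMap.mul_apply, norm_mul]
              exact mul_le_mul h2 (norm_le_of_bound hB₂ m k) (norm_nonneg _) h3
        _ = C * (2 + B) * ((m : ℝ) + 1) := by ring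
        _ ≤ _ := by
            gcongr
            nlinarith [hone m]
    · have h1 : ‖expo d n₀ N α β (-1) m k‖ ≤ C * ((m : ℝ) + 1) := by
        simpa [expo] using hC k k.2 m
      have h3 : 0 ≤ C * ((m : ℝ) + 1) := (norm_nonneg _).trans h1
      calc _ ≤ C * ((m : ℝ) + 1) * (2 + B) := by
            rw [ContinuousMap.mul_apply, norm_mul]
            exact mul_le_mul h1 ((norm_le_of_bound hB₃ m k).trans (by linarith)) (norm_nonneg _) h3
        _ = C * (2 + B) * ((m : ℝ) + 1) := by ring
        _ ≤ _ := by
            gcongr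
            nlinarith [hone m]
    · have h1 := matching_deriv_test hA k.2 (hrt k k.2) hg
      -- Subtracting twice the incident term changes σ(δ + r) into -σδ + σr, the true derivative
      -- with exponent -σ for the incident wave; since σ = -ik there, this is exactly the source
      -- term.
      have h2 : HasSum (fun m => 2 * (sig d n₀ N m k * (incidentCoeff n₀ α β m k *
          coeff (chiMinus d (m + 1)) g)))
          (-2 * Complex.I * k * coeff (chiMinus d (n₀ - 1 + 1)) g) := by
        have e : -2 * Complex.I * k * coeff (chiMinus d (n₀ - 1 + 1)) g =
            2 * (sig d n₀ N (n₀ - 1) k * (incidentCoeff n₀ α β (n₀ - 1) k *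
              coeff (chiMinus d (n₀ - 1 + 1)) g)) := by
          rw [hA.sig_channel k.2, incidentCoeff, if_pos rfl, ContinuousMap.one_apply]
          ring
        rw [e]
        refine hasSum_single (n₀ - 1) fun m hm => ?_
        rw [incidentCoeff, if_neg hm]
        simp
      have h3 := h1.sub h2
      rw [sub_self] at h3
      refine h3.congr_fun fun m => ?_
      have e : t k (m + 1) = transmissionCoeff hA hαβ hrt m k := rfl
      rw [hinc, e]
      simp only [ContinuousMap.add_apply, ContinuousMap.mul_apply, expo, ContinuousMap.coe_mk,
        Complex.ofReal_neg, Complex.ofReal_one]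
      ring
  · rw [fibre_incident hA Φ₁ hτ₁ hc₁, fibre_reflected hA Φ₂ hτ₂ k (ρ := r k)
      (fun m => by rw [hc₂]; rfl) hx, eigenfunction, if_pos hx, add_assoc]
  · rw [fibre_transmitted hA Φ₃ hτ₃ k (ρ := t k) (fun m => by rw [hc₃]; rfl) hx, eigenfunction,
      if_neg (not_lt.2 hx.le)]
end

end Waveguide

theorem mainTheorem5 (d : ℝ) (hd : 0 < d) (n₀ : ℕ) (hn₀ : 1 ≤ n₀)
    (α β : ℝ) (hαβ : α < β)
    (hM : Set.Icc α β ⊆ Set.Ioi 0 \ Waveguide.thresholds d n₀)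
    (a : ℝ → ℂ) (ha : ContDiff ℝ ∞ a) (hsupp : tsupport a ⊆ Set.Icc α β)
    (r t : ℝ → ℕ → ℂ)
    (hrt : ∀ k ∈ Set.Icc α β, Waveguide.IsScatteringSolution d n₀ k (r k) (t k)) :
    Waveguide.PacketSolves d n₀ a (Waveguide.hamiltonian d)
      (fun k => Waveguide.eigenfunction d n₀ k (r k) (t k)) ∧
    Waveguide.PacketSolves d n₀ a (-Waveguide.laplaceDN d)
      (fun k => Waveguide.incidentWave d n₀ k) ∧
    Waveguide.PacketSolves d n₀ a (-Waveguide.laplaceDN d)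
      (fun k => Waveguide.reflectedWave d n₀ k (r k)) ∧
    Waveguide.PacketSolves d n₀ a (-Waveguide.laplaceND d)
      (fun k => Waveguide.transmittedWave d n₀ k (t k)) := by
  -- The interval contains no threshold, so the number of open channels may be read off at α.
  have hA : Waveguide.Admissible d n₀ (Waveguide.nExc d n₀ α) α β :=
    ⟨hd, hn₀, hM, fun k hk => Waveguide.nExc_eq hd hM hk (left_mem_Icc.2 hαβ.le)⟩
  exact ⟨Waveguide.packetSolves_eigenfunction hA hαβ.le hrt ha.continuous hsupp,
    Waveguide.packetSolves_incident hA hαβ.le ha.continuous hsupp,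
    Waveguide.packetSolves_reflected hA hαβ.le hrt ha.continuous hsupp,
    Waveguide.packetSolves_transmitted hA hαβ.le hrt ha.continuous hsupp⟩
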